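/- Consider a single-item first-price auction between two bidders, the optimizer and the learner, in which all values and bids lie in the grid $\mathcal I=\{k\varepsilon : 0\le k\le N-1\}$ ($N\ge 1$, $\varepsilon>0$). The optimizer's value is $v_O\in\mathcal I$, and the learner's value $v$ is drawn from a known prior distribution $p$ on $\mathcal I$. The higher bid wins and is paid by the winner, ties are won by the learner, and the loser gets and pays nothing; so for an optimizer's bid $i$ and a pure strategy $f:\mathcal I\to\mathcal I$ of the learner, the learner's expected utility is $u_L(i,f)=\sum_{v\in\mathcal I}p_v\,(v-f(v))\,\mathbf 1[i\le f(v)]$, and for a mixed strategy $\beta$ (a distribution over pure strategies) it is $u_L(i,\beta)=\sum_f\beta_f\,u_L(i,f)$. The auction is repeated for $T$ rounds; in round $t$ the optimizer bids $i_t$, revealed after the round, and the learner uses a mixed strategy $\beta_t$. The polytope swap regret of the learner is $$\mathsf{Reg}_{\mathsf{poly}}=\min_{\rho_1\in[\beta_1],\dots,\rho_T\in[\beta_T]}\ \max_{\pi:\mathcal I^{\mathcal I}\to\mathcal I^{\mathcal I}}\ \sum_{t=1}^T\Big(\sum_{f}\rho_{t,f}\,u_L(i_t,\pi(f))-u_L(i_t,\beta_t)\Big),$$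 where $[\beta]$ is the set of mixed strategies that, conditioned on each value, play each bid with the same probability as $\beta$. There are absolute constants $K$, $b$ and $a>0$ and a learning algorithm (a program for a random access machine over the reals in which every operation $+,-,\times,\div,\sqrt{\ }$, comparison, memory access and assignment costs one step) that is given $N,\varepsilon,p,T$ and, in each round $t$, the optimizer's past bids $i_1,\dots,i_{t-1}$, and that computes in each round $t$ the probabilities with which $\beta_t$ plays each bid conditioned on each value, such that for every such auction, every $T$ and every sequence $i_1,\dots,i_T$ of bids of the optimizer: 1. the algorithm runs in time $2^{\Theta(N)}$ per round: its number of steps in each round lies between $2^{aN}$ and $2^{bN}$; 2. it guarantees $\mathsf{Reg}_{\mathsf{poly}}\le K\,\varepsilon\,\sqrt{4^N\,N\,T}$, i.e. $\mathsf{Reg}_{\mathsf{poly}}=O(\sqrt{4^N N\cdot T})$ for constant grid width $\varepsilon$. -/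

import Mathlib

open scoped BigOperators

noncomputable section

/-! ## Finite Bayesian games and polytope swap regret -/

/-- A finite Bayesian bimatrix game: `M` actions of the optimizer, `N` actions of the learner, `C`
contexts with prior `p`, and the two utilities, as functions of the optimizer's action, the
learner's action and the context. -/
structure BayesianGame (M N C : ℕ) where
  p : Fin C → ℝ
  p_mem : p ∈ stdSimplex ℝ (Fin C)
  uO : Fin M → Fin N → Fin C → ℝ
  uL : Fin M → Fin N → Fin C → ℝ

/-- Pure strategies of the learner: maps from contexts to actions. -/
abbrev PureStrategy (N C : ℕ) : Type := Fin C → Fin N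

/-- Mixed strategies of the learner: probability vectors over pure strategies. -/
abbrev MixedStrategy (N C : ℕ) : Type := stdSimplex ℝ (PureStrategy N C)

/-- The probability that the mixed strategy `β` plays action `j` conditioned on context `c`. -/
def MixedStrategy.marginal {N C : ℕ} (β : MixedStrategy N C) (c : Fin C) (j : Fin N) : ℝ :=
  ∑ f : PureStrategy N C with f c = j, β.1 f

/-- Two mixed strategies are equivalent if, conditioned on every context, they play every action
with the same probability. -/
def MixedStrategy.Equivalent {N C : ℕ} (β ρ : MixedStrategy N C) : Prop :=
  ∀ c j, β.marginal c j = ρ.marginal c j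

namespace BayesianGame

variable {M N C : ℕ}

/-- The learner's expected utility `u_L(i, f)`, for a pure strategy `f`. -/
def uLPure (G : BayesianGame M N C) (i : Fin M) (f : PureStrategy N C) : ℝ :=
  ∑ c, G.p c * G.uL i (f c) c

/-- The learner's expected utility `u_L(i, β)`, for a mixed strategy `β`. -/
def uLMixed (G : BayesianGame M N C) (i : Fin M) (β : MixedStrategy N C) : ℝ :=
  ∑ f, ∑ c, β.1 f * G.p c * G.uL i (f c) c

/-- The gain from replacing every pure strategy `f` by `π f` in the mixed strategies `ρ t`, over
the utility of the mixed strategies `β t`, when the optimizer plays `i t` in round `t`. -/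
def swapGain (G : BayesianGame M N C) {T : ℕ} (i : Fin T → Fin M) (β ρ : Fin T → MixedStrategy N C)
    (π : PureStrategy N C → PureStrategy N C) : ℝ :=
  ∑ t, ((∑ f, (ρ t).1 f * G.uLPure (i t) (π f)) - G.uLMixed (i t) (β t))

/-- Polytope swap regret: the minimum, over all `ρ` with `ρ t` equivalent to `β t` for all `t`, of
the maximum of the swap gain over all maps `π` from pure strategies to pure strategies. -/
def polytopeSwapRegret (G : BayesianGame M N C) {T : ℕ} (i : Fin T → Fin M)
    (β : Fin T → MixedStrategy N C) : ℝ :=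
  ⨅ ρ : {ρ : Fin T → MixedStrategy N C // ∀ t, (β t).Equivalent (ρ t)},
    ⨆ π : PureStrategy N C → PureStrategy N C, G.swapGain i β ρ.1 π

end BayesianGame

/-! ## Bayesian first-price auctions -/

/-- The data of a Bayesian first-price auction in which all values and bids are in the discrete
space `{k * ε | k = 0, …, N - 1}`, whose elements are represented by their indices `k : Fin N`:
the grid width `ε`, the optimizer's value and the prior distribution of the learner's value. -/
structure FirstPriceAuction (N : ℕ) where
  ε : ℝ
  ε_pos : 0 < ε
  vO : Fin N
  prior : Fin N → ℝ
  prior_mem : prior ∈ stdSimplex ℝ (Fin N)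

/-- The Bayesian game of a first-price auction. Actions are bids, the context is the learner's
value, the higher bid wins and is paid by the winner, and the learner wins ties. -/
def FirstPriceAuction.game {N : ℕ} (A : FirstPriceAuction N) : BayesianGame N N N where
  p := A.prior
  p_mem := A.prior_mem
  uO i j _ := if j < i then ((A.vO : ℕ) : ℝ) * A.ε - ((i : ℕ) : ℝ) * A.ε else 0
  uL i j c := if i ≤ j then ((c : ℕ) : ℝ) * A.ε - ((j : ℕ) : ℝ) * A.ε else 0

/-! ## Programs for a random access machine over the reals, with exact step counts

The memory consists of integer arrays and real arrays, named by natural numbers and indexed by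
natural numbers (a program names only finitely many arrays, so this is the usual random access
memory with indirect addressing). Every arithmetic operation, comparison, memory access and
assignment takes one step. -/

namespace RealRAM

/-- Contents of the memory: `nat a k` and `real a k` are the cells with index `k` of the integer
array and of the real array with name `a`. -/
structure Mem where
  nat : ℕ → ℕ → ℕ
  real : ℕ → ℕ → ℝ

/-- Write a natural number into a cell of an integer array. -/
def Mem.setNat (s : Mem) (a k x : ℕ) : Mem :=
  { s with nat := Function.update s.nat a (Function.update (s.nat a) k x) }

/-- Write a real number into a cell of a real array. -/
def Mem.setReal (s : Mem) (a k : ℕ) (x : ℝ) : Mem :=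
  { s with real := Function.update s.real a (Function.update (s.real a) k x) }

/-- Integer expressions; subtraction is truncated at `0`. -/
inductive NatExpr where
  | lit (k : ℕ)
  | get (a : ℕ) (k : NatExpr)
  | add (x y : NatExpr)
  | sub (x y : NatExpr)
  | mul (x y : NatExpr)

/-- The value of an integer expression. -/
def NatExpr.eval (s : Mem) : NatExpr → ℕ
  | .lit k => k
  | .get a k => s.nat a (k.eval s)
  | .add x y => x.eval s + y.eval s
  | .sub x y => x.eval s - y.eval s
  | .mul x y => x.eval s * y.eval s

/-- The number of steps that the evaluation of an integer expression takes. -/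
def NatExpr.cost : NatExpr → ℕ
  | .lit _ => 1
  | .get _ k => k.cost + 1
  | .add x y => x.cost + y.cost + 1
  | .sub x y => x.cost + y.cost + 1
  | .mul x y => x.cost + y.cost + 1

/-- Real expressions. There are no real constants other than (casts of) natural numbers, and there
is no conversion of reals into integers. A quotient by `0` and the root of a negative number have
the value `0`. -/
inductive RealExpr where
  | cast (k : NatExpr)
  | get (a : ℕ) (k : NatExpr)
  | add (x y : RealExpr)
  | sub (x y : RealExpr)
  | mul (x y : RealExpr)
  | div (x y : RealExpr)
  | sqrt (x : RealExpr)

/-- The value of a real expression. -/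
def RealExpr.eval (s : Mem) : RealExpr → ℝ
  | .cast k => (k.eval s : ℝ)
  | .get a k => s.real a (k.eval s)
  | .add x y => x.eval s + y.eval s
  | .sub x y => x.eval s - y.eval s
  | .mul x y => x.eval s * y.eval s
  | .div x y => x.eval s / y.eval s
  | .sqrt x => Real.sqrt (x.eval s)

/-- The number of steps that the evaluation of a real expression takes. -/
def RealExpr.cost : RealExpr → ℕ
  | .cast k => k.cost + 1
  | .get _ k => k.cost + 1
  | .add x y => x.cost + y.cost + 1
  | .sub x y => x.cost + y.cost + 1
  | .mul x y => x.cost + y.cost + 1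
  | .div x y => x.cost + y.cost + 1
  | .sqrt x => x.cost + 1

/-- Tests. -/
inductive Test where
  | natLe (x y : NatExpr)
  | realLe (x y : RealExpr)
  | not (b : Test)
  | and (b c : Test)

/-- A test holds in a given memory. -/
def Test.Holds (s : Mem) : Test → Prop
  | .natLe x y => x.eval s ≤ y.eval s
  | .realLe x y => x.eval s ≤ y.eval s
  | .not b => ¬ b.Holds s
  | .and b c => b.Holds s ∧ c.Holds s

/-- The number of steps that a test takes. -/
def Test.cost : Test → ℕ
  | .natLe x y => x.cost + y.cost + 1
  | .realLe x y => x.cost + y.cost + 1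
  | .not b => b.cost + 1
  | .and b c => b.cost + c.cost + 1

/-- Programs. `setNat a k x` is the assignment `a[k] := x` to an integer array, `setReal a k x` the
one to a real array, and `loop b P` repeats `P` as long as `b` holds. -/
inductive Program where
  | skip
  | setNat (a : ℕ) (k x : NatExpr)
  | setReal (a : ℕ) (k : NatExpr) (x : RealExpr)
  | seq (P Q : Program)
  | cond (b : Test) (P Q : Program)
  | loop (b : Test) (P : Program)

/-- `Runs P s s' n`: the program `P`, started with memory `s`, halts after exactly `n` steps with
memory `s'`. -/
inductive Runs : Program → Mem → Mem → ℕ → Prop where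
  | skip (s : Mem) : Runs .skip s s 1
  | setNat (s : Mem) (a : ℕ) (k x : NatExpr) :
      Runs (.setNat a k x) s (s.setNat a (k.eval s) (x.eval s)) (k.cost + x.cost + 1)
  | setReal (s : Mem) (a : ℕ) (k : NatExpr) (x : RealExpr) :
      Runs (.setReal a k x) s (s.setReal a (k.eval s) (x.eval s)) (k.cost + x.cost + 1)
  | seq {P Q : Program} {s s₁ s₂ : Mem} {m n : ℕ} (hP : Runs P s s₁ m) (hQ : Runs Q s₁ s₂ n) :
      Runs (.seq P Q) s s₂ (m + n)
  | condTrue {b : Test} {P Q : Program} {s s₁ : Mem} {n : ℕ} (hb : b.Holds s)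
      (hP : Runs P s s₁ n) : Runs (.cond b P Q) s s₁ (b.cost + 1 + n)
  | condFalse {b : Test} {P Q : Program} {s s₁ : Mem} {n : ℕ} (hb : ¬ b.Holds s)
      (hQ : Runs Q s s₁ n) : Runs (.cond b P Q) s s₁ (b.cost + 1 + n)
  | loopDone {b : Test} {P : Program} {s : Mem} (hb : ¬ b.Holds s) :
      Runs (.loop b P) s s (b.cost + 1)
  | loopStep {b : Test} {P : Program} {s s₁ s₂ : Mem} {m n : ℕ} (hb : b.Holds s)
      (hP : Runs P s s₁ m) (hL : Runs (.loop b P) s₁ s₂ n) :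
      Runs (.loop b P) s s₂ (b.cost + 1 + m + n)

/-- Programs are deterministic: final memory and number of steps are determined by the program and
the initial memory. -/
theorem Runs.unique {P : Program} {s s₁ s₂ : Mem} {m n : ℕ} (h₁ : Runs P s s₁ m)
    (h₂ : Runs P s s₂ n) : s₁ = s₂ ∧ m = n := by
  induction h₁ generalizing s₂ n with
  | skip => cases h₂; exact ⟨rfl, rfl⟩
  | setNat => cases h₂; exact ⟨rfl, rfl⟩
  | setReal => cases h₂; exact ⟨rfl, rfl⟩
  | seq _ _ ihP ihQ =>
    cases h₂ with
    | seq hP hQ =>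
      obtain ⟨rfl, rfl⟩ := ihP hP
      obtain ⟨rfl, rfl⟩ := ihQ hQ
      exact ⟨rfl, rfl⟩
  | condTrue hb _ ih =>
    cases h₂ with
    | condTrue _ hP => obtain ⟨rfl, rfl⟩ := ih hP; exact ⟨rfl, rfl⟩
    | condFalse hb' _ => exact absurd hb hb'
  | condFalse hb _ ih =>
    cases h₂ with
    | condTrue hb' _ => exact absurd hb' hb
    | condFalse _ hP => obtain ⟨rfl, rfl⟩ := ih hP; exact ⟨rfl, rfl⟩
  | loopDone hb =>
    cases h₂ with
    | loopDone => exact ⟨rfl, rfl⟩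
    | loopStep hb' _ _ => exact absurd hb' hb
  | loopStep hb _ _ ihP ihL =>
    cases h₂ with
    | loopDone hb' => exact absurd hb hb'
    | loopStep _ hP hL =>
      obtain ⟨rfl, rfl⟩ := ihP hP
      obtain ⟨rfl, rfl⟩ := ihL hL
      exact ⟨rfl, rfl⟩

end RealRAM

/-! ## Learning algorithms for repeated first-price auctions -/

/-- The memory before the first round. It holds the public data: the integers `N` and `T` in
`nat 0 0` and `nat 0 1`, the grid width `ε` in `real 0 0`, and the prior probability of value `v`
in `real 1 v`. All other cells are `0`. -/
def initialMem {N : ℕ} (A : FirstPriceAuction N) (T : ℕ) : RealRAM.Mem where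
  nat a k := if a = 0 ∧ k = 0 then N else if a = 0 ∧ k = 1 then T else 0
  real a k :=
    if a = 0 ∧ k = 0 then A.ε
    else if a = 1 then (if h : k < N then A.prior ⟨k, h⟩ else 0)
    else 0

/-- After each round the learner observes the bid of the optimizer in that round: its index is
written into the cell `nat 0 2`. -/
def observeBid (s : RealRAM.Mem) (i : ℕ) : RealRAM.Mem := s.setNat 0 2 i

/-- What a program has computed at the end of its run in a round: the cell `real 2 (c * N + j)`
holds the probability with which the learner bids `j`, conditioned on its value being `c`. -/
def outputProb (N : ℕ) (s : RealRAM.Mem) (c j : Fin N) : ℝ := s.real 2 ((c : ℕ) * N + (j : ℕ))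

/-- The learner uses the program `P` in `T` rounds of the auction `A`, in which the optimizer bids
`i 0, …, i (T - 1)`. In every round the program is run once, on the memory left by the previous
round together with the optimizer's previous bid; `final t` is the memory at the end of
the run in round `t`, and `steps t` is the number of steps of that run. -/
structure IsPlay {N : ℕ} (A : FirstPriceAuction N) (P : RealRAM.Program) {T : ℕ}
    (i : Fin T → Fin N) (final : Fin T → RealRAM.Mem) (steps : Fin T → ℕ) : Prop where
  first : ∀ h : 0 < T, RealRAM.Runs P (initialMem A T) (final ⟨0, h⟩) (steps ⟨0, h⟩)
  next : ∀ (t : ℕ) (h : t + 1 < T),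
    RealRAM.Runs P (observeBid (final ⟨t, by omega⟩) (i ⟨t, by omega⟩ : ℕ))
      (final ⟨t + 1, h⟩) (steps ⟨t + 1, h⟩)

end

/-! The learner plays a swap-to-external-regret reduction whose states are only the nondecreasing
strategies `f` with `f v ≤ v`. They are counted by the Catalan number (`length_monotoneBids_mul`),
which is at most `4 ^ N / N ^ (3 / 2)`.

Each such strategy `f` owns an external-regret learner. For every value `v` this learner uses
multiplicative weights over the bids; bid `b` has weight `W b ^ (v - b)`, where `W b` is the product
of the factors `1 + η ρ_t(f)` over the rounds that `b` would have won. A higher bid wins more often,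
so `W` is nondecreasing. The bid distributions therefore have a monotone likelihood ratio in `v` and
increase stochastically (`cumProb_succ_le`). Reading all of them at one common quantile `u ∈ [0, 1)`
yields a nondecreasing strategy without overbids, so the recommendation of each learner is realised
by a distribution on the same Catalan list (`sum_coupling`).

The play `ρ_t` is a stationary distribution of the chain that moves from `f` according to the
coupling of learner `f`. Its marginals are then the `ρ_t`-average of the recommendations, and the
gain of a swap `π` splits into the external regrets of the learners against `π f`, round `t` being
weighted by `ρ_t(f)` (`swapGain_mixture`). Polytope swap regret allows any decomposition with the
right marginals, so `ρ_t` bounds it (`polytopeSwapRegret_le`). By `regret_multiplicativeWeights`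
each learner pays at most `log N / η + 2 N² η ∑ ρ_t(f)` in grid units. Summation over `f` gives `m
log N / η + 2 N² η T` for `m` strategies, and `η = √(4 ^ N / (N³ T))` makes this at most `4 √(4 ^ N
N T)`.

For the running time, the stationary distribution is computed exactly by subtraction-free
elimination of states (`StateReduction`); the pivots are positive because every state moves to the
zero strategy with positive probability (`coupling_zero_pos`). The program is fixed and all its
loops have at most `4 ^ N` passes, so a round costs a polynomial in `4 ^ N`; one loop has exactly `4
^ N` passes, which gives the lower bound. -/

noncomputable section

/-! ### Structured programs with counting loops: semantics, frame rules and step counts. -/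

namespace RealRAM

/-- Structured programs, in which the only loops are counting loops: `rep x a P` runs `P` with the
counter `nat x 0` equal to `0, …, B - 1`, where `B` is the content of `nat a 0`. -/
inductive Code where
  | skip
  | setNat (a : ℕ) (k x : NatExpr)
  | setReal (a : ℕ) (k : NatExpr) (x : RealExpr)
  | seq (P Q : Code)
  | cond (b : Test) (P Q : Code)
  | rep (x a : ℕ) (P : Code)

namespace Code

/-- The test `nat x 0 < nat a 0`. -/
abbrev counterTest (x a : ℕ) : Test := .not (.natLe (.get a (.lit 0)) (.get x (.lit 0)))

/-- The program of a structured program. -/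
def compile : Code → Program
  | skip => .skip
  | setNat a k x => .setNat a k x
  | setReal a k x => .setReal a k x
  | seq P Q => .seq P.compile Q.compile
  | cond b P Q => .cond b P.compile Q.compile
  | rep x a P => .seq (.setNat x (.lit 0) (.lit 0))
      (.loop (counterTest x a)
        (.seq P.compile (.setNat x (.lit 0) (.add (.get x (.lit 0)) (.lit 1)))))

/-- The memory after `k` passes through a counting loop with counter `x` and body `F`. -/
def iterate (x : ℕ) (F : Mem → Mem) : ℕ → Mem → Mem
  | 0, s => s
  | k + 1, s => (F (iterate x F k s)).setNat x 0 (k + 1)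

open Classical in
/-- The final memory of a structured program. -/
def run : Code → Mem → Mem
  | skip, s => s
  | setNat a k x, s => s.setNat a (k.eval s) (x.eval s)
  | setReal a k x, s => s.setReal a (k.eval s) (x.eval s)
  | seq P Q, s => Q.run (P.run s)
  | cond b P Q, s => if b.Holds s then P.run s else Q.run s
  | rep x a P, s => iterate x P.run (s.nat a 0) (s.setNat x 0 0)

/-- The names of the integer arrays that a structured program may change. -/
def natWrites : Code → List ℕ
  | skip => []
  | setNat a _ _ => [a]
  | setReal _ _ _ => []
  | seq P Q => P.natWrites ++ Q.natWrites
  | cond _ P Q => P.natWrites ++ Q.natWrites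
  | rep x _ P => x :: P.natWrites

/-- The names of the real arrays that a structured program may change. -/
def realWrites : Code → List ℕ
  | skip => []
  | setNat _ _ _ => []
  | setReal a _ _ => [a]
  | seq P Q => P.realWrites ++ Q.realWrites
  | cond _ P Q => P.realWrites ++ Q.realWrites
  | rep _ _ P => P.realWrites

/-- The bodies of the loops change neither the counters nor the arrays `bs`, and the bounds of all
loops are in `bs`. -/
def Regular (bs : List ℕ) : Code → Prop
  | skip => True
  | setNat a _ _ => a ∉ bs
  | setReal _ _ _ => True
  | seq P Q => P.Regular bs ∧ Q.Regular bs
  | cond _ P Q => P.Regular bs ∧ Q.Regular bs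
  | rep x a P => x ∉ P.natWrites ∧ x ∉ bs ∧ a ∈ bs ∧ P.Regular bs

instance decidableRegular (bs : List ℕ) : (P : Code) → Decidable (P.Regular bs)
  | skip => inferInstanceAs (Decidable True)
  | setNat a _ _ => inferInstanceAs (Decidable (a ∉ bs))
  | setReal _ _ _ => inferInstanceAs (Decidable True)
  | seq P Q =>
    have := decidableRegular bs P
    have := decidableRegular bs Q
    inferInstanceAs (Decidable (_ ∧ _))
  | cond _ P Q =>
    have := decidableRegular bs P
    have := decidableRegular bs Q
    inferInstanceAs (Decidable (_ ∧ _))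
  | rep x a P =>
    have := decidableRegular bs P
    inferInstanceAs (Decidable (x ∉ P.natWrites ∧ x ∉ bs ∧ a ∈ bs ∧ _))

/-- A bound for the number of steps if all loops have at most `L` passes. -/
def cost (L : ℕ) : Code → ℕ
  | skip => 1
  | setNat _ k x => k.cost + x.cost + 1
  | setReal _ k x => k.cost + x.cost + 1
  | seq P Q => P.cost L + Q.cost L
  | cond b P Q => b.cost + 1 + (P.cost L + Q.cost L)
  -- A test of the counter costs 7 and an increment 6; the 10 is the initialisation (3) and the
  -- last, failing test (7).
  | rep _ _ P => 10 + L * (13 + P.cost L)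

/-- Each level of loop nesting contributes one factor of order `L`, so a fixed program has
polynomial cost. The exponent is not optimised. -/
theorem exists_cost_le (P : Code) : ∃ C d : ℕ, ∀ L, P.cost L ≤ C * (L + 1) ^ d := by
  have key : ∀ {C D d e L : ℕ}, C * (L + 1) ^ d + D * (L + 1) ^ e ≤
      (C + D) * (L + 1) ^ (d + e) := by
    intro C D d e L
    rw [add_mul]
    gcongr <;> omega
  induction P with
  | skip => exact ⟨1, 0, fun L => by simp [cost]⟩
  | setNat a k x => exact ⟨k.cost + x.cost + 1, 0, fun L => by simp [cost]⟩
  | setReal a k x => exact ⟨k.cost + x.cost + 1, 0, fun L => by simp [cost]⟩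
  | seq P Q ihP ihQ =>
    obtain ⟨C, d, h⟩ := ihP
    obtain ⟨D, e, h'⟩ := ihQ
    exact ⟨C + D, d + e, fun L => (add_le_add (h L) (h' L)).trans key⟩
  | cond b P Q ihP ihQ =>
    obtain ⟨C, d, h⟩ := ihP
    obtain ⟨D, e, h'⟩ := ihQ
    refine ⟨(b.cost + 1) + (C + D), 0 + (d + e), fun L => ?_⟩
    refine le_trans ?_ key
    have := (add_le_add (h L) (h' L)).trans key
    simp only [cost, pow_zero, mul_one]
    omega
  | rep x a P ih =>
    obtain ⟨C, d, h⟩ := ih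
    refine ⟨23 + C, d + 1, fun L => ?_⟩
    have h1 : 1 ≤ (L + 1) ^ d := Nat.one_le_pow _ _ (by omega)
    have h2 := h L
    simp only [cost, pow_succ]
    generalize (L + 1) ^ d = X at *
    generalize P.cost L = Y at *
    have : L * (13 + Y) ≤ L * (13 + C * X) := by gcongr
    nlinarith [Nat.zero_le (C * X), Nat.mul_le_mul_left L h1]

@[simp] theorem setNat_real (s : Mem) (a k x : ℕ) : (s.setNat a k x).real = s.real := rfl

@[simp] theorem setReal_nat (s : Mem) (a k : ℕ) (x : ℝ) : (s.setReal a k x).nat = s.nat := rfl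

theorem setNat_nat (s : Mem) (a k x b j : ℕ) :
    (s.setNat a k x).nat b j = if b = a ∧ j = k then x else s.nat b j := by
  by_cases h : b = a <;> by_cases h' : j = k <;> simp [Mem.setNat, h, h']

theorem setReal_real (s : Mem) (a k : ℕ) (x : ℝ) (b j : ℕ) :
    (s.setReal a k x).real b j = if b = a ∧ j = k then x else s.real b j := by
  by_cases h : b = a <;> by_cases h' : j = k <;> simp [Mem.setReal, h, h']

theorem setNat_nat_of_ne {s : Mem} {a k x b : ℕ} (h : b ≠ a) :
    (s.setNat a k x).nat b = s.nat b := by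
  simp [Mem.setNat, h]

theorem setReal_real_of_ne {s : Mem} {a k : ℕ} {x : ℝ} {b : ℕ} (h : b ≠ a) :
    (s.setReal a k x).real b = s.real b := by
  simp [Mem.setReal, h]

/-- Frame rule. The list of written arrays is syntactic, so its side condition is usually settled by
`decide`. -/
theorem run_nat (P : Code) (s : Mem) {a : ℕ} (ha : a ∉ P.natWrites) :
    (P.run s).nat a = s.nat a := by
  induction P generalizing s with
  | skip => rfl
  | setNat b k x => exact setNat_nat_of_ne (by simpa [natWrites] using ha)
  | setReal b k x => rfl
  | seq P Q ihP ihQ =>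
    simp only [natWrites, List.mem_append, not_or] at ha
    simp only [run]
    rw [ihQ _ ha.2, ihP _ ha.1]
  | cond b P Q ihP ihQ =>
    simp only [natWrites, List.mem_append, not_or] at ha
    simp only [run]
    split_ifs
    exacts [ihP _ ha.1, ihQ _ ha.2]
  | rep x c P ih =>
    simp only [natWrites, List.mem_cons, not_or] at ha
    simp only [run]
    generalize s.nat c 0 = B
    induction B with
    | zero => exact setNat_nat_of_ne ha.1
    | succ B hB => rw [iterate, setNat_nat_of_ne ha.1, ih _ ha.2, hB]

theorem run_real (P : Code) (s : Mem) {a : ℕ} (ha : a ∉ P.realWrites) :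
    (P.run s).real a = s.real a := by
  induction P generalizing s with
  | skip => rfl
  | setNat b k x => rfl
  | setReal b k x => exact setReal_real_of_ne (by simpa [realWrites] using ha)
  | seq P Q ihP ihQ =>
    simp only [realWrites, List.mem_append, not_or] at ha
    simp only [run]
    rw [ihQ _ ha.2, ihP _ ha.1]
  | cond b P Q ihP ihQ =>
    simp only [realWrites, List.mem_append, not_or] at ha
    simp only [run]
    split_ifs
    exacts [ihP _ ha.1, ihQ _ ha.2]
  | rep x c P ih =>
    simp only [realWrites] at ha
    simp only [run]
    generalize s.nat c 0 = B
    induction B with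
    | zero => rfl
    | succ B hB => rw [iterate, setNat_real, ih _ ha, hB]

theorem natWrites_of_regular {bs : List ℕ} {P : Code} (h : P.Regular bs) {a : ℕ} (ha : a ∈ bs) :
    a ∉ P.natWrites := by
  induction P with
  | skip => simp [natWrites]
  | setNat b k x =>
    simp only [natWrites, List.mem_singleton]
    rintro rfl
    exact h ha
  | setReal b k x => simp [natWrites]
  | seq P Q ihP ihQ => simpa [natWrites] using ⟨ihP h.1, ihQ h.2⟩
  | cond b P Q ihP ihQ => simpa [natWrites] using ⟨ihP h.1, ihQ h.2⟩
  | rep x c P ih =>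
    simp only [natWrites, List.mem_cons, not_or]
    exact ⟨fun e => h.2.1 (e ▸ ha), ih h.2.2.2⟩

/-- The rule for counting loops: besides the invariant `I`, the contents of all arrays that the
loop does not change are known. -/
theorem run_rep {x a : ℕ} {P : Code} (s : Mem) (I : ℕ → Mem → Prop)
    (h0 : I 0 (s.setNat x 0 0))
    (hs : ∀ k < s.nat a 0, ∀ t : Mem, t.nat x 0 = k →
      (∀ b, b ∉ (rep x a P).natWrites → t.nat b = s.nat b) →
      (∀ b, b ∉ P.realWrites → t.real b = s.real b) →
      I k t → I (k + 1) ((P.run t).setNat x 0 (k + 1))) :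
    I (s.nat a 0) ((rep x a P).run s) := by
  have key : ∀ k ≤ s.nat a 0, I k (iterate x P.run k (s.setNat x 0 0)) ∧
      (iterate x P.run k (s.setNat x 0 0)).nat x 0 = k ∧
      (∀ b, b ∉ (rep x a P).natWrites →
        (iterate x P.run k (s.setNat x 0 0)).nat b = s.nat b) ∧
      (∀ b, b ∉ P.realWrites → (iterate x P.run k (s.setNat x 0 0)).real b = s.real b) := by
    intro k
    induction k with
    | zero =>
      refine fun _ => ⟨h0, by simp [iterate, setNat_nat], fun b hb => ?_, fun b _ => rfl⟩
      simp only [natWrites, List.mem_cons, not_or] at hb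
      exact setNat_nat_of_ne hb.1
    | succ k ih =>
      intro hk
      obtain ⟨h1, h2, h3, h4⟩ := ih (by omega)
      refine ⟨hs k (by omega) _ h2 h3 h4 h1, by simp [iterate, setNat_nat], fun b hb => ?_,
        fun b hb => ?_⟩
      · have hb' := hb
        simp only [natWrites, List.mem_cons, not_or] at hb'
        rw [iterate, setNat_nat_of_ne hb'.1, run_nat _ _ hb'.2, h3 b hb]
      · rw [iterate, setNat_real, run_real _ _ hb, h4 b hb]
  exact (key _ le_rfl).1

/-- Regularity keeps the bound of a loop constant while the loop runs, so the number of passes is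
known on entry. The last conjunct, that a loop takes at least as many steps as passes, is the source
of the exponential lower bound. -/
theorem runs_compile (P : Code) (bs : List ℕ) (hP : P.Regular bs) (L : ℕ) (s : Mem)
    (hL : ∀ a ∈ bs, s.nat a 0 ≤ L) :
    ∃ n, Runs P.compile s (P.run s) n ∧ n ≤ P.cost L ∧
      ∀ x a Q, P = rep x a Q → s.nat a 0 ≤ n := by
  induction P generalizing s with
  | skip => exact ⟨_, .skip s, le_rfl, by simp⟩
  | setNat a k x => exact ⟨_, .setNat s a k x, le_rfl, by simp⟩
  | setReal a k x => exact ⟨_, .setReal s a k x, le_rfl, by simp⟩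
  | seq P Q ihP ihQ =>
    obtain ⟨m, hm, hm', -⟩ := ihP hP.1 s hL
    obtain ⟨n, hn, hn', -⟩ := ihQ hP.2 (P.run s) (fun a ha => by
      rw [run_nat _ _ (natWrites_of_regular hP.1 ha)]; exact hL a ha)
    exact ⟨_, .seq hm hn, add_le_add hm' hn', by simp⟩
  | cond b P Q ihP ihQ =>
    by_cases hb : b.Holds s
    · obtain ⟨m, hm, hm', -⟩ := ihP hP.1 s hL
      refine ⟨_, .condTrue hb (by simpa [run, hb] using hm), ?_, by simp⟩
      simp only [cost]
      omega
    · obtain ⟨m, hm, hm', -⟩ := ihQ hP.2 s hL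
      refine ⟨_, .condFalse hb (by simpa [run, hb] using hm), ?_, by simp⟩
      simp only [cost]
      omega
  | rep x a P ih =>
    obtain ⟨hx, hxb, hab, hP'⟩ := hP
    set s₀ := s.setNat x 0 0 with hs₀
    have hbs : ∀ k, (∀ c ∈ bs, (iterate x P.run k s₀).nat c = s.nat c) ∧
        (iterate x P.run k s₀).nat x 0 = k := by
      intro k
      induction k with
      | zero =>
        refine ⟨fun c hc => setNat_nat_of_ne ?_, by simp [iterate, hs₀, setNat_nat]⟩
        rintro rfl
        exact hxb hc
      | succ k ih' =>
        refine ⟨fun c hc => ?_, by simp [iterate, setNat_nat]⟩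
        rw [iterate, setNat_nat_of_ne (fun e : c = x => hxb (e ▸ hc)),
          run_nat _ _ (natWrites_of_regular hP' hc), ih'.1 c hc]
    -- Induction on the number `j` of passes still to come.
    have hloop : ∀ j k, k + j = s.nat a 0 → ∃ n,
        Runs (.loop (counterTest x a)
          (.seq P.compile (.setNat x (.lit 0) (.add (.get x (.lit 0)) (.lit 1)))))
          (iterate x P.run k s₀) (iterate x P.run (s.nat a 0) s₀) n ∧
          n ≤ 7 + j * (13 + P.cost L) ∧ j ≤ n := by
      intro j
      induction j with
      | zero =>
        rintro k rfl
        refine ⟨_, .loopDone ?_, by simp [Test.cost, NatExpr.cost], by simp⟩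
        simp [Test.Holds, NatExpr.eval, (hbs (s.nat a 0)).1 a hab, (hbs (s.nat a 0)).2]
      | succ j ihj =>
        intro k hk
        obtain ⟨n, hn, hn', hjn⟩ := ihj (k + 1) (by omega)
        obtain ⟨m, hm, hm', -⟩ := ih hP' (iterate x P.run k s₀) (fun c hc => by
          rw [(hbs k).1 c hc]; exact hL c hc)
        have hset := Runs.setNat (P.run (iterate x P.run k s₀)) x (.lit 0)
          (.add (.get x (.lit 0)) (.lit 1))
        have hval : (P.run (iterate x P.run k s₀)).setNat x (NatExpr.eval
            (P.run (iterate x P.run k s₀)) (.lit 0)) (NatExpr.eval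
            (P.run (iterate x P.run k s₀)) (.add (.get x (.lit 0)) (.lit 1))) =
            iterate x P.run (k + 1) s₀ := by
          simp [iterate, NatExpr.eval, run_nat _ _ hx, (hbs k).2]
        rw [hval] at hset
        refine ⟨_, .loopStep ?_ (.seq hm hset) hn, ?_, ?_⟩
        · simp only [Test.Holds, NatExpr.eval, (hbs k).1 a hab, (hbs k).2]
          omega
        · simp only [Test.cost, NatExpr.cost]
          rw [Nat.succ_mul]
          omega
        · simp only [Test.cost, NatExpr.cost]
          omega
    obtain ⟨n, hn, hn', hjn⟩ := hloop (s.nat a 0) 0 (by omega)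
    refine ⟨_, .seq (.setNat s x (.lit 0) (.lit 0)) hn, ?_, ?_⟩
    · have : s.nat a 0 * (13 + P.cost L) ≤ L * (13 + P.cost L) :=
        Nat.mul_le_mul_right _ (hL a hab)
      simp only [cost, NatExpr.cost]
      omega
    · intro x' a' Q h
      simp only [rep.injEq] at h
      rw [← h.2.1]
      simp only [NatExpr.cost]
      omega

end Code

end RealRAM

namespace FirstPriceAuction

/-! ## Monotone strategies without overbidding -/

/-- The bids below `N` that may extend `f`, defined below `n`, at `n`. -/
def nextBids (N n : ℕ) (f : ℕ → ℕ) : List ℕ :=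
  (List.range N).filter fun b => f (n - 1) ≤ b ∧ b ≤ n

/-- The nondecreasing functions `f` on the numbers below `n` with `f v ≤ v` for all `v`, extended
by `0`, in lexicographic order. -/
def monotoneBids (N : ℕ) : ℕ → List (ℕ → ℕ)
  | 0 => [fun _ => 0]
  | n + 1 => (monotoneBids N n).flatMap fun f => (nextBids N n f).map (Function.update f n)

theorem mem_nextBids {N n b : ℕ} {f : ℕ → ℕ} (hn : n < N) :
    b ∈ nextBids N n f ↔ f (n - 1) ≤ b ∧ b ≤ n := by
  simp only [nextBids, List.mem_filter, List.mem_range, decide_eq_true_eq]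
  constructor
  · exact fun h => h.2
  · exact fun h => ⟨by omega, h⟩

theorem mem_monotoneBids {N n : ℕ} (hn : n ≤ N) {f : ℕ → ℕ} :
    f ∈ monotoneBids N n ↔ (∀ v, n ≤ v → f v = 0) ∧ (∀ v, f v ≤ v) ∧
      ∀ v, v + 1 < n → f v ≤ f (v + 1) := by
  induction n generalizing f with
  | zero =>
    simp only [monotoneBids, List.mem_singleton]
    constructor
    · rintro rfl
      simp
    · exact fun h => funext fun v => h.1 v (Nat.zero_le _)
  | succ n ih =>
    simp only [monotoneBids, List.mem_flatMap, List.mem_map, ih (by omega : n ≤ N),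
      mem_nextBids (by omega : n < N)]
    constructor
    · rintro ⟨g, ⟨h1, h2, h3⟩, b, ⟨hb, hb'⟩, rfl⟩
      refine ⟨fun v hv => ?_, fun v => ?_, fun v hv => ?_⟩
      · rw [Function.update_of_ne (by omega), h1 v (by omega)]
      · by_cases h : v = n
        · subst h; simpa using hb'
        · rw [Function.update_of_ne h]; exact h2 v
      · rw [Function.update_of_ne (by omega)]
        by_cases h : v + 1 = n
        · subst h; simpa using hb
        · rw [Function.update_of_ne h]; exact h3 v (by omega)
    · rintro ⟨h1, h2, h3⟩
      refine ⟨Function.update f n 0, ⟨fun v hv => ?_, fun v => ?_, fun v hv => ?_⟩, f n, ⟨?_, h2 n⟩,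
        by simp⟩
      · by_cases h : v = n
        · subst h; simp
        · rw [Function.update_of_ne h, h1 v (by omega)]
      · by_cases h : v = n
        · subst h; simp
        · rw [Function.update_of_ne h]; exact h2 v
      · rw [Function.update_of_ne (by omega), Function.update_of_ne (by omega)]
        exact h3 v (by omega)
      -- For `n = 0` the truncated `n - 1` points to the cleared position `0`, so there is no lower
      -- bound on the first bid.
      · rcases n with _ | n
        · simp
        · rw [Function.update_of_ne (by omega)]
          exact h3 n (by omega)

theorem nodup_monotoneBids {N n : ℕ} (hn : n ≤ N) : (monotoneBids N n).Nodup := by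
  induction n with
  | zero => simp [monotoneBids]
  | succ n ih =>
    rw [monotoneBids, List.nodup_flatMap]
    refine ⟨fun f _ => ?_, ?_⟩
    · exact (List.nodup_range.filter _).map fun a b h => by simpa using congrFun h n
    · refine (ih (by omega)).imp_of_mem ?_
      intro f g hf hg hfg h hhf hhg
      simp only [List.mem_map] at hhf hhg
      obtain ⟨a, -, rfl⟩ := hhf
      obtain ⟨b, -, hb⟩ := hhg
      refine hfg (funext fun v => ?_)
      by_cases h : v = n
      · subst h
        rw [((mem_monotoneBids (by omega)).1 hf).1 v le_rfl,
          ((mem_monotoneBids (by omega)).1 hg).1 v le_rfl]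
      · simpa [h] using (congrFun hb v).symm

/-- Puts the zero strategy at index `0`, the state used as the root of the elimination. -/
theorem monotoneBids_eq_cons {N n : ℕ} (hn : n ≤ N) :
    ∃ l, monotoneBids N n = (fun _ => 0) :: l := by
  induction n with
  | zero => exact ⟨[], rfl⟩
  | succ n ih =>
    obtain ⟨l, hl⟩ := ih (by omega)
    obtain ⟨N, rfl⟩ : ∃ M, N = M + 1 := ⟨N - 1, by omega⟩
    rw [monotoneBids, hl]
    have : Function.update (fun _ : ℕ => 0) n 0 = fun _ => 0 := by
      funext v; simp [Function.update_apply]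
    exact ⟨_, by simp [nextBids, List.range_succ_eq_map]; rfl⟩

/-! ### Catalan count of the monotone strategies. -/

/-- The number of ways to extend an element of `monotoneBids` by `h` values, if `d` is the
difference between the length and the last value. -/
def extensions : ℕ → ℕ → ℕ
  | 0, _ => 1
  | h + 1, d => ∑ e ∈ Finset.range (d + 1), extensions h (e + 1)

/-- These are ballot numbers. Splitting off the last term of the defining sum turns it into a
two-term recursion in `d`, which Pascal's rule and the ratio of adjacent binomials match; `d = 0`
gives the Catalan numbers. -/
theorem extensions_mul (h d : ℕ) :
    (h + d + 1) * extensions h d = (d + 1) * (2 * h + d).choose h := by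
  induction h generalizing d with
  | zero => simp [extensions]
  | succ h ih =>
    induction d with
    | zero =>
      have h1 := ih 1
      simp only [extensions, zero_add, Finset.sum_range_one]
      have h2 : (h + 1) * (2 * (h + 1)).choose (h + 1) = 2 * ((h + 1) * (2 * h + 1).choose h) := by
        have := Nat.add_one_mul_choose_eq (2 * h + 1) h
        have e : 2 * (h + 1) = 2 * h + 1 + 1 := by ring
        rw [e]
        linarith
      have h3 : (h + 1) * ((h + 1 + 0 + 1) * extensions h 1) =
          (h + 1) * ((0 + 1) * (2 * (h + 1)).choose (h + 1)) := by
        rw [show h + 1 + 0 + 1 = h + 1 + 1 by ring, h1]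
        linarith
      exact Nat.eq_of_mul_eq_mul_left (by omega) h3
    | succ d ihd =>
      have e1 : extensions (h + 1) (d + 1) = extensions (h + 1) d + extensions h (d + 2) := by
        simp only [extensions]
        rw [Finset.sum_range_succ]
      have h1 := ih (d + 2)
      rw [e1]
      obtain ⟨X, hX⟩ : ∃ X, X = (2 * h + d + 2).choose h := ⟨_, rfl⟩
      obtain ⟨Y, hY⟩ : ∃ Y, Y = (2 * h + d + 2).choose (h + 1) := ⟨_, rfl⟩
      have e2 : (2 * (h + 1) + d).choose (h + 1) = Y := by rw [hY]; congr 1; ring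
      have e3 : (2 * h + (d + 2)).choose h = X := by rw [hX]; congr 1
      have e4 : (2 * (h + 1) + (d + 1)).choose (h + 1) = X + Y := by
        rw [hX, hY, show 2 * (h + 1) + (d + 1) = 2 * h + d + 2 + 1 by ring, Nat.choose_succ_succ]
      have e5 : Y * (h + 1) = X * (h + d + 2) := by
        rw [hX, hY, Nat.choose_succ_right_eq]; congr 1; omega
      rw [e2] at ihd
      rw [e3] at h1
      rw [e4]
      generalize extensions (h + 1) d = U at *
      generalize extensions h (d + 2) = V at *
      have : (h + d + 2) * (h + d + 3) * ((h + d + 3) * (U + V)) =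
          (h + d + 2) * (h + d + 3) * ((d + 2) * (X + Y)) := by
        zify at *
        have e6 : ((h : ℤ) + d + 2) * U = (d + 1) * Y := by linear_combination ihd
        have e7 : ((h : ℤ) + d + 3) * V = (d + 3) * X := by linear_combination h1
        linear_combination (h + d + 3) ^ 2 * e6 + (h + d + 2) * (h + d + 3) * e7 - (h + d + 3) * e5
      have := Nat.eq_of_mul_eq_mul_left (by positivity) this
      rw [← this]
      ring

/-- Bid `b` at position `n` leaves the gap `n + 1 - b`; for `e = n - b` these are the gaps `e + 1`
in the recursion of `extensions`. -/
theorem sum_map_monotoneBids {N n : ℕ} (hn : n < N) (h : ℕ) :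
    ((monotoneBids N (n + 1)).map fun f => extensions h (n + 1 - f n)).sum =
      ((monotoneBids N n).map fun f => extensions (h + 1) (n - f (n - 1))).sum := by
  have sum_flatMap : ∀ (l : List (ℕ → ℕ)) (F : (ℕ → ℕ) → List ℕ),
      (l.flatMap F).sum = (l.map fun f => (F f).sum).sum := by
    intro l F
    induction l with
    | nil => rfl
    | cons a l ih => simp [ih]
  rw [monotoneBids, List.map_flatMap, sum_flatMap]
  congr 1
  refine List.map_congr_left fun f hf => ?_
  have hle : f (n - 1) ≤ n := (((mem_monotoneBids hn.le).1 hf).2.1 _).trans (by omega)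
  simp only [List.map_map, Function.comp_def, Function.update_self, extensions]
  have hnd : (nextBids N n f).Nodup := List.nodup_range.filter _
  rw [← List.sum_toFinset _ hnd]
  refine Finset.sum_bij' (fun b _ => n - b) (fun e _ => n - e) ?_ ?_ ?_ ?_ ?_
  · intro b hb
    simp only [List.mem_toFinset, mem_nextBids hn] at hb
    simp only [Finset.mem_range]
    omega
  · intro b hb
    simp only [List.mem_toFinset, mem_nextBids hn]
    simp only [Finset.mem_range] at hb
    omega
  · intro b hb
    simp only [List.mem_toFinset, mem_nextBids hn] at hb
    omega
  · intro b hb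
    simp only [Finset.mem_range] at hb
    omega
  · intro b hb
    simp only [List.mem_toFinset, mem_nextBids hn] at hb
    congr 1
    omega

/-- The number of completions to length `n`, summed over all prefixes of length `k`, does not depend
on `k`; compare `k = 0` with `k = n`. -/
theorem length_monotoneBids {N n : ℕ} (hn : n ≤ N) :
    (monotoneBids N n).length = extensions n 0 := by
  have key : ∀ k ≤ n, ((monotoneBids N k).map fun f => extensions (n - k) (k - f (k - 1))).sum =
      extensions n 0 := by
    intro k
    induction k with
    | zero => simp [monotoneBids]
    | succ k ih =>
      intro hk
      rw [← ih (by omega), show n - k = n - (k + 1) + 1 by omega,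
        ← sum_map_monotoneBids (by omega), Nat.add_sub_cancel]
  have := key n le_rfl
  simpa [extensions] using this

theorem length_monotoneBids_mul {N n : ℕ} (hn : n ≤ N) :
    (n + 1) * (monotoneBids N n).length = n.centralBinom := by
  rw [length_monotoneBids hn, Nat.centralBinom]
  simpa using extensions_mul n 0

/-- The factor `n + 1` improves `4 ^ n` by a square root, which later absorbs `log N ≤ 2 √N` in the
regret. -/
theorem centralBinom_sq_mul_le (n : ℕ) : n.centralBinom ^ 2 * (n + 1) ≤ 16 ^ n := by
  induction n with
  | zero => simp
  | succ n ih =>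
    have h := Nat.succ_mul_centralBinom_succ n
    have : (n + 1) ^ 3 * ((n + 1).centralBinom ^ 2 * (n + 1 + 1)) ≤ (n + 1) ^ 3 * 16 ^ (n + 1) := by
      calc (n + 1) ^ 3 * ((n + 1).centralBinom ^ 2 * (n + 1 + 1))
          = ((n + 1) * (n + 1).centralBinom) ^ 2 * ((n + 1) * (n + 2)) := by ring
        _ = 4 * (2 * n + 1) ^ 2 * (n + 2) * (n.centralBinom ^ 2 * (n + 1)) := by rw [h]; ring
        _ ≤ 4 * (2 * n + 1) ^ 2 * (n + 2) * 16 ^ n := by gcongr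
        _ ≤ (16 * (n + 1) ^ 3) * 16 ^ n := by
          refine Nat.mul_le_mul_right _ ?_
          nlinarith [Nat.zero_le n]
        _ = _ := by ring
    exact Nat.le_of_mul_le_mul_left this (by positivity)

theorem length_monotoneBids_le {N n : ℕ} (hn : n ≤ N) : (monotoneBids N n).length ≤ 4 ^ N := by
  have h := length_monotoneBids_mul hn
  have h1 := centralBinom_sq_mul_le n
  have h2 : n.centralBinom ≤ 4 ^ n := by
    refine (Nat.pow_le_pow_iff_left (two_ne_zero)).1 ?_
    calc n.centralBinom ^ 2 ≤ n.centralBinom ^ 2 * (n + 1) := Nat.le_mul_of_pos_right _ (by omega)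
      _ ≤ 16 ^ n := h1
      _ = (4 ^ n) ^ 2 := by rw [← pow_mul, mul_comm, pow_mul]; norm_num
  calc (monotoneBids N n).length ≤ (n + 1) * (monotoneBids N n).length :=
        Nat.le_mul_of_pos_left _ (by omega)
    _ ≤ 4 ^ n := h ▸ h2
    _ ≤ 4 ^ N := Nat.pow_le_pow_right (by norm_num) hn

/-- The number of monotone strategies is at most `4 ^ N / N ^ (3 / 2)`. -/
theorem length_monotoneBids_mul_sqrt_le (N : ℕ) :
    ((monotoneBids N N).length : ℝ) * (N * Real.sqrt N) ≤ 4 ^ N := by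
  have h : ((N : ℝ) + 1) * (monotoneBids N N).length = N.centralBinom := by
    exact_mod_cast length_monotoneBids_mul (N := N) le_rfl
  have h1 : (N.centralBinom : ℝ) ^ 2 * (N + 1) ≤ 16 ^ N := by
    exact_mod_cast centralBinom_sq_mul_le N
  refine (sq_le_sq₀ (by positivity) (by positivity)).1 ?_
  rw [mul_pow, mul_pow, Real.sq_sqrt (by positivity), ← pow_mul, mul_comm N 2, pow_mul]
  norm_num
  rw [← h] at h1
  refine le_trans ?_ h1
  rw [mul_pow]
  have : (N : ℝ) ^ 2 * N ≤ (N + 1) ^ 2 * (N + 1) := by gcongr <;> linarith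
  nlinarith [sq_nonneg ((monotoneBids N N).length : ℝ)]

end FirstPriceAuction

namespace FirstPriceAuction

/-! ## Multiplicative weights for a learner with a known value -/

/-- The weight of bid `b` for value `v`; there are no overbids. -/
def bidWeight (W : ℕ → ℝ) (v b : ℕ) : ℝ := if b ≤ v then W b ^ (v - b) else 0

/-- The sum of the weights of the bids below `b`. -/
def cumWeight (W : ℕ → ℝ) (v b : ℕ) : ℝ := ∑ j ∈ Finset.range b, bidWeight W v j

/-- The probability of bid `b` for value `v`. -/
def bidProb (W : ℕ → ℝ) (N v b : ℕ) : ℝ := bidWeight W v b / cumWeight W v N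

/-- The probability of the bids below `b` for value `v`. -/
def cumProb (W : ℕ → ℝ) (N v b : ℕ) : ℝ := cumWeight W v b / cumWeight W v N

section Weights

variable {W : ℕ → ℝ} {N v : ℕ}

theorem bidWeight_nonneg (hW : ∀ b < N, 0 < W b) {b : ℕ} (hb : b < N) : 0 ≤ bidWeight W v b := by
  unfold bidWeight
  split_ifs
  · exact pow_nonneg (hW b hb).le _
  · exact le_rfl

theorem cumWeight_mono (hW : ∀ b < N, 0 < W b) {b c : ℕ} (hbc : b ≤ c) (hc : c ≤ N) :
    cumWeight W v b ≤ cumWeight W v c := by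
  refine Finset.sum_le_sum_of_subset_of_nonneg (by simpa using hbc) fun j hj _ => ?_
  exact bidWeight_nonneg hW ((Finset.mem_range.1 hj).trans_le hc)

theorem cumWeight_pos (hW : ∀ b < N, 0 < W b) {b : ℕ} (hb : 0 < b) (hbN : b ≤ N) :
    0 < cumWeight W v b := by
  refine Finset.sum_pos' (fun j hj => bidWeight_nonneg hW ((Finset.mem_range.1 hj).trans_le hbN))
    ⟨0, by simpa using hb, ?_⟩
  simpa [bidWeight] using pow_pos (hW 0 (by omega)) v

theorem cumWeight_of_lt {b : ℕ} (hv : v < b) : cumWeight W v b = cumWeight W v (v + 1) := by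
  refine (Finset.sum_subset (by simpa using hv) fun j _ hj => ?_).symm
  simp only [Finset.mem_range] at hj
  simp [bidWeight, show ¬ j ≤ v by omega]

theorem cumProb_zero : cumProb W N v 0 = 0 := by simp [cumProb, cumWeight]

theorem cumProb_mono (hW : ∀ b < N, 0 < W b) {b c : ℕ} (hbc : b ≤ c) (hc : c ≤ N) :
    cumProb W N v b ≤ cumProb W N v c :=
  div_le_div_of_nonneg_right (cumWeight_mono hW hbc hc)
    (Finset.sum_nonneg fun _ hj => bidWeight_nonneg hW (Finset.mem_range.1 hj))

theorem cumProb_of_lt (hW : ∀ b < N, 0 < W b) (hv : v < N) {b : ℕ} (hb : v < b) :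
    cumProb W N v b = 1 := by
  rw [cumProb, cumWeight_of_lt hb, cumWeight_of_lt hv, div_self]
  exact (cumWeight_pos hW (by omega) (by omega)).ne'

theorem cumProb_pos (hW : ∀ b < N, 0 < W b) {b : ℕ} (hb : 0 < b) (hbN : b ≤ N) :
    0 < cumProb W N v b :=
  div_pos (cumWeight_pos hW hb hbN) (cumWeight_pos hW (by omega) le_rfl)

theorem cumProb_succ_sub (b : ℕ) :
    cumProb W N v (b + 1) - cumProb W N v b = bidProb W N v b := by
  rw [cumProb, cumProb, ← sub_div, cumWeight, cumWeight, Finset.sum_range_succ, bidProb]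
  ring

theorem bidProb_nonneg (hW : ∀ b < N, 0 < W b) {b : ℕ} (hb : b < N) : 0 ≤ bidProb W N v b := by
  rw [← cumProb_succ_sub, sub_nonneg]
  exact cumProb_mono hW (by omega) hb

theorem sum_bidProb (hW : ∀ b < N, 0 < W b) (hv : v < N) :
    ∑ b ∈ Finset.range N, bidProb W N v b = 1 := by
  simp only [bidProb]
  rw [← Finset.sum_div]
  exact div_self (cumWeight_pos hW (by omega) le_rfl).ne'

/-- Higher values bid higher, in the sense of stochastic dominance. -/
theorem cumProb_succ_le (hW : ∀ b < N, 0 < W b) (hmono : ∀ b c, b ≤ c → c < N → W b ≤ W c)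
    (hv : v + 1 < N) {b : ℕ} (hb : b ≤ N) : cumProb W N (v + 1) b ≤ cumProb W N v b := by
  by_cases hvb : v < b
  · rw [cumProb_of_lt hW (by omega) hvb, cumProb,
      div_le_one (cumWeight_pos hW (by omega) le_rfl)]
    exact cumWeight_mono hW hb le_rfl
  -- From value `v` to `v + 1` the weight of bid `j` grows by the factor `W j`, nondecreasing in
  -- `j`. So `W b` bounds the growth of the bids below `b` from above and that of the others from
  -- below.
  have hstep : ∀ j ≤ v, bidWeight W (v + 1) j = W j * bidWeight W v j := by
    intro j hj
    simp only [bidWeight, hj, show j ≤ v + 1 by omega, if_true]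
    rw [show v + 1 - j = v - j + 1 by omega, pow_succ']
  have hle : cumWeight W (v + 1) b ≤ W b * cumWeight W v b := by
    simp only [cumWeight, Finset.mul_sum]
    refine Finset.sum_le_sum fun j hj => ?_
    simp only [Finset.mem_range] at hj
    rw [hstep j (by omega)]
    exact mul_le_mul_of_nonneg_right (hmono _ _ hj.le (by omega)) (bidWeight_nonneg hW (by omega))
  have hge : W b * (cumWeight W v N - cumWeight W v b) ≤
      cumWeight W (v + 1) N - cumWeight W (v + 1) b := by
    simp only [cumWeight]
    rw [← Finset.sum_Ico_eq_sub _ hb, ← Finset.sum_Ico_eq_sub _ hb, Finset.mul_sum]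
    refine Finset.sum_le_sum fun j hj => ?_
    simp only [Finset.mem_Ico] at hj
    by_cases hjv : j ≤ v
    · rw [hstep j hjv]
      exact mul_le_mul_of_nonneg_right (hmono _ _ hj.1 hj.2) (bidWeight_nonneg hW hj.2)
    -- A bid above `v` has no old weight and can only add to the upper tail.
    · rw [show bidWeight W v j = 0 by simp [bidWeight, hjv], mul_zero]
      exact bidWeight_nonneg hW hj.2
  have h1 : 0 ≤ cumWeight W v b :=
    Finset.sum_nonneg fun j hj => bidWeight_nonneg hW (by simp at hj; omega)
  have h2 := cumWeight_mono (v := v) hW hb le_rfl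
  rw [cumProb, cumProb, div_le_div_iff₀ (cumWeight_pos hW (by omega) le_rfl)
    (cumWeight_pos hW (by omega) le_rfl)]
  nlinarith [mul_le_mul_of_nonneg_right hle (sub_nonneg.2 h2),
    mul_le_mul_of_nonneg_left hge h1]

end Weights

/-! ## The quantile coupling -/

/-- The strategy with index `k` in the list of monotone strategies. -/
def strategy (N k : ℕ) : ℕ → ℕ := (monotoneBids N N).getD k fun _ => 0

/-- The number of monotone strategies. -/
def numStrategies (N : ℕ) : ℕ := (monotoneBids N N).length

/-- The quantiles at which the bids for all values are those of the strategy `g`. -/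
def quantiles (W : ℕ → ℝ) (N : ℕ) (g : ℕ → ℕ) : Set ℝ :=
  {u | (0 ≤ u ∧ u < 1) ∧ ∀ v < N, cumProb W N v (g v) ≤ u ∧ u < cumProb W N v (g v + 1)}

/-- The probability of the strategy with index `k` in the quantile coupling of the bids. -/
def coupling (W : ℕ → ℝ) (N k : ℕ) : ℝ :=
  MeasureTheory.volume.real (quantiles W N (strategy N k))

section Coupling

variable {W : ℕ → ℝ} {N : ℕ}

theorem strategy_mem {k : ℕ} (hk : k < numStrategies N) : strategy N k ∈ monotoneBids N N := by
  rw [strategy, List.getD_eq_getElem _ _ hk]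
  exact List.getElem_mem _

theorem strategy_le (k v : ℕ) : strategy N k v ≤ v := by
  by_cases hk : k < numStrategies N
  · exact ((mem_monotoneBids le_rfl).1 (strategy_mem hk)).2.1 v
  · rw [strategy, List.getD_eq_default _ _ (not_lt.1 hk)]
    exact Nat.zero_le v

theorem strategy_zero (N : ℕ) : strategy N 0 = fun _ => 0 := by
  obtain ⟨l, hl⟩ := monotoneBids_eq_cons (N := N) le_rfl
  simp [strategy, hl]

theorem numStrategies_pos (N : ℕ) : 0 < numStrategies N := by
  obtain ⟨l, hl⟩ := monotoneBids_eq_cons (N := N) le_rfl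
  simp [numStrategies, hl]

theorem measurableSet_quantiles (g : ℕ → ℕ) : MeasurableSet (quantiles W N g) := by
  have : quantiles W N g = Set.Ico 0 1 ∩ ⋂ v ∈ Finset.range N,
      Set.Ico (cumProb W N v (g v)) (cumProb W N v (g v + 1)) := by
    ext u
    simp [quantiles]
  rw [this]
  exact measurableSet_Ico.inter (Finset.measurableSet_biInter _ fun _ _ => measurableSet_Ico)

theorem coupling_nonneg (k : ℕ) : 0 ≤ coupling W N k := MeasureTheory.measureReal_nonneg

theorem quantile_unique (hW : ∀ b < N, 0 < W b) {v b c : ℕ} (hb : b < N) (hc : c < N) {u : ℝ}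
    (hub : cumProb W N v b ≤ u ∧ u < cumProb W N v (b + 1))
    (huc : cumProb W N v c ≤ u ∧ u < cumProb W N v (c + 1)) : b = c := by
  rcases lt_trichotomy b c with h | h | h
  · have := cumProb_mono (v := v) hW (show b + 1 ≤ c by omega) hc.le
    linarith [hub.2, huc.1]
  · exact h
  · have := cumProb_mono (v := v) hW (show c + 1 ≤ b by omega) hb.le
    linarith [huc.2, hub.1]

theorem exists_quantile (hW : ∀ b < N, 0 < W b) {v : ℕ} (hv : v < N) {u : ℝ} (h0 : 0 ≤ u)
    (h1 : u < 1) : ∃ b ≤ v, cumProb W N v b ≤ u ∧ u < cumProb W N v (b + 1) := by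
  have hex : ∃ b, u < cumProb W N v (b + 1) := ⟨v, by rwa [cumProb_of_lt hW hv (by omega)]⟩
  classical
  refine ⟨Nat.find hex, Nat.find_min' hex (by rwa [cumProb_of_lt hW hv (by omega)]), ?_,
    Nat.find_spec hex⟩
  rcases h : Nat.find hex with _ | b
  · rwa [cumProb_zero]
  · exact not_lt.1 (Nat.find_min hex (by omega))

/-- The marginals of the quantile coupling. -/
theorem sum_coupling (hW : ∀ b < N, 0 < W b) (hmono : ∀ b c, b ≤ c → c < N → W b ≤ W c)
    {v b : ℕ} (hv : v < N) (hb : b < N) :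
    ∑ k ∈ Finset.range (numStrategies N), (if strategy N k v = b then coupling W N k else 0) =
      bidProb W N v b := by
  classical
  rw [← Finset.sum_filter]
  have hlt : ∀ k {w}, w < N → strategy N k w < N := fun k _ hw => (strategy_le k _).trans_lt hw
  -- The quantile cells of the strategies bidding `b` at `v` tile the interval of quantiles at which
  -- value `v` bids `b`; its length is the marginal.
  have hunion : (⋃ k ∈ {k ∈ Finset.range (numStrategies N) | strategy N k v = b},
      quantiles W N (strategy N k)) = Set.Ico (cumProb W N v b) (cumProb W N v (b + 1)) := by
    ext u
    simp only [Set.mem_iUnion, Finset.mem_filter, Finset.mem_range, Set.mem_Ico, exists_prop]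
    constructor
    · rintro ⟨k, ⟨hk, rfl⟩, hu⟩
      exact hu.2 v hv
    · rintro hu
      have h0 : 0 ≤ u := by
        have := cumProb_mono (v := v) hW (Nat.zero_le b) hb.le
        rw [cumProb_zero] at this
        exact this.trans hu.1
      have h1 : u < 1 := by
        have := cumProb_mono (v := v) hW (show b + 1 ≤ N from hb) le_rfl
        rw [cumProb_of_lt hW hv hv] at this
        exact hu.2.trans_le this
      choose q hq using fun w (hw : w < N) => exists_quantile hW hw h0 h1
      let g : ℕ → ℕ := fun w => if hw : w < N then q w hw else 0
      have hgq : ∀ w (hw : w < N), g w = q w hw := fun w hw => by simp [g, hw]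
      have hg : g ∈ monotoneBids N N := by
        rw [mem_monotoneBids le_rfl]
        refine ⟨fun w hw => by simp [g, not_lt.2 hw], fun w => ?_, fun w hw => ?_⟩
        · by_cases hw : w < N
          · rw [hgq w hw]; exact (hq w hw).1
          · simp [g, hw]
        · rw [hgq w (by omega), hgq (w + 1) hw]
          -- If `w + 1` bid less than `w` at quantile `u`, dominance would give `u < cumProb W N (w
          -- + 1) (q' + 1) ≤ cumProb W N w (q' + 1) ≤ u`, where `q'` is the bid of `w + 1`.
          by_contra! hlt
          have e1 := (hq (w + 1) hw).2.2
          have e2 := (hq w (by omega)).2.1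
          have e0 := (hq w (by omega)).1
          have e3 := cumProb_mono (v := w) hW
            (show q (w + 1) hw + 1 ≤ q w (by omega) from hlt) (by omega)
          have e4 := cumProb_succ_le hW hmono hw
            (show q (w + 1) hw + 1 ≤ N by omega)
          linarith
      obtain ⟨k, hk, hkg⟩ := List.getElem_of_mem hg
      have hs : strategy N k = g := by rw [strategy, List.getD_eq_getElem _ _ hk, hkg]
      refine ⟨k, ⟨hk, ?_⟩, ⟨h0, h1⟩, fun w hw => ?_⟩
      · rw [hs, hgq v hv]
        exact quantile_unique hW ((hq v hv).1.trans_lt hv) hb (hq v hv).2 hu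
      · rw [hs, hgq w hw]
        exact (hq w hw).2
  have hdisj : (({k ∈ Finset.range (numStrategies N) | strategy N k v = b} : Finset ℕ) :
      Set ℕ).PairwiseDisjoint fun k => quantiles W N (strategy N k) := by
    intro k hk l hl hkl
    simp only [Finset.coe_filter, Finset.mem_range, Set.mem_ofPred_eq] at hk hl
    rw [Function.onFun, Set.disjoint_left]
    intro u hu hu'
    refine hkl ?_
    have hfun : strategy N k = strategy N l := by
      funext w
      by_cases hw : w < N
      · exact quantile_unique hW (hlt k hw) (hlt l hw) (hu.2 w hw) (hu'.2 w hw)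
      · rw [((mem_monotoneBids le_rfl).1 (strategy_mem hk.1)).1 w (by omega),
          ((mem_monotoneBids le_rfl).1 (strategy_mem hl.1)).1 w (by omega)]
    rw [strategy, strategy, List.getD_eq_getElem _ _ hk.1, List.getD_eq_getElem _ _ hl.1] at hfun
    exact (nodup_monotoneBids le_rfl).getElem_inj_iff.1 hfun
  have hfin : ∀ k ∈ ({k ∈ Finset.range (numStrategies N) | strategy N k v = b} : Finset ℕ),
      MeasureTheory.volume (quantiles W N (strategy N k)) ≠ ⊤ := by
    intro k _
    refine ne_top_of_le_ne_top ?_ (MeasureTheory.measure_mono (t := Set.Ico 0 1) fun u hu => hu.1)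
    simp
  have := MeasureTheory.measureReal_biUnion_finset hdisj
    (fun k _ => measurableSet_quantiles _) (μ := MeasureTheory.volume) hfin
  rw [hunion, Real.volume_real_Ico_of_le (cumProb_mono hW (by omega) hb), cumProb_succ_sub] at this
  rw [this]
  rfl

theorem sum_coupling_eq_one (hN : 0 < N) (hW : ∀ b < N, 0 < W b)
    (hmono : ∀ b c, b ≤ c → c < N → W b ≤ W c) :
    ∑ k ∈ Finset.range (numStrategies N), coupling W N k = 1 := by
  have h := sum_coupling hW hmono hN hN
  -- Value `0` can only bid `0`, so its marginal collects the mass of all strategies.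
  have h1 : bidProb W N 0 0 = 1 := by
    rw [← cumProb_succ_sub, cumProb_zero, cumProb_of_lt hW hN (by omega), sub_zero]
  rw [h1] at h
  rw [← h]
  refine Finset.sum_congr rfl fun k _ => ?_
  rw [if_pos (Nat.le_zero.1 (strategy_le k 0))]

/-- Below the least of the positive numbers `cumProb W N v 1` every value bids `0`. This keeps the
pivots of the state reduction positive. -/
theorem coupling_zero_pos (hW : ∀ b < N, 0 < W b) : 0 < coupling W N 0 := by
  classical
  obtain ⟨δ, hδ, hδ'⟩ : ∃ δ : ℝ, 0 < δ ∧ δ ≤ 1 ∧ ∀ v < N, δ ≤ cumProb W N v 1 := by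
    have : ∀ n ≤ N, ∃ δ : ℝ, 0 < δ ∧ δ ≤ 1 ∧ ∀ v < n, δ ≤ cumProb W N v 1 := by
      intro n
      induction n with
      | zero => exact fun _ => ⟨1, one_pos, le_rfl, by simp⟩
      | succ n ih =>
        intro hn
        obtain ⟨δ, h0, h1, h2⟩ := ih (by omega)
        have hp : 0 < cumProb W N n 1 := cumProb_pos hW one_pos (by omega)
        refine ⟨min δ (cumProb W N n 1), lt_min h0 hp, (min_le_left _ _).trans h1, fun v hv => ?_⟩
        rcases Nat.lt_succ_iff_lt_or_eq.1 hv with h | rfl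
        · exact (min_le_left _ _).trans (h2 v h)
        · exact min_le_right _ _
    exact this N le_rfl
  have hsub : Set.Ico 0 δ ⊆ quantiles W N (strategy N 0) := by
    intro u hu
    rw [strategy_zero]
    exact ⟨⟨hu.1, hu.2.trans_le hδ'.1⟩, fun v hv =>
      ⟨by rw [cumProb_zero]; exact hu.1, hu.2.trans_le (hδ'.2 v hv)⟩⟩
  have hfin : MeasureTheory.volume (quantiles W N (strategy N 0)) ≠ ⊤ := by
    refine ne_top_of_le_ne_top ?_ (MeasureTheory.measure_mono (t := Set.Ico 0 1) fun u hu => hu.1)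
    simp
  have := MeasureTheory.measureReal_mono hsub hfin
  rw [Real.volume_real_Ico_of_le hδ.le] at this
  rw [coupling]
  linarith

end Coupling

/-! ## The regret of multiplicative weights -/

theorem one_add_pow_sub_one_le {x : ℝ} (hx : 0 ≤ x) {k : ℕ} (hk : k * x ≤ 1) :
    (1 + x) ^ k - 1 ≤ k * x + (k * x) ^ 2 := by
  have h1 : (1 + x) ^ k ≤ Real.exp (k * x) := by
    rw [Real.exp_nat_mul]
    exact pow_le_pow_left₀ (by linarith) (by linarith [Real.add_one_le_exp x]) k
  have h2 := (abs_le.1 (Real.abs_exp_sub_one_sub_id_le (x := k * x)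
    (by rw [abs_of_nonneg (by positivity)]; exact hk))).2
  linarith

theorem sub_sq_le_log_one_add {x : ℝ} (hx : 0 ≤ x) : x - x ^ 2 ≤ Real.log (1 + x) := by
  refine le_trans ?_ (Real.one_sub_inv_le_log_of_pos (by linarith))
  have h : 1 - (1 + x)⁻¹ = x / (1 + x) := by field_simp; ring
  rw [h, le_div_iff₀ (by linarith)]
  nlinarith [pow_nonneg hx 3]

/-- The utility of bid `b` for value `v` against the bid `i`, in units of the grid width. -/
def gain (i v b : ℕ) : ℝ := if i ≤ b then (v : ℝ) - b else 0

theorem gain_nonneg {i v b : ℕ} (hb : b ≤ v) : 0 ≤ gain i v b := by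
  unfold gain
  split_ifs
  · simpa using hb
  · exact le_rfl

theorem gain_le {i v b : ℕ} : gain i v b ≤ v := by
  unfold gain
  split_ifs
  · simp
  · positivity

/-- The exponent is the utility in grid units, so changing the single family `W` performs the
multiplicative update for all values at once. -/
theorem bidWeight_step {W W' : ℕ → ℝ} {x : ℝ} {i v b : ℕ} (hb : b ≤ v)
    (h : W' b = if i ≤ b then W b * (1 + x) else W b) :
    bidWeight W' v b = bidWeight W v b * (1 + x) ^ (if i ≤ b then v - b else 0) := by
  simp only [bidWeight, hb, if_true, h]
  split_ifs <;> simp [mul_pow]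

/-- Potential argument: the logarithm of the total weight lies above that of the comparator's
weight. The rates `x t` vary with the round because they will be `η ρ_t(f)`. -/
theorem regret_multiplicativeWeights {N T v b : ℕ} (W : ℕ → ℕ → ℝ) (x : ℕ → ℝ) (i : ℕ → ℕ)
    (hv : v < N) (hb : b ≤ v) (h0 : ∀ b < N, W 0 b = 1)
    (hW : ∀ t < T, ∀ b < N, W (t + 1) b = if i t ≤ b then W t b * (1 + x t) else W t b)
    (hx : ∀ t < T, 0 ≤ x t ∧ N * x t ≤ 1) :
    ∑ t ∈ Finset.range T, x t * (gain (i t) v b -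
      ∑ j ∈ Finset.range N, bidProb (W t) N v j * gain (i t) v j) ≤
      Real.log N + 2 * N ^ 2 * ∑ t ∈ Finset.range T, x t ^ 2 := by
  have hcast : ∀ t j, j ≤ v → gain (i t) v j = ((if i t ≤ j then v - j else 0 : ℕ) : ℝ) := by
    intro t j hj
    unfold gain
    split_ifs
    · rw [Nat.cast_sub hj]
    · simp
  have hgN : ∀ t j, gain (i t) v j ≤ N := fun t j => gain_le.trans (by exact_mod_cast hv.le)
  have hpos : ∀ t ≤ T, ∀ b < N, 0 < W t b := by
    intro t
    induction t with
    | zero => intro _ b hb; rw [h0 b hb]; exact one_pos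
    | succ t ih =>
      intro ht b hb
      have h1 := ih (by omega) b hb
      have h2 := (hx t (by omega)).1
      rw [hW t (by omega) b hb]
      split_ifs <;> positivity
  -- Uses `log (1 + x) ≥ x - x ^ 2`; the error `gain * x ^ 2` is relaxed to `N ^ 2 * x ^ 2` to match
  -- the upper bound.
  have hlower : ∀ t ≤ T, ∑ s ∈ Finset.range t, (x s * gain (i s) v b - N ^ 2 * x s ^ 2) ≤
      Real.log (bidWeight (W t) v b) := by
    intro t
    induction t with
    | zero => intro _; simp [bidWeight, hb, h0 b (by omega)]
    | succ t ih =>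
      intro ht
      obtain ⟨hx0, hx1⟩ := hx t (by omega)
      have hwpos : 0 < bidWeight (W t) v b := by
        simpa [bidWeight, hb] using pow_pos (hpos t (by omega) b (by omega)) _
      rw [Finset.sum_range_succ, bidWeight_step hb (hW t (by omega) b (by omega)),
        Real.log_mul hwpos.ne' (by positivity), Real.log_pow, ← hcast t b hb]
      have h1 := mul_le_mul_of_nonneg_left (sub_sq_le_log_one_add hx0)
        (gain_nonneg (i := i t) hb)
      have h2 : gain (i t) v b * x t ^ 2 ≤ N ^ 2 * x t ^ 2 := by
        refine mul_le_mul_of_nonneg_right ((hgN t b).trans ?_) (sq_nonneg _)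
        have : (1 : ℝ) ≤ N := by exact_mod_cast (by omega : 1 ≤ N)
        nlinarith
      linarith [ih (by omega)]
  -- Uses `log y ≤ y - 1` and the quadratic bound on `(1 + x) ^ k - 1`, valid because utility times
  -- rate is at most `1`.
  have hupper : ∀ t ≤ T, Real.log (cumWeight (W t) v N) ≤ Real.log N +
      ∑ s ∈ Finset.range t, (x s * (∑ j ∈ Finset.range N, bidProb (W s) N v j * gain (i s) v j) +
        N ^ 2 * x s ^ 2) := by
    intro t
    induction t with
    | zero =>
      intro _
      have hp := cumWeight_pos (v := v) (hpos 0 (by omega)) (by omega : 0 < N) le_rfl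
      simp only [Finset.range_zero, Finset.sum_empty, add_zero]
      refine Real.log_le_log hp ?_
      calc cumWeight (W 0) v N ≤ ∑ j ∈ Finset.range N, (1 : ℝ) := by
            refine Finset.sum_le_sum fun j hj => ?_
            rw [bidWeight, h0 j (Finset.mem_range.1 hj)]
            split_ifs <;> simp
        _ = N := by simp
    | succ t ih =>
      intro ht
      obtain ⟨hx0, hx1⟩ := hx t (by omega)
      have hWt := hpos t (by omega)
      have hp := cumWeight_pos (v := v) hWt (by omega : 0 < N) le_rfl
      have hp' := cumWeight_pos (v := v) (hpos (t + 1) ht) (by omega : 0 < N) le_rfl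
      have hlog := Real.log_le_sub_one_of_pos (div_pos hp' hp)
      rw [Real.log_div hp'.ne' hp.ne'] at hlog
      have hratio : cumWeight (W (t + 1)) v N / cumWeight (W t) v N - 1 ≤
          x t * (∑ j ∈ Finset.range N, bidProb (W t) N v j * gain (i t) v j) +
            N ^ 2 * x t ^ 2 := by
        rw [← sum_bidProb hWt hv]
        have e : cumWeight (W (t + 1)) v N / cumWeight (W t) v N = ∑ j ∈ Finset.range N,
            bidProb (W t) N v j * (1 + x t) ^ (if i t ≤ j then v - j else 0) := by
          rw [cumWeight, Finset.sum_div]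
          refine Finset.sum_congr rfl fun j hj => ?_
          by_cases hjv : j ≤ v
          · rw [bidWeight_step hjv (hW t (by omega) j (Finset.mem_range.1 hj)), bidProb]
            ring
          · simp [bidProb, bidWeight, hjv]
        have e2 : (N : ℝ) ^ 2 * x t ^ 2 =
            ∑ j ∈ Finset.range N, bidProb (W t) N v j * (N ^ 2 * x t ^ 2) := by
          rw [← Finset.sum_mul, sum_bidProb hWt hv, one_mul]
        rw [e, e2, ← Finset.sum_sub_distrib, Finset.mul_sum, ← Finset.sum_add_distrib]
        refine Finset.sum_le_sum fun j hj => ?_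
        have hq := bidProb_nonneg (v := v) hWt (Finset.mem_range.1 hj)
        by_cases hjv : j ≤ v
        · have hk : ((if i t ≤ j then v - j else 0 : ℕ) : ℝ) * x t ≤ 1 := by
            rw [← hcast t j hjv]
            exact (mul_le_mul_of_nonneg_right (hgN t j) hx0).trans hx1
          have h1 := one_add_pow_sub_one_le hx0 hk
          rw [← hcast t j hjv] at h1
          have h2 : (gain (i t) v j * x t) ^ 2 ≤ N ^ 2 * x t ^ 2 := by
            rw [← mul_pow]
            exact pow_le_pow_left₀ (mul_nonneg (gain_nonneg hjv) hx0)
              (mul_le_mul_of_nonneg_right (hgN t j) hx0) 2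
          have h3 := mul_le_mul_of_nonneg_left (h1.trans (add_le_add_right h2 _)) hq
          linarith
        · simp [bidProb, bidWeight, hjv]
      rw [Finset.sum_range_succ]
      linarith [ih (by omega)]
  have h1 := hlower T le_rfl
  have h2 := hupper T le_rfl
  have h3 : Real.log (bidWeight (W T) v b) ≤ Real.log (cumWeight (W T) v N) := by
    refine Real.log_le_log ?_ ?_
    · simpa [bidWeight, hb] using pow_pos (hpos T le_rfl b (by omega)) _
    · exact Finset.single_le_sum
        (fun j hj => bidWeight_nonneg (hpos T le_rfl) (Finset.mem_range.1 hj))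
        (Finset.mem_range.2 (by omega : b < N))
  have h4 := h1.trans (h3.trans h2)
  rw [Finset.sum_sub_distrib, Finset.sum_add_distrib, ← Finset.mul_sum] at h4
  simp only [mul_sub, Finset.sum_sub_distrib]
  linarith

end FirstPriceAuction

/-! ## State reduction for Markov chains -/

namespace StateReduction

/-- The balance equations for the rates `P` on the states below `m`. -/
def Balanced (m : ℕ) (P : ℕ → ℕ → ℝ) (μ : ℕ → ℝ) : Prop :=
  ∀ j < m, ∑ i ∈ Finset.range m, μ i * P i j = μ j * ∑ k ∈ Finset.range m, P j k

/-- The rates on the states below `n` after elimination of state `n`; the column `n` holds the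
coefficients for the weight of state `n`. -/
def eliminate (P : ℕ → ℕ → ℝ) (n i j : ℕ) : ℝ :=
  if i < n then
    if j < n then P i j + P i n / (∑ k ∈ Finset.range n, P n k) * P n j
    else if j = n then P i n / (∑ k ∈ Finset.range n, P n k)
    else P i j
  else P i j

/-- `P` arises from `Q` by elimination of the states from `k` to `m - 1`. -/
structure Reduced (m : ℕ) (Q : ℕ → ℕ → ℝ) (k : ℕ) (P : ℕ → ℕ → ℝ) : Prop where
  balanced : ∀ μ : ℕ → ℝ, Balanced k P μ →
    (∀ n, 1 ≤ n → k ≤ n → n < m → μ n = ∑ i ∈ Finset.range n, μ i * P i n) → Balanced m Q μ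
  nonneg : ∀ i < m, ∀ j < m, 0 ≤ P i j
  pos : ∀ i < m, 0 < P i 0

theorem Reduced.refl {m : ℕ} {Q : ℕ → ℕ → ℝ} (h : ∀ i < m, ∀ j < m, 0 ≤ Q i j)
    (h' : ∀ i < m, 0 < Q i 0) : Reduced m Q m Q :=
  ⟨fun _ hμ _ => hμ, h, h'⟩

/-- The balance equation at `n` reads `μ n * s = ∑ μ i * P i n`, as the diagonal rate cancels.
Substituting it into the other equations gives the balance equations of the eliminated rates. -/
theorem balanced_of_eliminate {P : ℕ → ℕ → ℝ} {μ : ℕ → ℝ} {n : ℕ}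
    (hs : 0 < ∑ k ∈ Finset.range n, P n k) (h : Balanced n (eliminate P n) μ)
    (hn : μ n = ∑ i ∈ Finset.range n, μ i * eliminate P n i n) : Balanced (n + 1) P μ := by
  set s := ∑ k ∈ Finset.range n, P n k with hsdef
  have hn' : μ n * s = ∑ i ∈ Finset.range n, μ i * P i n := by
    rw [hn, Finset.sum_mul]
    refine Finset.sum_congr rfl fun i hi => ?_
    simp only [eliminate, Finset.mem_range.1 hi, lt_irrefl, if_true, if_false, ← hsdef]
    field_simp
  intro j hj
  rw [Finset.sum_range_succ, Finset.sum_range_succ]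
  rcases Nat.lt_succ_iff_lt_or_eq.1 hj with hj | rfl
  · have hb := h j hj
    have e1 : ∀ i ∈ Finset.range n, ∀ k ∈ Finset.range n,
        eliminate P n i k = P i k + P i n / s * P n k := by
      intro i hi k hk
      simp [eliminate, Finset.mem_range.1 hi, Finset.mem_range.1 hk, ← hsdef]
    rw [Finset.sum_congr rfl fun i hi => by rw [e1 i hi j (Finset.mem_range.2 hj)],
      Finset.sum_congr rfl fun k hk => e1 j (Finset.mem_range.2 hj) k hk,
      Finset.sum_add_distrib, ← Finset.mul_sum, ← hsdef, div_mul_cancel₀ _ hs.ne'] at hb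
    rw [← hb]
    have : μ n * P n j = ∑ i ∈ Finset.range n, μ i * (P i n / s * P n j) := by
      rw [show μ n * P n j = (μ n * s) * (P n j / s) by field_simp, hn', Finset.sum_mul]
      refine Finset.sum_congr rfl fun i _ => by ring
    rw [this, ← Finset.sum_add_distrib]
    exact Finset.sum_congr rfl fun i _ => by ring
  · rw [← hn', mul_add]

/-- Nothing is subtracted, so rates stay nonnegative and rates into state `0` stay positive, hence
so do the pivots. Columns beyond `n` are untouched, so the coefficients stored earlier survive. -/
theorem Reduced.eliminate {m n : ℕ} {P Q : ℕ → ℕ → ℝ} (h : Reduced m Q (n + 1) P) (hn : n < m) :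
    Reduced m Q n (eliminate P n) := by
  have hsum : ∀ {n}, 0 < n → n < m → 0 < ∑ k ∈ Finset.range n, P n k := fun h0 hm =>
    Finset.sum_pos' (fun k hk => h.nonneg _ hm _ ((Finset.mem_range.1 hk).trans hm))
      ⟨0, Finset.mem_range.2 h0, h.pos _ hm⟩
  have hcol : ∀ i j, n < j → StateReduction.eliminate P n i j = P i j := by
    intro i j hj
    simp [StateReduction.eliminate, not_lt.2 hj.le, hj.ne']
  refine ⟨fun μ hμ hcoef => h.balanced μ ?_ ?_, fun i hi j hj => ?_, fun i hi => ?_⟩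
  -- With a single state the balance equation is trivial; its pivot, an empty sum, plays no role.
  · rcases n with _ | n
    · intro j hj
      rw [Nat.lt_one_iff.1 hj]
      simp
    · exact balanced_of_eliminate (hsum (by omega) hn) hμ (hcoef _ (by omega) le_rfl hn)
  · intro l h1 h2 h3
    rw [hcoef l h1 (by omega) h3]
    exact Finset.sum_congr rfl fun i _ => by rw [hcol i l (by omega)]
  · have h1 := h.nonneg i hi j hj
    have h2 := h.nonneg i hi n hn
    have h3 := h.nonneg n hn j hj
    have h4 : 0 ≤ ∑ k ∈ Finset.range n, P n k :=
      Finset.sum_nonneg fun k hk => h.nonneg n hn k ((Finset.mem_range.1 hk).trans hn)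
    unfold StateReduction.eliminate
    split_ifs <;> positivity
  · have h1 := h.pos i hi
    have h2 := h.nonneg i hi n hn
    have h3 := h.pos n hn
    have h4 : 0 ≤ ∑ k ∈ Finset.range n, P n k :=
      Finset.sum_nonneg fun k hk => h.nonneg n hn k ((Finset.mem_range.1 hk).trans hn)
    unfold StateReduction.eliminate
    split_ifs with ha hb hc
    · positivity
    · omega
    · exact h1
    · exact h1

theorem Reduced.solution {m : ℕ} {P Q : ℕ → ℕ → ℝ} (h : Reduced m Q 0 P) {μ : ℕ → ℝ}
    (h0 : μ 0 = 1) (hμ : ∀ n, 1 ≤ n → n < m → μ n = ∑ i ∈ Finset.range n, μ i * P i n) :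
    Balanced m Q μ ∧ ∀ n < m, 0 ≤ μ n := by
  refine ⟨h.balanced μ (fun j hj => absurd hj (Nat.not_lt_zero j)) fun n h1 _ h2 => hμ n h1 h2,
    fun n => ?_⟩
  induction n using Nat.strong_induction_on with
  | _ n ih =>
    intro hn
    rcases n.eq_zero_or_pos with rfl | hpos
    · rw [h0]; exact zero_le_one
    · rw [hμ n hpos hn]
      refine Finset.sum_nonneg fun i hi => ?_
      have := Finset.mem_range.1 hi
      exact mul_nonneg (ih i this (by omega)) (h.nonneg i (by omega) n hn)

end StateReduction

namespace FirstPriceAuction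

open RealRAM RealRAM.Code

/-! ## The program: table of the monotone strategies -/

/-- The scalar in an integer array. -/
abbrev var (a : ℕ) : NatExpr := .get a (.lit 0)

/-- The scalar in a real array. -/
abbrev rvar (a : ℕ) : RealExpr := .get a (.lit 0)

/-- Assignment to the scalar in an integer array. -/
abbrev setVar (a : ℕ) (x : NatExpr) : Code := .setNat a (.lit 0) x

/-- Assignment to the scalar in a real array. -/
abbrev setRvar (a : ℕ) (x : RealExpr) : Code := .setReal a (.lit 0) x

/-- The address of an entry of a two-dimensional array of width `w`. -/
abbrev entry (w r c : NatExpr) : NatExpr := .add (.mul r w) c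

/-- Computes `4 ^ N` in `nat 1 0`. -/
def powerCode : Code := .seq (setVar 1 (.lit 1)) (.rep 3 0 (setVar 1 (.mul (var 1) (.lit 4))))

theorem run_powerCode (s : Mem) : (powerCode.run s).nat 1 0 = 4 ^ s.nat 0 0 := by
  have := run_rep (x := 3) (a := 0) (P := setVar 1 (.mul (var 1) (.lit 4)))
    ((setVar 1 (.lit 1)).run s) (fun k t => t.nat 1 0 = 4 ^ k)
    (by simp [run, setNat_nat, NatExpr.eval])
    (fun k _ t _ _ _ h => by simp [run, setNat_nat, NatExpr.eval, h, pow_succ])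
  simpa [powerCode, run, setNat_nat] using this

/-- The row of the table in which row `nat 4 0` of level `nat 3 0` is stored. -/
abbrev sourceRow : NatExpr := entry (var 1) (var 3) (var 4)

/-- The first free row of the next level. -/
abbrev targetRow : NatExpr := entry (var 1) (.add (var 3) (.lit 1)) (var 7)

/-- Copies the source row to the target row. -/
def copyCode : Code :=
  .rep 6 0 (.setNat 8 (entry (var 0) targetRow (var 6))
    (.get 8 (entry (var 0) sourceRow (var 6))))

/-- Copies the source row, extended by the bid `nat 5 0`, to the target row. -/
def pushCode : Code :=
  .seq copyCode (.seq (.setNat 8 (entry (var 0) targetRow (var 3)) (var 5))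
    (setVar 7 (.add (var 7) (.lit 1))))

/-- Extends the source row in all possible ways. -/
def extendCode : Code :=
  .rep 5 0 (.cond (.and
    -- At level `0` the truncated subtraction reads column `0` of the zero row, so this test passes.
    (.natLe (.get 8 (entry (var 0) sourceRow (.sub (var 3) (.lit 1)))) (var 5))
    (.natLe (var 5) (var 3))) pushCode .skip)

/-- Computes the next level of the table. -/
def levelCode : Code :=
  .seq (setVar 7 (.lit 0)) (.seq
    -- The number of rows in `nat 2 0` changes between levels while loop bounds must stay constant;
    -- hence `4 ^ N` passes guarded by a test.
    (.rep 4 1 (.cond (.natLe (.add (var 4) (.lit 1)) (var 2)) extendCode .skip))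
    (setVar 2 (var 7)))

/-- Computes the table of the monotone strategies in the integer array `8`, and their number in
`nat 2 0`. -/
def tableCode : Code :=
  -- Clearing the first row makes the table independent of the memory on entry.
  .seq (.rep 6 0 (.setNat 8 (var 6) (.lit 0))) (.seq (setVar 2 (.lit 1)) (.rep 3 0 levelCode))

/-- The rows of the table `A` from row `r` on contain the functions in the list `l`. -/
def Rows (A : ℕ → ℕ) (N r : ℕ) (l : List (ℕ → ℕ)) : Prop :=
  ∀ k (h : k < l.length), ∀ v < N, A ((r + k) * N + v) = l[k] v

theorem entry_lt {N r c r' : ℕ} (hc : c < N) (h : r < r') : r * N + c < r' * N := by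
  calc r * N + c < r * N + N := by omega
    _ = (r + 1) * N := by ring
    _ ≤ r' * N := Nat.mul_le_mul_right _ h

theorem entry_inj {N r c r' c' : ℕ} (hc : c < N) (hc' : c' < N) :
    r * N + c = r' * N + c' ↔ r = r' ∧ c = c' := by
  constructor
  · intro h
    have hr : r = r' := by
      rcases lt_trichotomy r r' with hlt | heq | hlt
      · have := entry_lt hc hlt; omega
      · exact heq
      · have := entry_lt hc' hlt; omega
    subst hr
    exact ⟨rfl, by omega⟩
  · rintro ⟨rfl, rfl⟩; rfl

theorem Rows.of_agree {A A' : ℕ → ℕ} {N r : ℕ} {l : List (ℕ → ℕ)} (h : Rows A N r l)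
    (hA : ∀ j < (r + l.length) * N, A' j = A j) : Rows A' N r l := fun k hk v hv => by
  rw [hA _ (entry_lt hv (by omega)), h k hk v hv]

theorem Rows.append {A A' : ℕ → ℕ} {N r : ℕ} {l : List (ℕ → ℕ)} {f : ℕ → ℕ} (h : Rows A N r l)
    (hA : ∀ j < (r + l.length) * N, A' j = A j)
    (hf : ∀ v < N, A' ((r + l.length) * N + v) = f v) : Rows A' N r (l ++ [f]) := by
  intro k hk v hv
  by_cases hkl : k < l.length
  · rw [List.getElem_append_left hkl]
    exact h.of_agree hA k hkl v hv
  · have : k = l.length := by simp at hk; omega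
    subst this
    simpa using hf v hv

/-- The source row lies in the block of its own level, before the target row, so copying does not
destroy entries still to be read. -/
theorem run_copyCode (s : Mem) (hr : s.nat 4 0 < s.nat 1 0) :
    (∀ v < s.nat 0 0,
      (copyCode.run s).nat 8 (((s.nat 3 0 + 1) * s.nat 1 0 + s.nat 7 0) * s.nat 0 0 + v) =
        s.nat 8 ((s.nat 3 0 * s.nat 1 0 + s.nat 4 0) * s.nat 0 0 + v)) ∧
    ∀ j < ((s.nat 3 0 + 1) * s.nat 1 0 + s.nat 7 0) * s.nat 0 0,
      (copyCode.run s).nat 8 j = s.nat 8 j := by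
  refine run_rep (x := 6) (a := 0) s (fun k t => (∀ v < k,
      t.nat 8 (((s.nat 3 0 + 1) * s.nat 1 0 + s.nat 7 0) * s.nat 0 0 + v) =
        s.nat 8 ((s.nat 3 0 * s.nat 1 0 + s.nat 4 0) * s.nat 0 0 + v)) ∧
    ∀ j < ((s.nat 3 0 + 1) * s.nat 1 0 + s.nat 7 0) * s.nat 0 0, t.nat 8 j = s.nat 8 j) ?_ ?_
  · simp [setNat_nat]
  · rintro k hk t htk hN - ⟨h1, h2⟩
    have e0 := hN 0 (by decide)
    have e1 := hN 1 (by decide)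
    have e3 := hN 3 (by decide)
    have e4 := hN 4 (by decide)
    have e7 := hN 7 (by decide)
    have hsrc : (s.nat 3 0 * s.nat 1 0 + s.nat 4 0) * s.nat 0 0 + k <
        ((s.nat 3 0 + 1) * s.nat 1 0 + s.nat 7 0) * s.nat 0 0 := entry_lt hk (by
      rw [add_mul]; omega)
    simp only [run, setNat_nat, NatExpr.eval, e0, e1, e3, e4, e7, htk]
    constructor
    · intro v hv
      by_cases hvk : v = k
      · subst hvk
        simp [h2 _ hsrc]
      · simp [hvk, h1 v (by omega)]
    · intro j hj
      rw [if_neg (by omega), if_neg (by omega), h2 j hj]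

theorem run_pushCode (s : Mem) (hr : s.nat 4 0 < s.nat 1 0) :
    (pushCode.run s).nat 7 0 = s.nat 7 0 + 1 ∧
    (∀ v < s.nat 0 0,
      (pushCode.run s).nat 8 (((s.nat 3 0 + 1) * s.nat 1 0 + s.nat 7 0) * s.nat 0 0 + v) =
        if v = s.nat 3 0 then s.nat 5 0 else
        s.nat 8 ((s.nat 3 0 * s.nat 1 0 + s.nat 4 0) * s.nat 0 0 + v)) ∧
    ∀ j < ((s.nat 3 0 + 1) * s.nat 1 0 + s.nat 7 0) * s.nat 0 0,
      (pushCode.run s).nat 8 j = s.nat 8 j := by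
  obtain ⟨h1, h2⟩ := run_copyCode s hr
  have e0 := copyCode.run_nat s (a := 0) (by decide)
  have e1 := copyCode.run_nat s (a := 1) (by decide)
  have e3 := copyCode.run_nat s (a := 3) (by decide)
  have e5 := copyCode.run_nat s (a := 5) (by decide)
  have e7 := copyCode.run_nat s (a := 7) (by decide)
  simp only [pushCode, run, setNat_nat, NatExpr.eval, e0, e1, e3, e5, e7]
  refine ⟨by simp, fun v hv => ?_, fun j hj => ?_⟩
  · by_cases hv3 : v = s.nat 3 0
    · simp [hv3]
    · simp [hv3, h1 v hv]
  · rw [if_neg (by omega), if_neg (by omega), h2 j hj]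

theorem run_extendCode (s : Mem) {l l' : List (ℕ → ℕ)} {n r : ℕ} (hn : s.nat 3 0 = n)
    (hnN : n < s.nat 0 0)
    (hr : s.nat 4 0 = r) (hrl : r < l.length) (hl : l.length ≤ s.nat 1 0)
    (hsrc : Rows (s.nat 8) (s.nat 0 0) (n * s.nat 1 0) l)
    (htgt : Rows (s.nat 8) (s.nat 0 0) ((n + 1) * s.nat 1 0) l') (hlen : s.nat 7 0 = l'.length) :
    Rows ((extendCode.run s).nat 8) (s.nat 0 0) (n * s.nat 1 0) l ∧
    Rows ((extendCode.run s).nat 8) (s.nat 0 0) ((n + 1) * s.nat 1 0)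
      (l' ++ (nextBids (s.nat 0 0) n l[r]).map (Function.update l[r] n)) ∧
    (extendCode.run s).nat 7 0 =
      (l' ++ (nextBids (s.nat 0 0) n l[r]).map (Function.update l[r] n)).length := by
  unfold nextBids
  refine run_rep (x := 5) (a := 0) s (fun k t =>
    Rows (t.nat 8) (s.nat 0 0) (n * s.nat 1 0) l ∧
    Rows (t.nat 8) (s.nat 0 0) ((n + 1) * s.nat 1 0)
      (l' ++ ((List.range k).filter fun b => l[r] (n - 1) ≤ b ∧ b ≤ n).map
        (Function.update l[r] n)) ∧
    t.nat 7 0 = (l' ++ ((List.range k).filter fun b => l[r] (n - 1) ≤ b ∧ b ≤ n).map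
        (Function.update l[r] n)).length) ?_ ?_
  · simpa [setNat_nat_of_ne, setNat_nat, hlen] using ⟨hsrc, htgt⟩
  · rintro k hk t htk hN - ⟨h1, h2, h3⟩
    have e0 := hN 0 (by decide)
    have e1 := hN 1 (by decide)
    have e3 := hN 3 (by decide)
    have e4 := hN 4 (by decide)
    have hprev : t.nat 8 ((n * s.nat 1 0 + r) * s.nat 0 0 + (n - 1)) = l[r] (n - 1) :=
      h1 r hrl (n - 1) (by omega)
    simp only [run, Test.Holds, NatExpr.eval, e0, e1, e3, e4, hn, hr, htk, hprev]
    rw [List.range_succ, List.filter_append]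
    by_cases hcond : l[r] (n - 1) ≤ k ∧ k ≤ n
    · obtain ⟨p1, p2, p3⟩ := run_pushCode t (by rw [e4, e1, hr]; omega)
      rw [e0, e1, e3, hn, h3] at p2 p3
      rw [h3] at p1
      have hlt : (n * s.nat 1 0 + l.length) ≤ (n + 1) * s.nat 1 0 := by
        rw [add_mul]; omega
      have hsing : List.filter (fun b => decide (l[r] (n - 1) ≤ b ∧ b ≤ n)) [k] = [k] := by
        simp [hcond]
      rw [if_pos hcond, hsing, List.map_append, ← List.append_assoc,
        setNat_nat_of_ne (by norm_num), setNat_nat_of_ne (by norm_num)]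
      refine ⟨h1.of_agree fun j hj => p3 j (hj.trans_le (Nat.mul_le_mul_right _ ?_)),
        h2.append p3 fun v hv => ?_, ?_⟩
      · omega
      · rw [p2 v hv, htk, e4, hr, h1 r hrl v hv, Function.update_apply]
      · rw [p1]; simp [add_assoc]
    · have hsing : List.filter (fun b => decide (l[r] (n - 1) ≤ b ∧ b ≤ n)) [k] = [] := by
        simpa using hcond
      rw [if_neg hcond, hsing, List.append_nil, setNat_nat_of_ne (by norm_num),
        setNat_nat_of_ne (by norm_num)]
      exact ⟨h1, h2, h3⟩

theorem run_levelCode (s : Mem) {N n : ℕ} (h0 : s.nat 0 0 = N) (h1 : s.nat 1 0 = 4 ^ N)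
    (hn : s.nat 3 0 = n) (hnN : n < N) (hlen : s.nat 2 0 = (monotoneBids N n).length)
    (hrows : Rows (s.nat 8) N (n * 4 ^ N) (monotoneBids N n)) :
    (levelCode.run s).nat 2 0 = (monotoneBids N (n + 1)).length ∧
    Rows ((levelCode.run s).nat 8) N ((n + 1) * 4 ^ N) (monotoneBids N (n + 1)) := by
  set l := monotoneBids N n with hl
  -- Each level fits into its block of `4 ^ N` rows, so levels do not overlap.
  have hlM : l.length ≤ 4 ^ N := length_monotoneBids_le hnN.le
  set s' := (setVar 7 (.lit 0)).run s with hs'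
  have e : ∀ a, a ≠ 7 → s'.nat a = s.nat a := fun a ha => setNat_nat_of_ne ha
  have e7 : s'.nat 7 0 = 0 := by simp [hs', run, setNat_nat, NatExpr.eval]
  have key := run_rep (x := 4) (a := 1)
    (P := .cond (.natLe (.add (var 4) (.lit 1)) (var 2)) extendCode .skip) s' (fun k t =>
      Rows (t.nat 8) N (n * 4 ^ N) l ∧
      Rows (t.nat 8) N ((n + 1) * 4 ^ N) ((l.take k).flatMap fun f =>
        (nextBids N n f).map (Function.update f n)) ∧
      t.nat 7 0 = ((l.take k).flatMap fun f =>
        (nextBids N n f).map (Function.update f n)).length) ?_ ?_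
  · rw [e 1 (by norm_num), h1, List.take_of_length_le hlM] at key
    obtain ⟨u, hu⟩ : ∃ u, u = (Code.rep 4 1 (.cond (.natLe (.add (var 4) (.lit 1)) (var 2))
      extendCode .skip)).run s' := ⟨_, rfl⟩
    have hrun : levelCode.run s = u.setNat 2 0 (u.nat 7 0) := by rw [hu]; rfl
    rw [← hu] at key
    rw [hrun, setNat_nat, setNat_nat_of_ne (by norm_num)]
    exact ⟨key.2.2, key.2.1⟩
  · rw [setNat_nat_of_ne (by norm_num), setNat_nat_of_ne (by norm_num), e 8 (by norm_num), e7]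
    exact ⟨hrows, by intro k hk; simp at hk, by simp⟩
  · rintro k hk t htk hN - ⟨i1, i2, i3⟩
    have t0 : t.nat 0 0 = N := by rw [hN 0 (by decide), e 0 (by norm_num), h0]
    have t1 : t.nat 1 0 = 4 ^ N := by rw [hN 1 (by decide), e 1 (by norm_num), h1]
    have t2 : t.nat 2 0 = l.length := by rw [hN 2 (by decide), e 2 (by norm_num), hlen]
    have t3 : t.nat 3 0 = n := by rw [hN 3 (by decide), e 3 (by norm_num), hn]
    simp only [run, Test.Holds, NatExpr.eval, htk, t2]
    by_cases hkl : k + 1 ≤ l.length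
    · have hx := run_extendCode t t3 (by omega) htk hkl (by omega)
        (by rw [t0, t1]; exact i1) (by rw [t0, t1]; exact i2) i3
      rw [t0, t1] at hx
      rw [if_pos hkl, setNat_nat_of_ne (by norm_num), setNat_nat_of_ne (by norm_num),
        List.take_succ_eq_append_getElem (by omega), List.flatMap_append, List.flatMap_singleton]
      exact hx
    · rw [if_neg hkl, setNat_nat_of_ne (by norm_num), setNat_nat_of_ne (by norm_num)]
      rw [List.take_of_length_le (by omega)] at i2 i3 ⊢
      exact ⟨i1, i2, i3⟩

theorem run_tableCode (s : Mem) {N : ℕ} (h0 : s.nat 0 0 = N) (h1 : s.nat 1 0 = 4 ^ N) :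
    (tableCode.run s).nat 2 0 = numStrategies N ∧
    ∀ k < numStrategies N, ∀ v < N,
      (tableCode.run s).nat 8 ((N * 4 ^ N + k) * N + v) = strategy N k v := by
  set s₁ := (Code.rep 6 0 (.setNat 8 (var 6) (.lit 0))).run s with hs₁
  have hz : ∀ v < N, s₁.nat 8 v = 0 := by
    have := run_rep (x := 6) (a := 0) (P := .setNat 8 (var 6) (.lit 0)) s
      (fun k t => ∀ v < k, t.nat 8 v = 0) (by simp) (fun k _ t htk _ _ h v hv => by
        simp only [run, setNat_nat, NatExpr.eval, htk]
        by_cases hvk : v = k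
        · simp [hvk]
        · simp [hvk, h v (by omega)])
    rwa [h0] at this
  set s₂ := (setVar 2 (.lit 1)).run s₁ with hs₂
  have e : ∀ a, a ≠ 2 → a ≠ 6 → a ≠ 8 → s₂.nat a = s.nat a := fun a h2 h6 h8 => by
    rw [hs₂, run_nat _ _ (by simpa [natWrites] using h2), hs₁,
      run_nat _ _ (by simpa [natWrites] using ⟨h6, h8⟩)]
  have key := run_rep (x := 3) (a := 0) (P := levelCode) s₂ (fun k t =>
      t.nat 2 0 = (monotoneBids N k).length ∧ Rows (t.nat 8) N (k * 4 ^ N) (monotoneBids N k))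
    ?_ ?_
  · rw [e 0 (by norm_num) (by norm_num) (by norm_num), h0] at key
    refine ⟨key.1, fun k hk v hv => ?_⟩
    rw [strategy, List.getD_eq_getElem _ _ hk]
    exact key.2 k hk v hv
  · refine ⟨by simp [hs₂, run, setNat_nat, NatExpr.eval, monotoneBids], ?_⟩
    intro k hk v hv
    have : k = 0 := by simpa [monotoneBids] using hk
    subst this
    have : s₂.nat 8 v = 0 := by
      rw [hs₂, run_nat _ _ (by decide)]
      exact hz v hv
    simp only [add_zero, zero_mul, zero_add,
      setNat_nat_of_ne (show 8 ≠ 3 by norm_num), this]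
    rfl
  · rintro k hk t htk hN - ⟨i1, i2⟩
    rw [e 0 (by norm_num) (by norm_num) (by norm_num), h0] at hk
    have := run_levelCode t (N := N) (by
      rw [hN 0 (by decide), e 0 (by norm_num) (by norm_num) (by norm_num), h0]) (by
      rw [hN 1 (by decide), e 1 (by norm_num) (by norm_num) (by norm_num), h1]) htk hk i1 i2
    rw [setNat_nat_of_ne (by norm_num), setNat_nat_of_ne (by norm_num)]
    exact this

end FirstPriceAuction

namespace FirstPriceAuction

open RealRAM RealRAM.Code

/-! ## The program: update of the weights -/

/-- The learning rate. -/
def learningRate (N T : ℕ) : ℝ := Real.sqrt ((4 ^ N : ℕ) / (N * N * N * T : ℕ))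

/-- Computes the learning rate. -/
def rateCode : Code :=
  setRvar 5 (.sqrt (.div (.cast (var 1))
    (.cast (.mul (.mul (.mul (var 0) (var 0)) (var 0)) (.get 0 (.lit 1))))))

theorem run_rateCode (s : Mem) {N T : ℕ} (h0 : s.nat 0 0 = N) (hT : s.nat 0 1 = T)
    (h1 : s.nat 1 0 = 4 ^ N) : (rateCode.run s).real 5 0 = learningRate N T := by
  simp [rateCode, run, setReal_real, RealExpr.eval, NatExpr.eval, h0, h1, hT, learningRate]

/-- Multiplies the weights of the bid `nat 5 0` if it wins against the last bid of the
optimizer. -/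
def updateEntryCode : Code :=
  .cond (.natLe (.get 0 (.lit 2)) (var 5))
    (.setReal 3 (entry (var 0) (var 4) (var 5))
      (.add (.get 3 (entry (var 0) (var 4) (var 5)))
        (.mul (.mul (rvar 5) (.get 4 (var 4)))
          (.add (.cast (.lit 1)) (.get 3 (entry (var 0) (var 4) (var 5))))))) .skip

/-- Updates the weights of all strategies. -/
def updateCode : Code := .rep 4 1 (.rep 5 0 updateEntryCode)

/-- The array stores weights minus one, so zero memory means weight `1`, and the update multiplies
`1 + r` by `1 + η ρ`. In the first round `ρ` is still zero and nothing changes. -/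
theorem run_updateCode (s : Mem) {N : ℕ} (h0 : s.nat 0 0 = N) :
    ∀ f < s.nat 1 0, ∀ b < N, (updateCode.run s).real 3 (f * N + b) =
      if s.nat 0 2 ≤ b then s.real 3 (f * N + b) +
        s.real 5 0 * s.real 4 f * (1 + s.real 3 (f * N + b)) else s.real 3 (f * N + b) := by
  refine (run_rep (x := 4) (a := 1) s (fun k t => (∀ f < k, ∀ b < N,
    t.real 3 (f * N + b) = if s.nat 0 2 ≤ b then s.real 3 (f * N + b) +
        s.real 5 0 * s.real 4 f * (1 + s.real 3 (f * N + b)) else s.real 3 (f * N + b)) ∧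
      ∀ j, k * N ≤ j → t.real 3 j = s.real 3 j) ?_ ?_).1
  · simp
  · rintro k hk t htk hN hR ⟨i1, i2⟩
    have t0 : t.nat 0 0 = N := by rw [hN 0 (by decide), h0]
    have t02 : t.nat 0 2 = s.nat 0 2 := by rw [hN 0 (by decide)]
    have key := run_rep (x := 5) (a := 0) (P := updateEntryCode) t
      (fun l u => (∀ b < l, u.real 3 (k * N + b) = if s.nat 0 2 ≤ b then s.real 3 (k * N + b) +
        s.real 5 0 * s.real 4 k * (1 + s.real 3 (k * N + b)) else s.real 3 (k * N + b)) ∧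
        (∀ j, k * N + l ≤ j → u.real 3 j = s.real 3 j) ∧
        ∀ j < k * N, u.real 3 j = t.real 3 j) ?_ ?_
    · rw [t0] at key
      rw [setNat_real]
      refine ⟨fun f hf b hb => ?_, fun j hj => key.2.1 j (by rw [add_mul] at hj; omega)⟩
      rcases Nat.lt_succ_iff_lt_or_eq.1 hf with hf | rfl
      · rw [key.2.2 _ (entry_lt hb hf)]
        exact i1 f hf b hb
      · exact key.1 b hb
    · simpa using i2
    · rintro l hl u hul hN' hR' ⟨j1, j2, j3⟩
      rw [t0] at hl
      have u0 : u.nat 0 0 = N := by rw [hN' 0 (by decide), t0]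
      have u02 : u.nat 0 2 = s.nat 0 2 := by rw [hN' 0 (by decide), t02]
      have u4 : u.nat 4 0 = k := by rw [hN' 4 (by decide), htk]
      have r4 : u.real 4 = s.real 4 := by rw [hR' 4 (by decide), hR 4 (by decide)]
      have r5 : u.real 5 = s.real 5 := by rw [hR' 5 (by decide), hR 5 (by decide)]
      simp only [updateEntryCode, run, Test.Holds, NatExpr.eval, RealExpr.eval, u0, u02, u4,
        hul, setNat_real, r4, r5]
      by_cases hil : s.nat 0 2 ≤ l
      · simp only [if_pos hil, setReal_real, true_and]
        refine ⟨fun b hb => ?_, fun j hj => ?_, fun j hj => ?_⟩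
        · by_cases hbl : b = l
          · subst hbl
            simp [hil, j2 _ le_rfl]
          · rw [if_neg (by omega), j1 b (by omega)]
        · rw [if_neg (by omega), j2 j (by omega)]
        · rw [if_neg (by omega), j3 j hj]
      · simp only [if_neg hil]
        refine ⟨fun b hb => ?_, fun j hj => j2 j (by omega), j3⟩
        by_cases hbl : b = l
        · subst hbl
          simp [hil, j2 _ le_rfl]
        · exact j1 b (by omega)

/-! ## The program: transition probabilities -/

/-- Adds the values of `e` for which the test `b` holds, over all values of the counter, to the
scalar `real c 0`. -/
def sumCode (x a c : ℕ) (b : Test) (e : RealExpr) : Code :=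
  .rep x a (.cond b (setRvar c (.add (rvar c) e)) .skip)

open Classical in
theorem run_sumCode {x a c : ℕ} {b : Test} {e : RealExpr} (s : Mem) (val : ℕ → ℝ)
    (h : ∀ k < s.nat a 0, ∀ t : Mem, t.nat x 0 = k → (∀ y, y ≠ x → t.nat y = s.nat y) →
      (∀ y, y ≠ c → t.real y = s.real y) → (if b.Holds t then e.eval t else 0) = val k) :
    ((sumCode x a c b e).run s).real c 0 =
      s.real c 0 + ∑ k ∈ Finset.range (s.nat a 0), val k := by
  refine run_rep (x := x) (a := a) s (fun k t => t.real c 0 =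
    s.real c 0 + ∑ k ∈ Finset.range k, val k) (by simp) ?_
  intro k hk t htk hN hR hI
  have hv := h k hk t htk (fun y hy => hN y (by simpa [natWrites] using hy))
    (fun y hy => hR y (by simpa [realWrites] using hy))
  rw [Finset.sum_range_succ, ← add_assoc, ← hI, ← hv]
  simp only [run, setNat_real]
  split_ifs <;> simp [setReal_real, RealExpr.eval, NatExpr.eval]

/-- The address of the bid for value `v` of the strategy with index `g`. -/
abbrev bidEntry (g v : NatExpr) : NatExpr := entry (var 0) (entry (var 1) (var 0) g) v

/-- Computes the weight of bid `nat 5 0` for value `nat 6 0` from the weight for the previous value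
in the real array `6`, and adds it to the cumulated weight. -/
def cumWeightBody : Code :=
  .seq
    (.cond (.natLe (var 5) (var 6))
      (.seq (.cond (.natLe (var 6) (var 5))
          (.setReal 6 (var 5) (.cast (.lit 1)))
          (.setReal 6 (var 5) (.mul (.get 6 (var 5)) (.add (.cast (.lit 1))
            (.get 3 (entry (var 0) (var 4) (var 5)))))))
        (setRvar 7 (.add (rvar 7) (.get 6 (var 5))))) .skip)
    (.setReal 8 (entry (.add (var 0) (.lit 1)) (var 6) (.add (var 5) (.lit 1))) (rvar 7))

/-- The cumulated weights of the bids for value `nat 6 0`. -/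
def cumWeightCode : Code :=
  .seq (setRvar 7 (.cast (.lit 0)))
    (.seq (.setReal 8 (entry (.add (var 0) (.lit 1)) (var 6) (.lit 0)) (.cast (.lit 0)))
      (.rep 5 0 cumWeightBody))

theorem run_cumWeightBody (t : Mem) {N f v k : ℕ} (h0 : t.nat 0 0 = N) (h4 : t.nat 4 0 = f)
    (h6 : t.nat 6 0 = v) (h5 : t.nat 5 0 = k) :
    (cumWeightBody.run t).real 6 =
      (if k ≤ v then Function.update (t.real 6) k (if v ≤ k then 1 else
        t.real 6 k * (1 + t.real 3 (f * N + k))) else t.real 6) ∧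
    (cumWeightBody.run t).real 7 0 = t.real 7 0 +
      (if k ≤ v then (if v ≤ k then 1 else t.real 6 k * (1 + t.real 3 (f * N + k))) else 0) ∧
    ∀ j, (cumWeightBody.run t).real 8 j =
      if j = v * (N + 1) + (k + 1) then (cumWeightBody.run t).real 7 0 else t.real 8 j := by
  simp only [cumWeightBody, run, Test.Holds, NatExpr.eval, h0, h4, h5, h6, RealExpr.eval]
  by_cases hkv : k ≤ v <;> by_cases hvk : v ≤ k <;>
    simp [hkv, hvk, Mem.setReal, Function.update_apply, h0, h5, h6]

/-- The power `W b ^ (v - b)` is obtained from the one for `v - 1` by one multiplication, starting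
from `1` at `v = b`. -/
theorem run_cumWeightCode (s : Mem) {N f v : ℕ} {W : ℕ → ℝ} (h0 : s.nat 0 0 = N)
    (h4 : s.nat 4 0 = f) (h6 : s.nat 6 0 = v)
    (hW : ∀ b < N, 1 + s.real 3 (f * N + b) = W b)
    (hp : ∀ b < N, b < v → s.real 6 b = W b ^ (v - 1 - b)) :
    (∀ b < N, b ≤ v → (cumWeightCode.run s).real 6 b = W b ^ (v - b)) ∧
    (∀ b ≤ N, (cumWeightCode.run s).real 8 (v * (N + 1) + b) = cumWeight W v b) ∧
    ∀ j < v * (N + 1), (cumWeightCode.run s).real 8 j = s.real 8 j := by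
  set s' := (Code.seq (setRvar 7 (.cast (.lit 0)))
    (.setReal 8 (entry (.add (var 0) (.lit 1)) (var 6) (.lit 0)) (.cast (.lit 0)))).run s with hs'
  have hrun : cumWeightCode.run s = (Code.rep 5 0 cumWeightBody).run s' := by rw [hs']; rfl
  have en : s'.nat = s.nat := rfl
  have e3 : s'.real 3 = s.real 3 := run_real _ _ (by decide)
  have e6 : s'.real 6 = s.real 6 := run_real _ _ (by decide)
  have e7 : s'.real 7 0 = 0 := by simp [hs', run, setReal_real, RealExpr.eval, NatExpr.eval]
  have e8 : ∀ j, s'.real 8 j = if j = v * (N + 1) then 0 else s.real 8 j := by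
    intro j
    simp [hs', run, setReal_real, RealExpr.eval, NatExpr.eval, h0, h6]
  have key := run_rep (x := 5) (a := 0) (P := cumWeightBody) s' (fun k t =>
    (∀ b < N, b ≤ v → t.real 6 b = if b < k then W b ^ (v - b) else s.real 6 b) ∧
    t.real 7 0 = cumWeight W v k ∧
    (∀ b ≤ k, t.real 8 (v * (N + 1) + b) = cumWeight W v b) ∧
    ∀ j < v * (N + 1), t.real 8 j = s.real 8 j) ?_ ?_
  · rw [hrun]
    rw [en, h0] at key
    refine ⟨fun b hb hbv => ?_, key.2.2.1, key.2.2.2⟩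
    rw [key.1 b hb hbv, if_pos hb]
  · refine ⟨fun b _ _ => by simp [e6], by simp [e7, cumWeight], fun b hb => ?_, fun j hj => ?_⟩
    · rw [Nat.le_zero.1 hb]
      simp [e8, cumWeight]
    · simp [e8, hj.ne]
  · rintro k hk t htk hN hR ⟨i1, i2, i3, i4⟩
    rw [en, h0] at hk
    have t0 : t.nat 0 0 = N := by rw [hN 0 (by decide), en, h0]
    have t4 : t.nat 4 0 = f := by rw [hN 4 (by decide), en, h4]
    have t6 : t.nat 6 0 = v := by rw [hN 6 (by decide), en, h6]
    have t3 : t.real 3 = s.real 3 := by rw [hR 3 (by decide), e3]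
    obtain ⟨b1, b2, b3⟩ := run_cumWeightBody t t0 t4 t6 htk
    simp only [setNat_real]
    have hnew : k ≤ v → (if v ≤ k then 1 else t.real 6 k * (1 + t.real 3 (f * N + k))) =
        W k ^ (v - k) := by
      intro hkv
      split_ifs with hvk
      · simp [show v = k by omega]
      · rw [t3, hW k hk, i1 k hk hkv, if_neg (lt_irrefl k), hp k hk (by omega),
          show v - k = v - 1 - k + 1 by omega, pow_succ]
    have hacc : (cumWeightBody.run t).real 7 0 = cumWeight W v (k + 1) := by
      rw [b2, i2, cumWeight, cumWeight, Finset.sum_range_succ, bidWeight]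
      by_cases hkv : k ≤ v
      · rw [if_pos hkv, if_pos hkv, hnew hkv]
      · rw [if_neg hkv, if_neg hkv]
    refine ⟨fun b hb hbv => ?_, hacc, fun b hb => ?_, fun j hj => ?_⟩
    · rw [b1]
      by_cases hkv : k ≤ v
      · rw [if_pos hkv, hnew hkv, Function.update_apply]
        by_cases hbk : b = k
        · simp [hbk]
        · rw [if_neg hbk, i1 b hb hbv]
          by_cases hlt : b < k
          · rw [if_pos hlt, if_pos (by omega)]
          · rw [if_neg hlt, if_neg (by omega)]
      · rw [if_neg hkv, i1 b hb hbv, if_pos (by omega), if_pos (by omega)]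
    · rw [b3, hacc]
      by_cases hbk : b = k + 1
      · simp [hbk]
      · rw [if_neg (by omega), i3 b (by omega)]
    · have : v * (N + 1) ≤ v * (N + 1) + (k + 1) := Nat.le_add_right _ _
      rw [b3, if_neg (by omega), i4 j hj]

/-- The cumulated weights of the bids for all values. -/
def weightTableCode : Code := .rep 6 0 cumWeightCode

theorem run_weightTableCode (s : Mem) {N f : ℕ} {W : ℕ → ℝ} (h0 : s.nat 0 0 = N)
    (h4 : s.nat 4 0 = f) (hW : ∀ b < N, 1 + s.real 3 (f * N + b) = W b) :
    ∀ v < N, ∀ b ≤ N, (weightTableCode.run s).real 8 (v * (N + 1) + b) = cumWeight W v b := by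
  have key := run_rep (x := 6) (a := 0) (P := cumWeightCode) s (fun k t =>
    (∀ b < N, b < k → t.real 6 b = W b ^ (k - 1 - b)) ∧
    ∀ v < k, ∀ b ≤ N, t.real 8 (v * (N + 1) + b) = cumWeight W v b) (by simp) ?_
  · rw [h0] at key
    exact key.2
  · rintro k hk t htk hN hR ⟨i1, i2⟩
    obtain ⟨c1, c2, c3⟩ := run_cumWeightCode t (f := f) (v := k) (W := W)
      (by rw [hN 0 (by decide), h0]) (by rw [hN 4 (by decide), h4]) htk
      (by rw [hR 3 (by decide)]; exact hW) i1
    simp only [setNat_real]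
    refine ⟨fun b hb hbk => by rw [c1 b hb (by omega), Nat.add_sub_cancel], fun v hv b hb => ?_⟩
    rcases Nat.lt_succ_iff_lt_or_eq.1 hv with hv | rfl
    · rw [c3 _ (entry_lt (by omega) hv), i2 v hv b hb]
    · exact c2 b hb

/-- Normalized cumulated weight. -/
abbrev cumProbExpr (b : NatExpr) : RealExpr :=
  .div (.get 8 (entry (.add (var 0) (.lit 1)) (var 6) b))
    (.get 8 (entry (.add (var 0) (.lit 1)) (var 6) (var 0)))

/-- The bid of strategy `nat 9 0` for value `nat 6 0`. -/
abbrev strategyExpr : NatExpr := .get 8 (bidEntry (var 9) (var 6))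

/-- The end points of the interval of quantiles of the strategy `nat 9 0`. -/
def quantileCode : Code :=
  .seq (setRvar 9 (.cast (.lit 0))) (.seq (setRvar 10 (.cast (.lit 1)))
    (.rep 6 0 (.seq
      (.cond (.realLe (rvar 9) (cumProbExpr strategyExpr)) (setRvar 9 (cumProbExpr strategyExpr))
        .skip)
      (.cond (.realLe (cumProbExpr (.add strategyExpr (.lit 1))) (rvar 10))
        (setRvar 10 (cumProbExpr (.add strategyExpr (.lit 1)))) .skip))))

/-- The quantiles of a strategy are an intersection of half-open intervals, so the largest lower end
and the smallest upper end determine them. -/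
theorem run_quantileCode (s : Mem) {N g : ℕ} {W : ℕ → ℝ} (h0 : s.nat 0 0 = N)
    (h1 : s.nat 1 0 = 4 ^ N) (h9 : s.nat 9 0 = g)
    (hF : ∀ v < N, s.nat 8 ((N * 4 ^ N + g) * N + v) = strategy N g v)
    (hE : ∀ v < N, ∀ b ≤ N, s.real 8 (v * (N + 1) + b) = cumWeight W v b) :
    Set.Ico ((quantileCode.run s).real 9 0) ((quantileCode.run s).real 10 0) =
      quantiles W N (strategy N g) := by
  set s' := (Code.seq (setRvar 9 (.cast (.lit 0))) (setRvar 10 (.cast (.lit 1)))).run s with hs'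
  have en : s'.nat = s.nat := rfl
  have e8 : s'.real 8 = s.real 8 := run_real _ _ (by decide)
  have e9 : s'.real 9 0 = 0 := by simp [hs', run, setReal_real, RealExpr.eval, NatExpr.eval]
  have e10 : s'.real 10 0 = 1 := by simp [hs', run, setReal_real, RealExpr.eval, NatExpr.eval]
  have key := run_rep (x := 6) (a := 0) (P := .seq
      (.cond (.realLe (rvar 9) (cumProbExpr strategyExpr)) (setRvar 9 (cumProbExpr strategyExpr))
        .skip)
      (.cond (.realLe (cumProbExpr (.add strategyExpr (.lit 1))) (rvar 10))
        (setRvar 10 (cumProbExpr (.add strategyExpr (.lit 1)))) .skip)) s' (fun k t =>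
    ∀ u, (t.real 9 0 ≤ u ∧ u < t.real 10 0) ↔ (0 ≤ u ∧ u < 1) ∧ ∀ v < k,
      cumProb W N v (strategy N g v) ≤ u ∧ u < cumProb W N v (strategy N g v + 1)) ?_ ?_
  · rw [en, h0] at key
    have hrun : quantileCode.run s = (Code.rep 6 0 (.seq
      (.cond (.realLe (rvar 9) (cumProbExpr strategyExpr)) (setRvar 9 (cumProbExpr strategyExpr))
        .skip)
      (.cond (.realLe (cumProbExpr (.add strategyExpr (.lit 1))) (rvar 10))
        (setRvar 10 (cumProbExpr (.add strategyExpr (.lit 1)))) .skip))).run s' := by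
      rw [hs']; rfl
    rw [hrun]
    ext u
    exact key u
  · simp [e9, e10]
  · intro k hk t htk hN hR hI u
    rw [en, h0] at hk
    have t0 : t.nat 0 0 = N := by rw [hN 0 (by decide), en, h0]
    have t1 : t.nat 1 0 = 4 ^ N := by rw [hN 1 (by decide), en, h1]
    have t9 : t.nat 9 0 = g := by rw [hN 9 (by decide), en, h9]
    have t8 : t.nat 8 ((N * 4 ^ N + g) * N + k) = strategy N g k := by
      rw [hN 8 (by decide), en, hF k hk]
    have hlt : strategy N g k < N := (strategy_le g k).trans_lt hk
    have r8 : ∀ b ≤ N, t.real 8 (k * (N + 1) + b) = cumWeight W k b := by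
      rw [hR 8 (by decide), e8]
      exact hE k hk
    have hsplit : ((0 ≤ u ∧ u < 1) ∧ ∀ v < k + 1,
        cumProb W N v (strategy N g v) ≤ u ∧ u < cumProb W N v (strategy N g v + 1)) ↔
        (t.real 9 0 ≤ u ∧ u < t.real 10 0) ∧
        (cumProb W N k (strategy N g k) ≤ u ∧ u < cumProb W N k (strategy N g k + 1)) := by
      rw [hI u]
      constructor
      · rintro ⟨h, h'⟩
        exact ⟨⟨h, fun v hv => h' v (by omega)⟩, h' k (by omega)⟩
      · rintro ⟨⟨h, h'⟩, h''⟩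
        refine ⟨h, fun v hv => ?_⟩
        rcases Nat.lt_succ_iff_lt_or_eq.1 hv with hv | rfl
        · exact h' v hv
        · exact h''
    rw [hsplit]
    have q1 : cumWeight W k (strategy N g k) / cumWeight W k N =
      cumProb W N k (strategy N g k) := rfl
    have q2 : cumWeight W k (strategy N g k + 1) / cumWeight W k N =
      cumProb W N k (strategy N g k + 1) := rfl
    have hlo : ((Code.cond (.realLe (rvar 9) (cumProbExpr strategyExpr))
        (setRvar 9 (cumProbExpr strategyExpr)) .skip).run t).real 9 0 =
        max (t.real 9 0) (cumProb W N k (strategy N g k)) := by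
      simp only [run, Test.Holds, RealExpr.eval, NatExpr.eval, t0, t1, t9, htk, t8,
        r8 _ hlt.le, r8 N le_rfl, q1]
      split_ifs with h
      · simp [setReal_real, h]
      · rw [max_eq_left (not_le.1 h).le]
    set t' := (Code.cond (.realLe (rvar 9) (cumProbExpr strategyExpr))
        (setRvar 9 (cumProbExpr strategyExpr)) .skip).run t with ht'
    have en' : t'.nat = t.nat := by funext a; exact run_nat _ _ (by simp [natWrites])
    have r8' : t'.real 8 = t.real 8 := run_real _ _ (by decide)
    have r10' : t'.real 10 = t.real 10 := run_real _ _ (by decide)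
    have hhi : ((Code.cond (.realLe (cumProbExpr (.add strategyExpr (.lit 1))) (rvar 10))
        (setRvar 10 (cumProbExpr (.add strategyExpr (.lit 1)))) .skip).run t').real 10 0 =
        min (t.real 10 0) (cumProb W N k (strategy N g k + 1)) := by
      simp only [run, Test.Holds, RealExpr.eval, NatExpr.eval, en', t0, t1, t9, htk, t8, r8', r10',
        r8 _ (show strategy N g k + 1 ≤ N from hlt), r8 N le_rfl, q2]
      split_ifs with h
      · simp [setReal_real, h]
      · rw [min_eq_left (not_le.1 h).le, r10']
    have h9' : ((Code.cond (.realLe (cumProbExpr (.add strategyExpr (.lit 1))) (rvar 10))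
        (setRvar 10 (cumProbExpr (.add strategyExpr (.lit 1)))) .skip).run t').real 9 = t'.real 9 :=
      run_real _ _ (by decide)
    rw [setNat_real, Code.run, ← ht', hhi, h9', hlo, max_le_iff, lt_min_iff]
    tauto

/-- Computes the transition probabilities from strategy `nat 4 0` to all strategies. -/
def transitionRowCode : Code :=
  .rep 9 2 (.seq quantileCode
    (.cond (.realLe (rvar 9) (rvar 10))
      (.setReal 11 (entry (var 2) (var 4) (var 9)) (.sub (rvar 10) (rvar 9)))
      (.setReal 11 (entry (var 2) (var 4) (var 9)) (.cast (.lit 0)))))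

theorem run_transitionRowCode (s : Mem) {N f : ℕ} {W : ℕ → ℝ} (h0 : s.nat 0 0 = N)
    (h1 : s.nat 1 0 = 4 ^ N) (h2 : s.nat 2 0 = numStrategies N) (h4 : s.nat 4 0 = f)
    (hF : ∀ k < numStrategies N, ∀ v < N, s.nat 8 ((N * 4 ^ N + k) * N + v) = strategy N k v)
    (hE : ∀ v < N, ∀ b ≤ N, s.real 8 (v * (N + 1) + b) = cumWeight W v b) :
    (∀ g < numStrategies N,
      (transitionRowCode.run s).real 11 (f * numStrategies N + g) = coupling W N g) ∧
    ∀ j < f * numStrategies N, (transitionRowCode.run s).real 11 j = s.real 11 j := by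
  have key := run_rep (x := 9) (a := 2) (P := .seq quantileCode
    (.cond (.realLe (rvar 9) (rvar 10))
      (.setReal 11 (entry (var 2) (var 4) (var 9)) (.sub (rvar 10) (rvar 9)))
      (.setReal 11 (entry (var 2) (var 4) (var 9)) (.cast (.lit 0))))) s (fun k t =>
    (∀ g < k, t.real 11 (f * numStrategies N + g) = coupling W N g) ∧
    ∀ j < f * numStrategies N, t.real 11 j = s.real 11 j) (by simp) ?_
  · rwa [h2] at key
  · rintro k hk t htk hN hR ⟨i1, i2⟩
    rw [h2] at hk
    have hq := run_quantileCode t (N := N) (g := k) (W := W) (by rw [hN 0 (by decide), h0])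
      (by rw [hN 1 (by decide), h1]) htk (by rw [hN 8 (by decide)]; exact hF k hk)
      (by rw [hR 8 (by decide)]; exact hE)
    -- An empty intersection appears as end points in the wrong order; truncation at `0` gives its
    -- measure.
    have hc : coupling W N k = max ((quantileCode.run t).real 10 0 - (quantileCode.run t).real 9 0)
        0 := by
      rw [coupling, ← hq, Real.volume_real_Ico]
    have q2 : (quantileCode.run t).nat 2 0 = numStrategies N := by
      rw [run_nat _ _ (by decide), hN 2 (by decide), h2]
    have q4 : (quantileCode.run t).nat 4 0 = f := by
      rw [run_nat _ _ (by decide), hN 4 (by decide), h4]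
    have q9 : (quantileCode.run t).nat 9 0 = k := by
      rw [run_nat _ _ (by decide), htk]
    have q11 : (quantileCode.run t).real 11 = t.real 11 := run_real _ _ (by decide)
    have hfin : ∀ j, ((Code.seq quantileCode
        (.cond (.realLe (rvar 9) (rvar 10))
          (.setReal 11 (entry (var 2) (var 4) (var 9)) (.sub (rvar 10) (rvar 9)))
          (.setReal 11 (entry (var 2) (var 4) (var 9)) (.cast (.lit 0))))).run t).real 11 j =
        if j = f * numStrategies N + k then coupling W N k else t.real 11 j := by
      intro j
      rw [hc]
      simp only [run, Test.Holds, RealExpr.eval, NatExpr.eval, q2, q4, q9]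
      split_ifs with hle hj hj <;> simp only [setReal_real, hj, q11, and_true, and_false, if_true,
        if_false]
      · rw [max_eq_left (sub_nonneg.2 hle)]
      · rw [max_eq_right (sub_nonpos.2 (not_le.1 hle).le)]; simp
    rw [setNat_real]
    refine ⟨fun g hg => ?_, fun j hj => ?_⟩
    · rw [hfin]
      by_cases hgk : g = k
      · simp [hgk]
      · rw [if_neg (by omega), i1 g (by omega)]
    · rw [hfin, if_neg (by omega), i2 j hj]

/-- Computes the matrix of transition probabilities. -/
def transitionCode : Code := .rep 4 2 (.seq weightTableCode transitionRowCode)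

theorem run_transitionCode (s : Mem) {N : ℕ} {W : ℕ → ℕ → ℝ} (h0 : s.nat 0 0 = N)
    (h1 : s.nat 1 0 = 4 ^ N) (h2 : s.nat 2 0 = numStrategies N)
    (hF : ∀ k < numStrategies N, ∀ v < N, s.nat 8 ((N * 4 ^ N + k) * N + v) = strategy N k v)
    (hW : ∀ f < numStrategies N, ∀ b < N, 1 + s.real 3 (f * N + b) = W f b) :
    ∀ f < numStrategies N, ∀ g < numStrategies N,
      (transitionCode.run s).real 11 (f * numStrategies N + g) = coupling (W f) N g := by
  have key := run_rep (x := 4) (a := 2) (P := .seq weightTableCode transitionRowCode) s (fun k t =>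
    ∀ f < k, ∀ g < numStrategies N,
      t.real 11 (f * numStrategies N + g) = coupling (W f) N g) (by simp) ?_
  · rwa [h2] at key
  · intro k hk t htk hN hR hI
    rw [h2] at hk
    have hw := run_weightTableCode t (N := N) (f := k) (W := W k) (by rw [hN 0 (by decide), h0]) htk
      (by rw [hR 3 (by decide)]; exact hW k hk)
    obtain ⟨r1, r2⟩ := run_transitionRowCode (weightTableCode.run t) (N := N) (f := k) (W := W k)
      (by rw [run_nat _ _ (by decide), hN 0 (by decide), h0])
      (by rw [run_nat _ _ (by decide), hN 1 (by decide), h1])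
      (by rw [run_nat _ _ (by decide), hN 2 (by decide), h2])
      (by rw [run_nat _ _ (by decide), htk])
      (by rw [run_nat _ _ (by decide), hN 8 (by decide)]; exact hF) hw
    intro f hf g hg
    rw [setNat_real, Code.run]
    rcases Nat.lt_succ_iff_lt_or_eq.1 hf with hf | rfl
    · rw [r2 _ (entry_lt hg hf), run_real _ _ (by decide), hI f hf g hg]
    · exact r1 g hg

end FirstPriceAuction

/-- The matrix in memory is specified only for indices below `m`, and no others matter. -/
theorem StateReduction.Reduced.congr {m k : ℕ} {P P' Q : ℕ → ℕ → ℝ}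
    (h : StateReduction.Reduced m Q k P) (hk : k ≤ m)
    (hP : ∀ i < m, ∀ j < m, P' i j = P i j) : StateReduction.Reduced m Q k P' := by
  refine ⟨fun μ hμ hcoef => h.balanced μ (fun j hj => ?_) fun n h1 h2 h3 => ?_,
    fun i hi j hj => by rw [hP i hi j hj]; exact h.nonneg i hi j hj,
    fun i hi => by rw [hP i hi 0 (by omega)]; exact h.pos i hi⟩
  · have := hμ j hj
    rw [Finset.sum_congr rfl fun i hi => by
        rw [hP i (by simp at hi; omega) j (by omega)],
      Finset.sum_congr rfl fun i hi => hP j (by omega) i (by simp at hi; omega)] at this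
    exact this
  · rw [hcoef n h1 h2 h3]
    exact Finset.sum_congr rfl fun i hi => by rw [hP i (by simp at hi; omega) n h3]

namespace FirstPriceAuction

open RealRAM RealRAM.Code

/-! ## The program: stationary distribution -/

/-- The test `x < y`. -/
abbrev ltTest (x y : NatExpr) : Test := .natLe (.add x (.lit 1)) y

/-- Elimination of state `nat 7 0` from row `nat 4 0` of the matrix. -/
def eliminateRowCode : Code :=
  .seq (.setReal 11 (entry (var 2) (var 4) (var 7))
      (.div (.get 11 (entry (var 2) (var 4) (var 7))) (rvar 7)))
    (.rep 5 2 (.cond (ltTest (var 5) (var 7))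
      (.setReal 11 (entry (var 2) (var 4) (var 5))
        (.add (.get 11 (entry (var 2) (var 4) (var 5)))
          (.mul (.get 11 (entry (var 2) (var 4) (var 7)))
            (.get 11 (entry (var 2) (var 7) (var 5)))))) .skip))

/-- In-place update: column `n` is divided by the pivot first, and then serves as the multiplier for
the columns below `n`. Row `n` is only read, since `i < n`. -/
theorem run_eliminateRowCode (s : Mem) {m n i : ℕ} {P : ℕ → ℕ → ℝ} {x : ℝ} (h2 : s.nat 2 0 = m)
    (h4 : s.nat 4 0 = i) (h7 : s.nat 7 0 = n) (hx : s.real 7 0 = x) (hin : i < n) (hnm : n < m)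
    (hP : ∀ k, ∀ j < m, s.real 11 (k * m + j) = P k j) :
    ∀ k, ∀ j < m, (eliminateRowCode.run s).real 11 (k * m + j) =
      if k = i then (if j < n then P i j + P i n / x * P n j else if j = n then P i n / x
        else P i j) else P k j := by
  set s' := (Code.setReal 11 (entry (var 2) (var 4) (var 7))
      (.div (.get 11 (entry (var 2) (var 4) (var 7))) (rvar 7))).run s with hs'
  have en : s'.nat = s.nat := rfl
  have e11 : ∀ k, ∀ j < m, s'.real 11 (k * m + j) =
      if k = i ∧ j = n then P i n / x else P k j := by
    intro k j hj
    simp only [hs', run, setReal_real, RealExpr.eval, NatExpr.eval, h2, h4, h7, hx, hP i n hnm,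
      hP k j hj, true_and, entry_inj hj hnm]
  have key := run_rep (x := 5) (a := 2) (P := .cond (ltTest (var 5) (var 7))
      (.setReal 11 (entry (var 2) (var 4) (var 5))
        (.add (.get 11 (entry (var 2) (var 4) (var 5)))
          (.mul (.get 11 (entry (var 2) (var 4) (var 7)))
            (.get 11 (entry (var 2) (var 7) (var 5)))))) .skip) s' (fun l t =>
      ∀ k, ∀ j < m, t.real 11 (k * m + j) =
        if k = i then (if j < n ∧ j < l then P i j + P i n / x * P n j else if j = n then P i n / x
          else P i j) else P k j) ?_ ?_
  · rw [en, h2] at key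
    have hrun : eliminateRowCode.run s = (Code.rep 5 2 (.cond (ltTest (var 5) (var 7))
      (.setReal 11 (entry (var 2) (var 4) (var 5))
        (.add (.get 11 (entry (var 2) (var 4) (var 5)))
          (.mul (.get 11 (entry (var 2) (var 4) (var 7)))
            (.get 11 (entry (var 2) (var 7) (var 5)))))) .skip)).run s' := by rw [hs']; rfl
    rw [hrun]
    intro k j hj
    simpa only [hj, and_true] using key k j hj
  · intro k j hj
    rw [setNat_real, e11 k j hj]
    by_cases hk : k = i <;> by_cases hjn : j = n <;> simp [hk, hjn]
  · intro l hl t htl hN hR hI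
    rw [en, h2] at hl
    have t2 : t.nat 2 0 = m := by rw [hN 2 (by decide), en, h2]
    have t4 : t.nat 4 0 = i := by rw [hN 4 (by decide), en, h4]
    have t7 : t.nat 7 0 = n := by rw [hN 7 (by decide), en, h7]
    intro k j hj
    simp only [run, Test.Holds, RealExpr.eval, NatExpr.eval, t2, t4, t7, htl, setNat_real]
    by_cases hln : l + 1 ≤ n
    · have v1 := hI i l hl
      have v2 := hI i n hnm
      have v3 := hI n l hl
      simp only [if_true, lt_irrefl, and_false, if_false, show l ≠ n by omega] at v1 v2
      rw [if_neg (by omega)] at v3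
      simp only [if_pos hln, setReal_real, true_and, entry_inj hj hl, v1, v2, v3, hI k j hj]
      by_cases hk : k = i
      · by_cases hjl : j = l
        · simp [hk, hjl, show l < n by omega]
        · simp only [hk, hjl, and_false, if_false, if_true]
          by_cases hjn : j < n
          · by_cases hjl' : j < l
            · simp [hjn, hjl', show j < l + 1 by omega]
            · simp [hjl', show ¬ j < l + 1 by omega]
          · simp [hjn]
      · simp [hk]
    · rw [if_neg hln, hI k j hj]
      by_cases hjn : j < n
      · simp [hjn, show j < l by omega, show j < l + 1 by omega]
      · simp [hjn]

/-- Elimination of the last state. -/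
def eliminateCode : Code :=
  .seq (setVar 7 (.sub (.sub (var 2) (.lit 1)) (var 3))) (.seq (setRvar 7 (.cast (.lit 0)))
    (.seq (sumCode 5 2 7 (ltTest (var 5) (var 7)) (.get 11 (entry (var 2) (var 7) (var 5))))
      (.rep 4 2 (.cond (ltTest (var 4) (var 7)) eliminateRowCode .skip))))

theorem sum_range_ite_lt {m n : ℕ} (hn : n ≤ m) (f : ℕ → ℝ) :
    ∑ k ∈ Finset.range m, (if k < n then f k else 0) = ∑ k ∈ Finset.range n, f k := by
  rw [← Finset.sum_filter]
  congr 1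
  ext k
  simp only [Finset.mem_filter, Finset.mem_range]
  omega

theorem run_eliminateCode (s : Mem) {m n : ℕ} {P : ℕ → ℕ → ℝ} (h2 : s.nat 2 0 = m) (hnm : n < m)
    (h3 : s.nat 3 0 = m - 1 - n) (hP : ∀ k, ∀ j < m, s.real 11 (k * m + j) = P k j) :
    ∀ i < m, ∀ j < m, (eliminateCode.run s).real 11 (i * m + j) =
      StateReduction.eliminate P n i j := by
  set s' := (Code.seq (setVar 7 (.sub (.sub (var 2) (.lit 1)) (var 3)))
    (setRvar 7 (.cast (.lit 0)))).run s with hs'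
  have e2 : s'.nat 2 0 = m := by rw [hs', run_nat _ _ (by decide), h2]
  have e7 : s'.nat 7 0 = n := by
    simp only [hs', run, setReal_nat, setNat_nat, NatExpr.eval, h2, h3]
    simp only [true_and, if_true]
    omega
  have er7 : s'.real 7 0 = 0 := by simp [hs', run, setReal_real, RealExpr.eval, NatExpr.eval]
  have er11 : s'.real 11 = s.real 11 := run_real _ _ (by decide)
  have hsum := run_sumCode (x := 5) (a := 2) (c := 7) (b := ltTest (var 5) (var 7))
    (e := .get 11 (entry (var 2) (var 7) (var 5))) s' (fun j => if j < n then P n j else 0)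
    (fun k hk t htk hN hR => by
      rw [e2] at hk
      simp only [Test.Holds, RealExpr.eval, NatExpr.eval, htk, hN 7 (by norm_num), e7,
        hN 2 (by norm_num), e2, hR 11 (by norm_num), er11, hP n k hk]
      rfl)
  rw [e2, er7, zero_add, sum_range_ite_lt hnm.le] at hsum
  set s₂ := (sumCode 5 2 7 (ltTest (var 5) (var 7))
    (.get 11 (entry (var 2) (var 7) (var 5)))).run s' with hs₂
  have f2 : s₂.nat 2 0 = m := by rw [hs₂, run_nat _ _ (by decide), e2]
  have f7 : s₂.nat 7 0 = n := by rw [hs₂, run_nat _ _ (by decide), e7]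
  have f11 : s₂.real 11 = s.real 11 := by rw [hs₂, run_real _ _ (by decide), er11]
  have hrun : eliminateCode.run s =
      (Code.rep 4 2 (.cond (ltTest (var 4) (var 7)) eliminateRowCode .skip)).run s₂ := by
    rw [hs₂, hs']; rfl
  have key := run_rep (x := 4) (a := 2)
    (P := .cond (ltTest (var 4) (var 7)) eliminateRowCode .skip) s₂ (fun l t =>
      t.real 7 0 = ∑ k ∈ Finset.range n, P n k ∧
      ∀ i, ∀ j < m, t.real 11 (i * m + j) =
        if i < l then StateReduction.eliminate P n i j else P i j) ?_ ?_
  · rw [f2, ← hrun] at key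
    intro i hi j hj
    rw [key.2 i j hj, if_pos hi]
  · exact ⟨hsum, fun i j hj => by simp [f11, hP i j hj]⟩
  · rintro l hl t htl hN hR ⟨hx, hI⟩
    rw [f2] at hl
    have t2 : t.nat 2 0 = m := by rw [hN 2 (by decide), f2]
    have t7 : t.nat 7 0 = n := by rw [hN 7 (by decide), f7]
    simp only [run, Test.Holds, NatExpr.eval, t7, htl, setNat_real]
    by_cases hln : l + 1 ≤ n
    · rw [if_pos hln]
      have hrow := run_eliminateRowCode t t2 htl t7 hx hln hnm (P := fun i j =>
        if i < l then StateReduction.eliminate P n i j else P i j) hI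
      refine ⟨by rw [run_real _ _ (by decide), hx], fun i j hj => ?_⟩
      rw [hrow i j hj]
      simp only [lt_irrefl, if_false, show ¬ n < l by omega]
      by_cases hil : i = l
      · subst hil
        simp [StateReduction.eliminate, show i < n by omega]
      · by_cases hlt : i < l
        · simp [hil, hlt, show i < l + 1 by omega]
        · simp [hil, hlt, show ¬ i < l + 1 by omega]
    · rw [if_neg hln]
      refine ⟨hx, fun i j hj => ?_⟩
      rw [hI i j hj]
      by_cases hil : i = l
      · subst hil
        simp [StateReduction.eliminate, show ¬ i < n by omega]
      · by_cases hlt : i < l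
        · simp [hlt, show i < l + 1 by omega]
        · simp [hlt, show ¬ i < l + 1 by omega]

/-- Elimination of all states. -/
def reductionCode : Code := .rep 3 2 eliminateCode

theorem run_reductionCode (s : Mem) {m : ℕ} {Q : ℕ → ℕ → ℝ} (h2 : s.nat 2 0 = m)
    (hQ : ∀ i < m, ∀ j < m, s.real 11 (i * m + j) = Q i j)
    (h0 : ∀ i < m, ∀ j < m, 0 ≤ Q i j) (h0' : ∀ i < m, 0 < Q i 0) :
    StateReduction.Reduced m Q 0 fun i j => (reductionCode.run s).real 11 (i * m + j) := by
  have key := run_rep (x := 3) (a := 2) (P := eliminateCode) s (fun k t =>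
    StateReduction.Reduced m Q (m - k) fun i j => t.real 11 (i * m + j)) ?_ ?_
  · rw [h2, Nat.sub_self] at key
    exact key
  · exact (StateReduction.Reduced.refl h0 h0').congr (by omega) (by simpa using hQ)
  · intro k hk t htk hN hR hI
    rw [h2] at hk
    have := run_eliminateCode t (m := m) (n := m - 1 - k) (P := fun i j => t.real 11 (i * m + j))
      (by rw [hN 2 (by decide), h2]) (by omega) (by omega) fun _ _ _ => rfl
    rw [show m - k = m - 1 - k + 1 by omega] at hI
    rw [show m - (k + 1) = m - 1 - k by omega, setNat_real]
    exact (hI.eliminate (by omega)).congr (by omega) this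

/-- Solution of the balance equations, with weight `1` for state `0`. -/
def solveCode : Code :=
  .rep 3 2 (.cond (.natLe (.lit 1) (var 3))
    (.seq (setRvar 7 (.cast (.lit 0)))
      (.seq (sumCode 4 2 7 (ltTest (var 4) (var 3))
          (.mul (.get 4 (var 4)) (.get 11 (entry (var 2) (var 4) (var 3)))))
        (.setReal 4 (var 3) (rvar 7))))
    (.setReal 4 (var 3) (.cast (.lit 1))))

/-- Forward substitution: column `n` expresses the weight of state `n` through lower states only. -/
theorem run_solveCode (s : Mem) {m : ℕ} {P : ℕ → ℕ → ℝ} (hm : 0 < m) (h2 : s.nat 2 0 = m)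
    (hP : ∀ i < m, ∀ j < m, s.real 11 (i * m + j) = P i j) :
    (solveCode.run s).real 4 0 = 1 ∧ ∀ n, 1 ≤ n → n < m →
      (solveCode.run s).real 4 n = ∑ i ∈ Finset.range n, (solveCode.run s).real 4 i * P i n := by
  have key := run_rep (x := 3) (a := 2) (P := .cond (.natLe (.lit 1) (var 3))
    (.seq (setRvar 7 (.cast (.lit 0)))
      (.seq (sumCode 4 2 7 (ltTest (var 4) (var 3))
          (.mul (.get 4 (var 4)) (.get 11 (entry (var 2) (var 4) (var 3)))))
        (.setReal 4 (var 3) (rvar 7))))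
    (.setReal 4 (var 3) (.cast (.lit 1)))) s (fun k t => (0 < k → t.real 4 0 = 1) ∧
      ∀ n, 1 ≤ n → n < k → t.real 4 n = ∑ i ∈ Finset.range n, t.real 4 i * P i n)
      (by simp) ?_
  · rw [h2] at key
    exact ⟨key.1 hm, key.2⟩
  · rintro k hk t htk hN hR ⟨i1, i2⟩
    rw [h2] at hk
    have t2 : t.nat 2 0 = m := by rw [hN 2 (by decide), h2]
    have t11 : t.real 11 = s.real 11 := hR 11 (by decide)
    rw [setNat_real]
    by_cases hk1 : 1 ≤ k
    · set t' := (setRvar 7 (.cast (.lit 0))).run t with ht'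
      have e7 : t'.real 7 0 = 0 := by simp [ht', run, setReal_real, RealExpr.eval, NatExpr.eval]
      have e2 : t'.nat 2 0 = m := t2
      have e3 : t'.nat 3 0 = k := htk
      have e4 : t'.real 4 = t.real 4 := run_real _ _ (by decide)
      have e11 : t'.real 11 = s.real 11 := by rw [ht', run_real _ _ (by decide), t11]
      have hsum := run_sumCode (x := 4) (a := 2) (c := 7) (b := ltTest (var 4) (var 3))
        (e := .mul (.get 4 (var 4)) (.get 11 (entry (var 2) (var 4) (var 3)))) t'
        (fun i => if i < k then t.real 4 i * P i k else 0) (fun i hi u hui hN' hR' => by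
          rw [e2] at hi
          simp only [Test.Holds, RealExpr.eval, NatExpr.eval, hui, hN' 3 (by norm_num), e3,
            hN' 2 (by norm_num), e2, hR' 11 (by norm_num), e11, hR' 4 (by norm_num), e4,
            hP i hi k hk]
          rfl)
      rw [e2, e7, zero_add, sum_range_ite_lt hk.le] at hsum
      set u := (sumCode 4 2 7 (ltTest (var 4) (var 3))
        (.mul (.get 4 (var 4)) (.get 11 (entry (var 2) (var 4) (var 3))))).run t' with hu
      have u4 : u.real 4 = t.real 4 := by rw [hu, run_real _ _ (by decide), e4]
      have u3 : u.nat 3 0 = k := by rw [hu, run_nat _ _ (by decide), e3]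
      have hfin : (Code.run (.cond (.natLe (.lit 1) (var 3))
          (.seq (setRvar 7 (.cast (.lit 0)))
            (.seq (sumCode 4 2 7 (ltTest (var 4) (var 3))
                (.mul (.get 4 (var 4)) (.get 11 (entry (var 2) (var 4) (var 3)))))
              (.setReal 4 (var 3) (rvar 7))))
          (.setReal 4 (var 3) (.cast (.lit 1)))) t).real 4 =
          Function.update (t.real 4) k (u.real 7 0) := by
        rw [Code.run, if_pos (by simpa [Test.Holds, NatExpr.eval, htk] using hk1)]
        simp only [Code.run] at hu ht' ⊢
        rw [← ht', ← hu]
        simp [Mem.setReal, NatExpr.eval, RealExpr.eval, u3, u4]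
      rw [hfin, hsum]
      refine ⟨fun _ => ?_, fun n hn hnk => ?_⟩
      · rw [Function.update_of_ne (by omega)]
        exact i1 (by omega)
      · have hs : ∑ i ∈ Finset.range n, Function.update (t.real 4) k
            (∑ k_1 ∈ Finset.range k, t.real 4 k_1 * P k_1 k) i * P i n =
            ∑ i ∈ Finset.range n, t.real 4 i * P i n := by
          refine Finset.sum_congr rfl fun i hi => ?_
          rw [Function.update_of_ne (by simp at hi; omega)]
        rw [hs]
        by_cases hnk' : n = k
        · subst hnk'
          simp
        · rw [Function.update_of_ne hnk', i2 n hn (by omega)]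
    · have hk0 : k = 0 := by omega
      subst hk0
      refine ⟨fun _ => ?_, fun n hn hn' => by omega⟩
      simp [Code.run, Test.Holds, NatExpr.eval, htk, setReal_real, RealExpr.eval]

/-- Normalization of the solution of the balance equations. -/
def normalizeCode : Code :=
  .seq (setRvar 7 (.cast (.lit 0)))
    (.seq (sumCode 4 2 7 (.natLe (.lit 0) (.lit 0)) (.get 4 (var 4)))
      (.rep 4 2 (.setReal 4 (var 4) (.div (.get 4 (var 4)) (rvar 7)))))

theorem run_normalizeCode (s : Mem) {m : ℕ} (h2 : s.nat 2 0 = m) :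
    ∀ f < m, (normalizeCode.run s).real 4 f =
      s.real 4 f / ∑ k ∈ Finset.range m, s.real 4 k := by
  set s' := (setRvar 7 (.cast (.lit 0))).run s with hs'
  have e7 : s'.real 7 0 = 0 := by simp [hs', run, setReal_real, RealExpr.eval, NatExpr.eval]
  have e4 : s'.real 4 = s.real 4 := run_real _ _ (by decide)
  have e2 : s'.nat 2 0 = m := h2
  have hsum := run_sumCode (x := 4) (a := 2) (c := 7) (b := .natLe (.lit 0) (.lit 0))
    (e := .get 4 (var 4)) s' (fun i => s.real 4 i) (fun i hi u hui hN' hR' => by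
      simp [Test.Holds, RealExpr.eval, NatExpr.eval, hui, hR' 4 (by norm_num), e4])
  rw [e2, e7, zero_add] at hsum
  set u := (sumCode 4 2 7 (.natLe (.lit 0) (.lit 0)) (.get 4 (var 4))).run s' with hu
  have u4 : u.real 4 = s.real 4 := by rw [hu, run_real _ _ (by decide), e4]
  have u2 : u.nat 2 0 = m := by rw [hu, run_nat _ _ (by decide), e2]
  have key := run_rep (x := 4) (a := 2)
    (P := .setReal 4 (var 4) (.div (.get 4 (var 4)) (rvar 7))) u (fun k t =>
      t.real 7 0 = ∑ k ∈ Finset.range m, s.real 4 k ∧ ∀ f, t.real 4 f =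
        if f < k then s.real 4 f / ∑ k ∈ Finset.range m, s.real 4 k else s.real 4 f) ?_ ?_
  · have hrun : normalizeCode.run s =
        (Code.rep 4 2 (.setReal 4 (var 4) (.div (.get 4 (var 4)) (rvar 7)))).run u := by
      rw [hu, hs']; rfl
    rw [hrun]
    rw [u2] at key
    intro f hf
    rw [key.2 f, if_pos hf]
  · exact ⟨hsum, by simp [u4]⟩
  · rintro k hk t htk hN hR ⟨i1, i2⟩
    simp only [run, setNat_real, setReal_real, NatExpr.eval, RealExpr.eval, htk, i1]
    refine ⟨by simp, fun f => ?_⟩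
    by_cases hfk : f = k
    · subst hfk
      simp [i2]
    · simp only [hfk, and_false, if_false, i2]
      by_cases hlt : f < k
      · simp [hlt, show f < k + 1 by omega]
      · simp [hlt, show ¬ f < k + 1 by omega]

/-! ## The program: output -/

/-- Computes the probability of bid `nat 5 0` for value `nat 6 0`. -/
def outputEntryCode : Code :=
  .seq (setRvar 7 (.cast (.lit 0)))
    (.seq (sumCode 4 2 7 (.and (.natLe (.get 8 (bidEntry (var 4) (var 6))) (var 5))
        (.natLe (var 5) (.get 8 (bidEntry (var 4) (var 6))))) (.get 4 (var 4)))
      (.setReal 2 (entry (var 0) (var 6) (var 5)) (rvar 7)))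

theorem run_outputEntryCode (s : Mem) {N v b : ℕ} (h0 : s.nat 0 0 = N) (h1 : s.nat 1 0 = 4 ^ N)
    (h2 : s.nat 2 0 = numStrategies N) (h5 : s.nat 5 0 = b) (h6 : s.nat 6 0 = v) (hv : v < N)
    (hF : ∀ k < numStrategies N, ∀ v < N, s.nat 8 ((N * 4 ^ N + k) * N + v) = strategy N k v)
    (j : ℕ) : (outputEntryCode.run s).real 2 j = if j = v * N + b then
      ∑ k ∈ Finset.range (numStrategies N), (if strategy N k v = b then s.real 4 k else 0)
      else s.real 2 j := by
  set s' := (setRvar 7 (.cast (.lit 0))).run s with hs'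
  have e7 : s'.real 7 0 = 0 := by simp [hs', run, setReal_real, RealExpr.eval, NatExpr.eval]
  have e4 : s'.real 4 = s.real 4 := run_real _ _ (by decide)
  have e2 : s'.real 2 = s.real 2 := run_real _ _ (by decide)
  have en : s'.nat = s.nat := rfl
  have hsum := run_sumCode (x := 4) (a := 2) (c := 7)
    (b := .and (.natLe (.get 8 (bidEntry (var 4) (var 6))) (var 5))
        (.natLe (var 5) (.get 8 (bidEntry (var 4) (var 6)))))
    (e := .get 4 (var 4)) s' (fun k => if strategy N k v = b then s.real 4 k else 0)
    (fun k hk u huk hN' hR' => by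
      rw [en, h2] at hk
      simp only [Test.Holds, RealExpr.eval, NatExpr.eval, huk, hR' 4 (by norm_num), e4,
        hN' 0 (by norm_num), hN' 1 (by norm_num), hN' 8 (by norm_num), hN' 5 (by norm_num),
        hN' 6 (by norm_num), en, h0, h1, h5, h6, hF k hk v hv, ← le_antisymm_iff])
  rw [en, h2, e7, zero_add] at hsum
  set u := (sumCode 4 2 7 (.and (.natLe (.get 8 (bidEntry (var 4) (var 6))) (var 5))
        (.natLe (var 5) (.get 8 (bidEntry (var 4) (var 6))))) (.get 4 (var 4))).run s' with hu
  have hrun : outputEntryCode.run s =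
      (Code.setReal 2 (entry (var 0) (var 6) (var 5)) (rvar 7)).run u := by
    rw [hu, hs']; rfl
  have u0 : u.nat 0 0 = N := by rw [hu, run_nat _ _ (by decide), en, h0]
  have u5 : u.nat 5 0 = b := by rw [hu, run_nat _ _ (by decide), en, h5]
  have u6 : u.nat 6 0 = v := by rw [hu, run_nat _ _ (by decide), en, h6]
  have u2 : u.real 2 = s.real 2 := by rw [hu, run_real _ _ (by decide), e2]
  rw [hrun]
  simp only [run, setReal_real, NatExpr.eval, RealExpr.eval, u0, u5, u6, true_and, hsum, u2]

/-- Computes the output. -/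
def outputCode : Code := .rep 6 0 (.rep 5 0 outputEntryCode)

theorem run_outputCode (s : Mem) {N : ℕ} (h0 : s.nat 0 0 = N) (h1 : s.nat 1 0 = 4 ^ N)
    (h2 : s.nat 2 0 = numStrategies N)
    (hF : ∀ k < numStrategies N, ∀ v < N, s.nat 8 ((N * 4 ^ N + k) * N + v) = strategy N k v) :
    ∀ v < N, ∀ b < N, (outputCode.run s).real 2 (v * N + b) =
      ∑ k ∈ Finset.range (numStrategies N), (if strategy N k v = b then s.real 4 k else 0) := by
  have key := run_rep (x := 6) (a := 0) (P := .rep 5 0 outputEntryCode) s (fun k t =>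
    ∀ v < k, ∀ b < N, t.real 2 (v * N + b) =
      ∑ k ∈ Finset.range (numStrategies N), (if strategy N k v = b then s.real 4 k else 0))
    (by simp) ?_
  · rwa [h0] at key
  · intro k hk t htk hN hR hI
    rw [h0] at hk
    have t0 : t.nat 0 0 = N := by rw [hN 0 (by decide), h0]
    have t4 : t.real 4 = s.real 4 := hR 4 (by decide)
    have key' := run_rep (x := 5) (a := 0) (P := outputEntryCode) t (fun l u =>
      (∀ b < l, u.real 2 (k * N + b) =
        ∑ f ∈ Finset.range (numStrategies N), (if strategy N f k = b then s.real 4 f else 0)) ∧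
      ∀ j < k * N, u.real 2 j = t.real 2 j) (by simp) ?_
    · rw [t0] at key'
      intro v hv b hb
      rw [setNat_real]
      rcases Nat.lt_succ_iff_lt_or_eq.1 hv with hv | rfl
      · rw [key'.2 _ (entry_lt hb hv), hI v hv b hb]
      · exact key'.1 b hb
    · rintro l hl u hul hN' hR' ⟨j1, j2⟩
      have hent := run_outputEntryCode u (N := N) (v := k) (b := l) (by rw [hN' 0 (by decide), t0])
        (by rw [hN' 1 (by decide), hN 1 (by decide), h1])
        (by rw [hN' 2 (by decide), hN 2 (by decide), h2]) hul
        (by rw [hN' 6 (by decide), htk]) hk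
        (by rw [hN' 8 (by decide), hN 8 (by decide)]; exact hF)
      have u4 : u.real 4 = s.real 4 := by rw [hR' 4 (by decide), t4]
      rw [u4] at hent
      rw [setNat_real]
      refine ⟨fun b hb => ?_, fun j hj => ?_⟩
      · rw [hent]
        by_cases hbl : b = l
        · simp [hbl]
        · rw [if_neg (by omega), j1 b (by omega)]
      · rw [hent, if_neg (by omega), j2 j hj]

end FirstPriceAuction

namespace FirstPriceAuction

open RealRAM RealRAM.Code

/-! ## The program of a round -/

/-- The program that the learner runs in each round. -/
def roundCode : Code :=
  .seq powerCode (.seq tableCode (.seq rateCode (.seq updateCode (.seq transitionCode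
    (.seq reductionCode (.seq solveCode (.seq normalizeCode outputCode)))))))

/-- The round is timed in pieces, because `nat 1 0` and `nat 2 0` can serve as loop bounds only
after they have been computed. -/
theorem runs_roundCode {N : ℕ} (s : Mem) (h0 : s.nat 0 0 = N) :
    ∃ n, Runs roundCode.compile s (roundCode.run s) n ∧ 4 ^ N ≤ n ∧
      n ≤ roundCode.cost (4 ^ N) := by
  have hN : N ≤ 4 ^ N := (Nat.lt_pow_self (by norm_num)).le
  obtain ⟨n₁, r₁, c₁, -⟩ := runs_compile powerCode [0] (by decide) (4 ^ N) s (by simp [h0, hN])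
  set s₁ := powerCode.run s with hs₁
  have a0 : s₁.nat 0 = s.nat 0 := run_nat _ _ (by decide)
  have a1 : s₁.nat 1 0 = 4 ^ N := by rw [hs₁, run_powerCode, h0]
  obtain ⟨n₂, r₂, c₂, -⟩ := runs_compile tableCode [0, 1] (by decide) (4 ^ N) s₁
    (by simp [a0, a1, h0, hN])
  have hm := (run_tableCode s₁ (by rw [a0, h0]) a1).1
  set s₂ := tableCode.run s₁ with hs₂
  have b0 : s₂.nat 0 0 = N := by rw [hs₂, run_nat _ _ (by decide), a0, h0]
  have b1 : s₂.nat 1 0 = 4 ^ N := by rw [hs₂, run_nat _ _ (by decide), a1]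
  obtain ⟨n₃, r₃, c₃, -⟩ := runs_compile rateCode [] (by decide) (4 ^ N) s₂ (by simp)
  set s₃ := rateCode.run s₂ with hs₃
  have d : s₃.nat = s₂.nat := rfl
  -- This loop has exactly `4 ^ N` passes, more than there are strategies to update, and supplies
  -- the lower bound.
  obtain ⟨n₄, r₄, c₄, l₄⟩ := runs_compile updateCode [0, 1] (by decide) (4 ^ N) s₃
    (by simp [d, b0, b1, hN])
  set s₄ := updateCode.run s₃ with hs₄
  have e0 : s₄.nat 0 0 = N := by rw [hs₄, run_nat _ _ (by decide), d, b0]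
  have e2 : s₄.nat 2 0 = numStrategies N := by rw [hs₄, run_nat _ _ (by decide), d, hm]
  obtain ⟨n₅, r₅, c₅, -⟩ := runs_compile (.seq transitionCode
    (.seq reductionCode (.seq solveCode (.seq normalizeCode outputCode)))) [0, 2] (by decide)
    (4 ^ N) s₄ (by
      simp only [List.mem_cons, List.not_mem_nil, or_false, forall_eq_or_imp, forall_eq, e0, e2]
      exact ⟨hN, length_monotoneBids_le le_rfl⟩)
  refine ⟨_, .seq r₁ (.seq r₂ (.seq r₃ (.seq r₄ r₅))), ?_, ?_⟩
  · have := l₄ _ _ _ rfl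
    rw [d, b1] at this
    omega
  · simp only [roundCode, cost] at c₁ c₂ c₃ c₄ c₅ ⊢
    omega

theorem exists_cost_roundCode_le :
    ∃ b : ℝ, ∀ N : ℕ, 0 < N → (roundCode.cost (4 ^ N) : ℝ) ≤ 2 ^ (b * (N : ℝ)) := by
  obtain ⟨C, d, h⟩ := roundCode.exists_cost_le
  -- From `C ≤ 2 ^ (C * N)` and `4 ^ N + 1 ≤ 8 ^ N`, both using `0 < N`.
  refine ⟨((C + 3 * d : ℕ) : ℝ), fun N hN => ?_⟩
  rw [← Nat.cast_mul, Real.rpow_natCast]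
  have h1 : 4 ^ N + 1 ≤ 8 ^ N := by
    have : 4 ^ N < 8 ^ N := Nat.pow_lt_pow_left (by norm_num) (by omega)
    omega
  have h2 : C ≤ 2 ^ (C * N) :=
    (Nat.lt_two_pow_self (n := C)).le.trans
      (Nat.pow_le_pow_right (by norm_num) (Nat.le_mul_of_pos_right _ hN))
  have : roundCode.cost (4 ^ N) ≤ 2 ^ ((C + 3 * d) * N) := by
    calc roundCode.cost (4 ^ N) ≤ C * (4 ^ N + 1) ^ d := h _
      _ ≤ 2 ^ (C * N) * (8 ^ N) ^ d := Nat.mul_le_mul h2 (Nat.pow_le_pow_left h1 d)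
      _ = 2 ^ ((C + 3 * d) * N) := by
        rw [show (8 : ℕ) = 2 ^ 3 by norm_num, ← pow_mul, ← pow_mul, ← pow_add]
        congr 1
        ring
  exact_mod_cast this

/-- The memory `s` after a round contains the weights `W`, a distribution over strategies that is
invariant under the quantile couplings for these weights, and the probabilities of the bids for
this distribution. -/
structure IsRound (N : ℕ) (W : ℕ → ℕ → ℝ) (s : Mem) : Prop where
  weight : ∀ f < numStrategies N, ∀ b < N, 1 + s.real 3 (f * N + b) = W f b
  nonneg : ∀ f < numStrategies N, 0 ≤ s.real 4 f
  sum_eq_one : ∑ f ∈ Finset.range (numStrategies N), s.real 4 f = 1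
  output : ∀ v < N, ∀ b < N, s.real 2 (v * N + b) =
    ∑ f ∈ Finset.range (numStrategies N), (if strategy N f v = b then s.real 4 f else 0)
  invariant : ∀ v < N, ∀ b < N,
    ∑ f ∈ Finset.range (numStrategies N), (if strategy N f v = b then s.real 4 f else 0) =
      ∑ f ∈ Finset.range (numStrategies N), s.real 4 f * bidProb (W f) N v b

theorem run_roundCode (s : Mem) {N : ℕ} {W : ℕ → ℕ → ℝ} (hN : 0 < N) (h0 : s.nat 0 0 = N)
    (hW : ∀ f < numStrategies N, ∀ b < N, W f b = if s.nat 0 2 ≤ b then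
      (1 + s.real 3 (f * N + b)) * (1 + learningRate N (s.nat 0 1) * s.real 4 f)
      else 1 + s.real 3 (f * N + b))
    (hpos : ∀ f < numStrategies N, ∀ b < N, 0 < W f b)
    (hmono : ∀ f < numStrategies N, ∀ b c, b ≤ c → c < N → W f b ≤ W f c) :
    IsRound N W (roundCode.run s) := by
  set m := numStrategies N with hm
  set s₁ := powerCode.run s with hs₁
  have a0 : s₁.nat 0 = s.nat 0 := run_nat _ _ (by decide)
  have a1 : s₁.nat 1 0 = 4 ^ N := by rw [hs₁, run_powerCode, h0]
  obtain ⟨tm, tF⟩ := run_tableCode s₁ (by rw [a0, h0]) a1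
  set s₂ := tableCode.run s₁ with hs₂
  have b0 : s₂.nat 0 = s.nat 0 := by rw [hs₂, run_nat _ _ (by decide), a0]
  have b1 : s₂.nat 1 0 = 4 ^ N := by rw [hs₂, run_nat _ _ (by decide), a1]
  set s₃ := rateCode.run s₂ with hs₃
  have d : s₃.nat = s₂.nat := rfl
  have d5 : s₃.real 5 0 = learningRate N (s.nat 0 1) :=
    run_rateCode s₂ (by rw [b0, h0]) (by rw [b0]) b1
  have d3 : s₃.real 3 = s.real 3 := by
    rw [hs₃, run_real _ _ (by decide), hs₂, run_real _ _ (by decide), hs₁, run_real _ _ (by decide)]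
  have d4 : s₃.real 4 = s.real 4 := by
    rw [hs₃, run_real _ _ (by decide), hs₂, run_real _ _ (by decide), hs₁, run_real _ _ (by decide)]
  have hupd := run_updateCode s₃ (N := N) (by rw [d, b0, h0])
  rw [d, b1, b0, d3, d4, d5] at hupd
  set s₄ := updateCode.run s₃ with hs₄
  have hV : ∀ f < m, ∀ b < N, 1 + s₄.real 3 (f * N + b) = W f b := by
    intro f hf b hb
    rw [hupd f (hf.trans_le (length_monotoneBids_le le_rfl)) b hb, hW f hf b hb]
    split_ifs
    · ring
    · rfl
  have e0 : s₄.nat 0 0 = N := by rw [hs₄, run_nat _ _ (by decide), d, b0, h0]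
  have e1 : s₄.nat 1 0 = 4 ^ N := by rw [hs₄, run_nat _ _ (by decide), d, b1]
  have e2 : s₄.nat 2 0 = m := by rw [hs₄, run_nat _ _ (by decide), d, tm]
  have e8 : s₄.nat 8 = s₂.nat 8 := by rw [hs₄, run_nat _ _ (by decide), d]
  have htr := run_transitionCode s₄ (W := W) e0 e1 e2 (by rw [e8]; exact tF) hV
  set s₅ := transitionCode.run s₄ with hs₅
  have f2 : s₅.nat 2 0 = m := by rw [hs₅, run_nat _ _ (by decide), e2]
  have hred := run_reductionCode s₅ f2 (Q := fun f g => coupling (W f) N g) htr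
    (fun f _ g _ => coupling_nonneg g) (fun f hf => coupling_zero_pos (hpos f hf))
  set s₆ := reductionCode.run s₅ with hs₆
  have g2 : s₆.nat 2 0 = m := by rw [hs₆, run_nat _ _ (by decide), f2]
  obtain ⟨hs0, hsn⟩ := run_solveCode s₆ (numStrategies_pos N) g2 fun _ _ _ _ => rfl
  set s₇ := solveCode.run s₆ with hs₇
  have i2 : s₇.nat 2 0 = m := by rw [hs₇, run_nat _ _ (by decide), g2]
  obtain ⟨hbal, hnn⟩ := hred.solution hs0 hsn
  have hnorm := run_normalizeCode s₇ i2
  set s₈ := normalizeCode.run s₇ with hs₈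
  have hout := run_outputCode s₈ (N := N)
    (by simp only [hs₈, hs₇, hs₆, hs₅]
        rw [run_nat _ _ (by decide), run_nat _ _ (by decide), run_nat _ _ (by decide),
          run_nat _ _ (by decide), e0])
    (by simp only [hs₈, hs₇, hs₆, hs₅]
        rw [run_nat _ _ (by decide), run_nat _ _ (by decide), run_nat _ _ (by decide),
          run_nat _ _ (by decide), e1])
    (by rw [hs₈, run_nat _ _ (by decide), i2])
    (by simp only [hs₈, hs₇, hs₆, hs₅]
        rw [run_nat _ _ (by decide), run_nat _ _ (by decide), run_nat _ _ (by decide),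
          run_nat _ _ (by decide), e8]
        exact tF)
  have hrun : roundCode.run s = outputCode.run s₈ := rfl
  have k4 : (roundCode.run s).real 4 = s₈.real 4 := by rw [hrun, run_real _ _ (by decide)]
  have k3 : (roundCode.run s).real 3 = s₄.real 3 := by
    rw [hrun, run_real _ _ (by decide)]
    simp only [hs₈, hs₇, hs₆, hs₅]
    rw [run_real _ _ (by decide), run_real _ _ (by decide), run_real _ _ (by decide),
      run_real _ _ (by decide)]
  have htot : 0 < ∑ k ∈ Finset.range m, s₇.real 4 k :=
    Finset.sum_pos' (fun k hk => hnn k (Finset.mem_range.1 hk))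
      ⟨0, Finset.mem_range.2 (numStrategies_pos N), by rw [hs0]; exact one_pos⟩
  -- The rows of the coupling matrix sum to one, so balance is stationarity.
  have hstat : ∀ g < m, ∑ f ∈ Finset.range m, s₈.real 4 f * coupling (W f) N g = s₈.real 4 g := by
    intro g hg
    have := hbal g hg
    rw [sum_coupling_eq_one hN (hpos g hg) (hmono g hg), mul_one] at this
    rw [hnorm g hg, ← this, Finset.sum_div]
    refine Finset.sum_congr rfl fun f hf => ?_
    rw [hnorm f (Finset.mem_range.1 hf)]
    ring
  refine ⟨?_, ?_, ?_, ?_, ?_⟩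
  · rw [k3]
    exact hV
  · intro f hf
    rw [k4, hnorm f hf]
    exact div_nonneg (hnn f hf) htot.le
  · rw [k4, Finset.sum_congr rfl fun f hf => hnorm f (Finset.mem_range.1 hf), ← Finset.sum_div,
      div_self htot.ne']
  · rw [k4, hrun]
    exact hout
  · intro v hv b hb
    rw [k4]
    -- Stationarity summed over the strategies that bid `b` at `v`; the couplings then contribute
    -- only their marginals.
    calc ∑ g ∈ Finset.range m, (if strategy N g v = b then s₈.real 4 g else 0)
        = ∑ g ∈ Finset.range m, ∑ f ∈ Finset.range m,
            s₈.real 4 f * (if strategy N g v = b then coupling (W f) N g else 0) := by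
          refine Finset.sum_congr rfl fun g hg => ?_
          split_ifs
          · exact (hstat g (Finset.mem_range.1 hg)).symm
          · simp
      _ = ∑ f ∈ Finset.range m, s₈.real 4 f * bidProb (W f) N v b := by
          rw [Finset.sum_comm]
          refine Finset.sum_congr rfl fun f hf => ?_
          rw [← Finset.mul_sum, sum_coupling (hpos f (Finset.mem_range.1 hf))
            (hmono f (Finset.mem_range.1 hf)) hv hb]

end FirstPriceAuction

/-! ## Polytope swap regret -/

namespace BayesianGame

variable {M N C : ℕ}

/-- Utility depends only on the marginals, so equivalent mixed strategies are interchangeable in it.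
-/
theorem uLMixed_eq (G : BayesianGame M N C) (i : Fin M) (β : MixedStrategy N C) :
    G.uLMixed i β = ∑ c, G.p c * ∑ j, β.marginal c j * G.uL i j c := by
  rw [uLMixed, Finset.sum_comm]
  refine Finset.sum_congr rfl fun c _ => ?_
  simp only [MixedStrategy.marginal, Finset.sum_filter, Finset.sum_mul, Finset.mul_sum]
  rw [Finset.sum_comm]
  refine Finset.sum_congr rfl fun f _ => ?_
  rw [Finset.sum_eq_single (f c)]
  · simp only [if_true]
    ring
  · intro j _ hj
    simp [Ne.symm hj]
  · simp

theorem sum_mul_uLPure (G : BayesianGame M N C) (i : Fin M) (β : MixedStrategy N C) :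
    ∑ f, β.1 f * G.uLPure i f = G.uLMixed i β := by
  simp only [uLPure, uLMixed, Finset.mul_sum, mul_assoc]

/-- An upper bound for the polytope swap regret from one decomposition. -/
theorem polytopeSwapRegret_le (G : BayesianGame M N C) {T : ℕ} (i : Fin T → Fin M)
    (β ρ : Fin T → MixedStrategy N C) (hρ : ∀ t, (β t).Equivalent (ρ t)) {B : ℝ}
    (hB : ∀ π, G.swapGain i β ρ π ≤ B) : G.polytopeSwapRegret i β ≤ B := by
  have : Nonempty (PureStrategy N C → PureStrategy N C) := ⟨id⟩
  -- The infimum is over a family bounded below, because the identity swap always gains `0`.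
  refine ciInf_le_of_le ⟨0, ?_⟩ ⟨ρ, hρ⟩ (ciSup_le hB)
  rintro _ ⟨σ, rfl⟩
  refine le_ciSup_of_le (Set.finite_range _).bddAbove id (le_of_eq ?_)
  refine (Finset.sum_eq_zero fun t _ => ?_).symm
  simp only [id_eq]
  rw [sum_mul_uLPure, uLMixed_eq, uLMixed_eq]
  simp [σ.2 t _ _]

end BayesianGame

/-! ### Swap regret of mixtures of monotone strategies. -/

namespace FirstPriceAuction

open RealRAM RealRAM.Code

variable {N : ℕ}

/-- The pure strategy with index `k` in the list of monotone strategies. -/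
def pureStrategy (N k : ℕ) : PureStrategy N N :=
  fun c => ⟨strategy N k c, (strategy_le k c).trans_lt c.2⟩

open Classical in
/-- The mixed strategy that plays `pureStrategy N k` with probability `ρ k`. -/
def mixture (N : ℕ) (ρ : ℕ → ℝ) (h0 : ∀ k < numStrategies N, 0 ≤ ρ k)
    (h1 : ∑ k ∈ Finset.range (numStrategies N), ρ k = 1) : MixedStrategy N N :=
  ⟨fun f => ∑ k ∈ Finset.range (numStrategies N), if pureStrategy N k = f then ρ k else 0, by
    refine ⟨fun f => Finset.sum_nonneg fun k hk => ?_, ?_⟩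
    · split_ifs
      · exact h0 k (Finset.mem_range.1 hk)
      · exact le_rfl
    · rw [Finset.sum_comm]
      simpa using h1⟩

theorem sum_mixture_mul {ρ : ℕ → ℝ} (h0 : ∀ k < numStrategies N, 0 ≤ ρ k)
    (h1 : ∑ k ∈ Finset.range (numStrategies N), ρ k = 1) (h : PureStrategy N N → ℝ) :
    ∑ f, (mixture N ρ h0 h1).1 f * h f =
      ∑ k ∈ Finset.range (numStrategies N), ρ k * h (pureStrategy N k) := by
  classical
  simp only [mixture, Finset.sum_mul]
  rw [Finset.sum_comm]
  refine Finset.sum_congr rfl fun k _ => ?_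
  rw [Finset.sum_eq_single (pureStrategy N k)]
  · simp
  · intro f _ hf
    simp [Ne.symm hf]
  · simp

theorem marginal_mixture {ρ : ℕ → ℝ} (h0 : ∀ k < numStrategies N, 0 ≤ ρ k)
    (h1 : ∑ k ∈ Finset.range (numStrategies N), ρ k = 1) (c j : Fin N) :
    (mixture N ρ h0 h1).marginal c j =
      ∑ k ∈ Finset.range (numStrategies N), if strategy N k c = j then ρ k else 0 := by
  have := sum_mixture_mul h0 h1 (fun f => if f c = j then 1 else 0)
  simp only [mul_ite, mul_one, mul_zero] at this
  rw [MixedStrategy.marginal, Finset.sum_filter, this]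
  refine Finset.sum_congr rfl fun k _ => ?_
  simp [pureStrategy, Fin.ext_iff]

theorem uL_game (A : FirstPriceAuction N) (i j c : Fin N) :
    A.game.uL i j c = A.ε * gain i c j := by
  simp only [game, gain, Fin.le_def]
  split_ifs
  · ring
  · simp

/-- Bidding the value gains nothing and bidding more never helps, so swap targets may be assumed not
to overbid. -/
theorem gain_le_gain_min (i v b : ℕ) : gain i v b ≤ gain i v (min b v) := by
  rcases le_total b v with h | h
  · rw [min_eq_left h]
  · rw [min_eq_right h]
    have : ((v : ℝ)) ≤ b := by exact_mod_cast h
    unfold gain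
    split_ifs <;> simp <;> linarith

/-- The gain of the swap function `π` in terms of the regrets of the strategies in the mixture. -/
theorem swapGain_mixture (A : FirstPriceAuction N) {T : ℕ} (i : Fin T → Fin N)
    (β : Fin T → MixedStrategy N N) (ρ : Fin T → ℕ → ℝ) (q : Fin T → ℕ → ℕ → ℕ → ℝ)
    (h0 : ∀ t, ∀ k < numStrategies N, 0 ≤ ρ t k)
    (h1 : ∀ t, ∑ k ∈ Finset.range (numStrategies N), ρ t k = 1)
    (hβ : ∀ t c j, (β t).marginal c j =
      ∑ k ∈ Finset.range (numStrategies N), ρ t k * q t k c j)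
    (π : PureStrategy N N → PureStrategy N N) :
    A.game.swapGain i β (fun t => mixture N (ρ t) (h0 t) (h1 t)) π =
      A.ε * ∑ c, A.prior c * ∑ k ∈ Finset.range (numStrategies N), ∑ t,
        ρ t k * (gain (i t) c (π (pureStrategy N k) c) -
          ∑ j ∈ Finset.range N, q t k c j * gain (i t) c j) := by
  -- The swapped term uses the weights `ρ`; the played term needs only marginals, which are expanded
  -- through the recommendations `q`.
  have hround : ∀ t, (∑ f, (mixture N (ρ t) (h0 t) (h1 t)).1 f * A.game.uLPure (i t) (π f)) -
      A.game.uLMixed (i t) (β t) = ∑ c, A.ε * (A.prior c *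
        ∑ k ∈ Finset.range (numStrategies N), ρ t k *
          (gain (i t) c (π (pureStrategy N k) c) -
            ∑ j ∈ Finset.range N, q t k c j * gain (i t) c j)) := by
    intro t
    rw [sum_mixture_mul (h0 t) (h1 t) fun f => A.game.uLPure (i t) (π f),
      BayesianGame.uLMixed_eq]
    simp only [BayesianGame.uLPure, uL_game, hβ]
    simp only [Finset.mul_sum (s := Finset.univ)]
    rw [Finset.sum_comm, ← Finset.sum_sub_distrib]
    refine Finset.sum_congr rfl fun c _ => ?_
    simp only [mul_sub, Finset.sum_sub_distrib, Finset.mul_sum, Finset.sum_mul]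
    congr 1
    · refine Finset.sum_congr rfl fun k _ => ?_
      simp only [game]
      ring
    · rw [Finset.sum_comm]
      refine Finset.sum_congr rfl fun k _ => ?_
      rw [← Fin.sum_univ_eq_sum_range
        (fun j => A.ε * (A.prior c * (ρ t k * (q t k c j * gain (i t) c j))))]
      refine Finset.sum_congr rfl fun j _ => ?_
      simp only [game]
      ring
  rw [BayesianGame.swapGain, Finset.sum_congr rfl fun t _ => hround t, Finset.sum_comm,
    Finset.mul_sum]
  refine Finset.sum_congr rfl fun c _ => ?_
  rw [← Finset.mul_sum, ← Finset.mul_sum, Finset.sum_comm]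

/-- Identifies the second-order term of the regret with the target bound. -/
theorem learningRate_eq (hN : 0 < N) (T : ℕ) :
    learningRate N T * N ^ 2 * T = Real.sqrt (4 ^ N * N * T) := by
  have hN' : (N : ℝ) ≠ 0 := by positivity
  rcases T.eq_zero_or_pos with rfl | hT
  · simp
  have hT' : (T : ℝ) ≠ 0 := by positivity
  refine (Real.sqrt_eq_iff_mul_self_eq (by positivity)
    (by unfold learningRate; positivity)).2 ?_ |>.symm
  rw [show learningRate N T * N ^ 2 * T * (learningRate N T * N ^ 2 * T) =
    learningRate N T ^ 2 * (N ^ 2 * T) ^ 2 by ring, learningRate, Real.sq_sqrt (by positivity)]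
  push_cast
  field_simp

/-- The numeric estimate behind the regret bound. -/
theorem log_div_learningRate_le (hN : 0 < N) {T : ℕ} (hT : 0 < T) :
    numStrategies N * (Real.log N / learningRate N T) ≤ 2 * Real.sqrt (4 ^ N * N * T) := by
  have hN' : (0 : ℝ) < N := by exact_mod_cast hN
  have hT' : (0 : ℝ) < T := by exact_mod_cast hT
  have hη : 0 < learningRate N T := by unfold learningRate; positivity
  have hη2 : learningRate N T ^ 2 * (N ^ 3 * T) = 4 ^ N := by
    rw [learningRate, Real.sq_sqrt (by positivity)]
    push_cast
    field_simp
  -- From `log N = 2 log √N`.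
  have hlog : Real.log N ≤ 2 * Real.sqrt N := by
    have := Real.log_le_sub_one_of_pos (Real.sqrt_pos.2 hN')
    rw [Real.log_sqrt hN'.le] at this
    linarith
  have hm := length_monotoneBids_mul_sqrt_le N
  rw [← learningRate_eq hN, ← mul_div_assoc, div_le_iff₀ hη]
  calc (numStrategies N : ℝ) * Real.log N ≤ numStrategies N * (2 * Real.sqrt N) := by gcongr
    _ ≤ 2 * (4 ^ N / N) := by
      have : (numStrategies N : ℝ) * Real.sqrt N ≤ 4 ^ N / N := by
        rw [le_div_iff₀ hN']
        simpa only [numStrategies, mul_assoc, mul_comm (Real.sqrt N)] using hm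
      linarith
    _ = 2 * (learningRate N T * N ^ 2 * T) * learningRate N T := by
      rw [← hη2]
      field_simp

/-- The regret of the learner whose decomposition over monotone strategies is invariant under the
multiplicative weights of all strategies. -/
theorem swapGain_mixture_le (A : FirstPriceAuction N) {T : ℕ} (i : ℕ → ℕ) (b : Fin T → Fin N)
    (hi : ∀ t : Fin T, i t = b t)
    (β : Fin T → MixedStrategy N N) (ρ : ℕ → ℕ → ℝ) (W : ℕ → ℕ → ℕ → ℝ)
    (h0 : ∀ t, ∀ k < numStrategies N, 0 ≤ ρ t k)
    (h1 : ∀ t, ∑ k ∈ Finset.range (numStrategies N), ρ t k = 1)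
    (hβ : ∀ t c j, (β t).marginal c j =
      ∑ k ∈ Finset.range (numStrategies N), ρ t k * bidProb (W t k) N c j)
    (hW0 : ∀ k < numStrategies N, ∀ b < N, W 0 k b = 1)
    (hW : ∀ t, ∀ k < numStrategies N, ∀ b < N, W (t + 1) k b =
      if i t ≤ b then W t k b * (1 + learningRate N T * ρ t k) else W t k b)
    (hpos : ∀ t, ∀ k < numStrategies N, ∀ b < N, 0 < W t k b)
    (π : PureStrategy N N → PureStrategy N N) :
    A.game.swapGain b β (fun t => mixture N (ρ t) (h0 t) (h1 t)) π ≤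
      4 * A.ε * Real.sqrt ((4 : ℝ) ^ N * (N : ℝ) * (T : ℝ)) := by
  have hN : 0 < N := by
    rcases N.eq_zero_or_pos with rfl | h
    · simpa using A.prior_mem.2
    · exact h
  have hN' : (0 : ℝ) < N := by exact_mod_cast hN
  set R := Real.sqrt ((4 : ℝ) ^ N * (N : ℝ) * (T : ℝ)) with hR
  have hRnn : 0 ≤ R := Real.sqrt_nonneg _
  rw [swapGain_mixture A b β (fun t => ρ t) (fun t k c j => bidProb (W t k) N c j) (fun t => h0 t)
    (fun t => h1 t) hβ π, mul_comm 4, mul_assoc]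
  refine mul_le_mul_of_nonneg_left ?_ A.ε_pos.le
  have hprior : 4 * R = ∑ c, A.prior c * (4 * R) := by
    rw [← Finset.sum_mul, A.prior_mem.2, one_mul]
  rw [hprior]
  refine Finset.sum_le_sum fun c _ => mul_le_mul_of_nonneg_left ?_ (A.prior_mem.1 c)
  have hmin : ∀ k ∈ Finset.range (numStrategies N), ∑ t : Fin T, ρ t k *
      (gain (b t) c (π (pureStrategy N k) c) -
        ∑ j ∈ Finset.range N, bidProb (W t k) N c j * gain (b t) c j) ≤
      ∑ t ∈ Finset.range T, ρ t k * (gain (i t) c (min (π (pureStrategy N k) c) c) -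
        ∑ j ∈ Finset.range N, bidProb (W t k) N c j * gain (i t) c j) := by
    intro k hk
    rw [← Fin.sum_univ_eq_sum_range (fun t => ρ t k * (gain (i t) c
      (min (π (pureStrategy N k) c) c) -
        ∑ j ∈ Finset.range N, bidProb (W t k) N c j * gain (i t) c j))]
    refine Finset.sum_le_sum fun t _ => ?_
    rw [hi]
    exact mul_le_mul_of_nonneg_left (sub_le_sub_right (gain_le_gain_min _ _ _) _)
      (h0 t k (Finset.mem_range.1 hk))
  refine (Finset.sum_le_sum hmin).trans ?_
  -- This is exactly the condition `N * η ≤ 1` required by the multiplicative weights; for smaller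
  -- `T` the trivial regret `N * T` suffices.
  by_cases hT : (4 : ℝ) ^ N ≤ N * T
  · have hTpos : 0 < T := by
      rcases T.eq_zero_or_pos with rfl | h
      · have : (0 : ℝ) < 4 ^ N := by positivity
        simp at hT
        linarith
      · exact h
    have hT' : (0 : ℝ) < T := by exact_mod_cast hTpos
    set η := learningRate N T with hη
    have hηpos : 0 < η := by rw [hη]; unfold learningRate; positivity
    have hηN : N * η ≤ 1 := by
      refine (sq_le_one_iff₀ (by positivity)).1 ?_
      rw [mul_pow, hη, learningRate, Real.sq_sqrt (by positivity)]
      push_cast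
      rw [mul_div_assoc', div_le_one (by positivity)]
      have : (N : ℝ) ^ 2 * 4 ^ N ≤ N ^ 2 * (N * T) := by gcongr
      linarith
    have hle : ∀ t, ∀ k < numStrategies N, ρ t k ≤ 1 := fun t k hk => by
      rw [← h1 t]
      exact Finset.single_le_sum (fun l hl => h0 t l (Finset.mem_range.1 hl))
        (Finset.mem_range.2 hk)
    have hreg : ∀ k ∈ Finset.range (numStrategies N),
        ∑ t ∈ Finset.range T, ρ t k * (gain (i t) c (min (π (pureStrategy N k) c) c) -
          ∑ j ∈ Finset.range N, bidProb (W t k) N c j * gain (i t) c j) ≤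
        Real.log N / η + 2 * N ^ 2 * η * ∑ t ∈ Finset.range T, ρ t k := by
      intro k hk
      have hk := Finset.mem_range.1 hk
      have := regret_multiplicativeWeights (N := N) (T := T) (v := c)
        (b := min (π (pureStrategy N k) c) c) (fun t => W t k) (fun t => η * ρ t k) i c.2
        (min_le_right _ _) (hW0 k hk) (fun t _ b hb => hW t k hk b hb)
        (fun t _ => ⟨mul_nonneg hηpos.le (h0 t k hk), by
          rw [← mul_assoc]
          exact mul_le_one₀ hηN (h0 t k hk) (hle t k hk)⟩)
      simp only [mul_assoc η, ← Finset.mul_sum, mul_pow] at this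
      -- Replacing `ρ ^ 2` by `ρ` lets the second-order terms of all learners add up to `T` instead
      -- of `T` per learner.
      have hsq : ∑ t ∈ Finset.range T, ρ t k ^ 2 ≤ ∑ t ∈ Finset.range T, ρ t k :=
        Finset.sum_le_sum fun t _ => by
          nlinarith [h0 t k hk, hle t k hk]
      rw [← mul_le_mul_iff_right₀ hηpos]
      refine this.trans ?_
      rw [mul_add, mul_div_cancel₀ _ hηpos.ne']
      have : η ^ 2 * ∑ t ∈ Finset.range T, ρ t k ^ 2 ≤ η ^ 2 * ∑ t ∈ Finset.range T, ρ t k := by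
        gcongr
      nlinarith [mul_le_mul_of_nonneg_left this (by positivity : (0 : ℝ) ≤ 2 * N ^ 2)]
    refine (Finset.sum_le_sum hreg).trans ?_
    rw [Finset.sum_add_distrib, ← Finset.mul_sum, Finset.sum_comm,
      Finset.sum_congr rfl fun t _ => h1 t]
    simp only [Finset.sum_const, Finset.card_range, nsmul_eq_mul, mul_one]
    have e1 := log_div_learningRate_le hN hTpos
    have e2 := learningRate_eq hN T
    rw [← hR] at e1 e2
    linarith
  · have hsmall : (N : ℝ) * T ≤ R := by
      rw [hR]
      refine Real.le_sqrt_of_sq_le ?_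
      have : (N : ℝ) * T * (N * T) ≤ 4 ^ N * (N * T) := by
        gcongr
        exact (not_le.1 hT).le
      nlinarith
    rw [Finset.sum_comm]
    have hround : ∀ t ∈ Finset.range T, ∑ k ∈ Finset.range (numStrategies N),
        ρ t k * (gain (i t) c (min (π (pureStrategy N k) c) c) -
          ∑ j ∈ Finset.range N, bidProb (W t k) N c j * gain (i t) c j) ≤ N := by
      intro t _
      calc _ ≤ ∑ k ∈ Finset.range (numStrategies N), ρ t k * (N : ℝ) := by
            refine Finset.sum_le_sum fun k hk => ?_
            have hk := Finset.mem_range.1 hk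
            refine mul_le_mul_of_nonneg_left ?_ (h0 t k hk)
            have g1 : gain (i t) c (min (π (pureStrategy N k) c) c) ≤ N :=
              gain_le.trans (by exact_mod_cast c.2.le)
            have g2 : 0 ≤ ∑ j ∈ Finset.range N, bidProb (W t k) N c j * gain (i t) c j := by
              refine Finset.sum_nonneg fun j hj => ?_
              by_cases hjc : j ≤ c
              · exact mul_nonneg (bidProb_nonneg (hpos t k hk) (Finset.mem_range.1 hj))
                  (gain_nonneg hjc)
              · simp [bidProb, bidWeight, hjc]
            linarith
        _ = N := by rw [← Finset.sum_mul, h1, one_mul]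
    refine (Finset.sum_le_sum hround).trans ?_
    simp only [Finset.sum_const, Finset.card_range, nsmul_eq_mul]
    linarith

/-! ## The play of the learner -/

/-- The memory at the end of round `t`, if the optimizer bids `i 0, i 1, …`. -/
def play (A : FirstPriceAuction N) (T : ℕ) (i : ℕ → ℕ) : ℕ → Mem
  | 0 => roundCode.run (initialMem A T)
  | t + 1 => roundCode.run (observeBid (play A T i t) (i t))

theorem play_zero (A : FirstPriceAuction N) (T : ℕ) (i : ℕ → ℕ) :
    play A T i 0 = roundCode.run (initialMem A T) := by rw [play]

theorem play_succ (A : FirstPriceAuction N) (T : ℕ) (i : ℕ → ℕ) (t : ℕ) :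
    play A T i (t + 1) = roundCode.run (observeBid (play A T i t) (i t)) := by rw [play]

theorem play_nat (A : FirstPriceAuction N) (T : ℕ) (i : ℕ → ℕ) (t : ℕ) :
    (play A T i t).nat 0 0 = N ∧ (play A T i t).nat 0 1 = T := by
  induction t with
  | zero =>
    rw [play, run_nat _ _ (by decide)]
    simp [initialMem]
  | succ t ih =>
    rw [play, run_nat _ _ (by decide)]
    simpa [observeBid, setNat_nat] using ih

/-- The weights in round `t`. -/
def weights (A : FirstPriceAuction N) (T : ℕ) (i : ℕ → ℕ) (t f b : ℕ) : ℝ :=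
  1 + (play A T i t).real 3 (f * N + b)

/-- Monotonicity of the weights persists because the winning bids form an upper set and their factor
is at least `1`; this is what the next coupling needs. -/
theorem isRound_play (A : FirstPriceAuction N) (hN : 0 < N) (T : ℕ) (i : ℕ → ℕ) (t : ℕ) :
    IsRound N (weights A T i t) (play A T i t) ∧
    (∀ f < numStrategies N, ∀ b < N, 0 < weights A T i t f b) ∧
    (∀ f < numStrategies N, ∀ b c, b ≤ c → c < N → weights A T i t f b ≤ weights A T i t f c) ∧
    (t = 0 → ∀ f < numStrategies N, ∀ b < N, weights A T i t f b = 1) ∧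
    ∀ s, t = s + 1 → ∀ f < numStrategies N, ∀ b < N, weights A T i t f b =
      if i s ≤ b then weights A T i s f b * (1 + learningRate N T * (play A T i s).real 4 f)
      else weights A T i s f b := by
  -- The bid probabilities involve weights at bids below `N` only.
  have hself : ∀ {t : ℕ} {W : ℕ → ℕ → ℝ}, IsRound N W (play A T i t) →
      IsRound N (weights A T i t) (play A T i t) := fun {t W} h =>
    ⟨fun _ _ _ _ => rfl, h.nonneg, h.sum_eq_one, h.output, fun v hv b hb => by
      rw [h.invariant v hv b hb]
      refine Finset.sum_congr rfl fun f hf => ?_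
      have hw : ∀ j < N, weights A T i t f j = W f j := h.weight f (Finset.mem_range.1 hf)
      have hbw : ∀ j < N, bidWeight (W f) v j = bidWeight (weights A T i t f) v j := fun j hj => by
        simp only [bidWeight, hw j hj]
      have hcw : cumWeight (W f) v N = cumWeight (weights A T i t f) v N :=
        Finset.sum_congr rfl fun j hj => hbw j (Finset.mem_range.1 hj)
      rw [bidProb, bidProb, hbw b hb, hcw]⟩
  induction t with
  | zero =>
    have h := run_roundCode (initialMem A T) (W := fun _ _ => 1) hN (by simp [initialMem])
      (fun f _ b _ => by simp [initialMem]) (fun _ _ _ _ => one_pos) (fun _ _ _ _ _ _ => le_rfl)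
    rw [← play_zero A T i] at h
    have hw : ∀ f < numStrategies N, ∀ b < N, weights A T i 0 f b = 1 := h.weight
    refine ⟨hself (t := 0) h, fun f hf b hb => by rw [hw f hf b hb]; exact one_pos,
      fun f hf b c hbc hc => by rw [hw f hf b (by omega), hw f hf c hc], fun _ => hw,
      fun s hs => by omega⟩
  | succ t ih =>
    obtain ⟨hr, hpos, hmono, -⟩ := ih
    obtain ⟨n0, n1⟩ := play_nat A T i t
    have hη : 0 ≤ learningRate N T := Real.sqrt_nonneg _
    have hx : ∀ f < numStrategies N, 1 ≤ 1 + learningRate N T * (play A T i t).real 4 f :=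
      fun f hf => le_add_of_nonneg_right (mul_nonneg hη (hr.nonneg f hf))
    have hposW : ∀ f < numStrategies N, ∀ b < N, 0 < (if i t ≤ b then
        weights A T i t f b * (1 + learningRate N T * (play A T i t).real 4 f)
        else weights A T i t f b) := by
      intro f hf b hb
      have h1 := hpos f hf b hb
      have h2 := hx f hf
      split_ifs <;> positivity
    have hmonoW : ∀ f < numStrategies N, ∀ b c, b ≤ c → c < N → (if i t ≤ b then
        weights A T i t f b * (1 + learningRate N T * (play A T i t).real 4 f)
        else weights A T i t f b) ≤ (if i t ≤ c then
        weights A T i t f c * (1 + learningRate N T * (play A T i t).real 4 f)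
        else weights A T i t f c) := by
      intro f hf b c hbc hc
      have h1 := hmono f hf b c hbc hc
      have h2 := hx f hf
      have h3 := hpos f hf b (by omega)
      have h4 := hpos f hf c hc
      split_ifs with hb hc' hc'
      · exact mul_le_mul_of_nonneg_right h1 (by linarith)
      · omega
      · nlinarith
      · exact h1
    have h := run_roundCode (observeBid (play A T i t) (i t)) (W := fun f b => if i t ≤ b then
        weights A T i t f b * (1 + learningRate N T * (play A T i t).real 4 f)
        else weights A T i t f b) hN (by simpa [observeBid, setNat_nat] using n0)
      (fun f hf b hb => by simp [observeBid, setNat_nat, n1, weights]) hposW hmonoW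
    rw [← play_succ A T i] at h
    have hw : ∀ f < numStrategies N, ∀ b < N, weights A T i (t + 1) f b = if i t ≤ b then
        weights A T i t f b * (1 + learningRate N T * (play A T i t).real 4 f)
        else weights A T i t f b := h.weight
    refine ⟨hself (t := t + 1) h, fun f hf b hb => by rw [hw f hf b hb]; exact hposW f hf b hb,
      fun f hf b c hbc hc => by
        rw [hw f hf b (by omega), hw f hf c hc]; exact hmonoW f hf b c hbc hc,
      fun h => by omega, fun s hs => ?_⟩
    obtain rfl : t = s := by omega
    exact hw

theorem outputProb_mem {W : ℕ → ℕ → ℝ} {s : Mem} (h : IsRound N W s) (c : Fin N) :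
    outputProb N s c ∈ stdSimplex ℝ (Fin N) := by
  have hout : ∀ j : Fin N, outputProb N s c j = (mixture N (s.real 4) h.nonneg h.sum_eq_one).marginal
      c j := fun j => by
    rw [marginal_mixture]
    exact h.output c c.2 j j.2
  refine ⟨fun j => ?_, ?_⟩
  · rw [hout]
    exact Finset.sum_nonneg fun f _ =>
      (mixture N (s.real 4) h.nonneg h.sum_eq_one).2.1 f
  · simp only [hout, MixedStrategy.marginal]
    rw [Finset.sum_fiberwise]
    exact (mixture N (s.real 4) h.nonneg h.sum_eq_one).2.2

end FirstPriceAuction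

end

/-! ### The main theorem. -/

theorem corollary1 :
    ∃ (P : RealRAM.Program) (K a b : ℝ), 0 < a ∧
      ∀ (N : ℕ) (A : FirstPriceAuction N) (T : ℕ) (i : Fin T → Fin N),
        ∃ (final : Fin T → RealRAM.Mem) (steps : Fin T → ℕ),
          IsPlay A P i final steps ∧
          (∀ t, (2 : ℝ) ^ (a * (N : ℝ)) ≤ (steps t : ℝ) ∧
            (steps t : ℝ) ≤ (2 : ℝ) ^ (b * (N : ℝ))) ∧
          (∀ t c, outputProb N (final t) c ∈ stdSimplex ℝ (Fin N)) ∧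
          ∀ β : Fin T → MixedStrategy N N,
            (∀ t c j, (β t).marginal c j = outputProb N (final t) c j) →
            A.game.polytopeSwapRegret i β ≤
              K * A.ε * Real.sqrt ((4 : ℝ) ^ N * (N : ℝ) * (T : ℝ)) := by
  obtain ⟨b, hb⟩ := FirstPriceAuction.exists_cost_roundCode_le
  refine ⟨FirstPriceAuction.roundCode.compile, 4, 1, b, one_pos, fun N A T i => ?_⟩
  -- There is no probability vector on an empty set of values.
  have hN : 0 < N := by
    rcases N.eq_zero_or_pos with rfl | h
    · simpa using A.prior_mem.2
    · exact h
  set i' : ℕ → ℕ := fun t => if h : t < T then i ⟨t, h⟩ else 0 with hi'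
  have hii : ∀ t : Fin T, i' t = i t := fun t => by simp [hi']
  have hplay := FirstPriceAuction.isRound_play A hN T i'
  have hruns : ∀ t, ∃ n, (match t with
      | 0 => RealRAM.Runs FirstPriceAuction.roundCode.compile (initialMem A T)
          (FirstPriceAuction.play A T i' 0) n
      | t + 1 => RealRAM.Runs FirstPriceAuction.roundCode.compile
          (observeBid (FirstPriceAuction.play A T i' t) (i' t))
          (FirstPriceAuction.play A T i' (t + 1)) n) ∧
      4 ^ N ≤ n ∧ n ≤ FirstPriceAuction.roundCode.cost (4 ^ N) := by
    intro t
    rcases t with _ | t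
    · simp only [FirstPriceAuction.play_zero]
      exact FirstPriceAuction.runs_roundCode _ (by simp [initialMem])
    · simp only [FirstPriceAuction.play_succ]
      exact FirstPriceAuction.runs_roundCode _ (by
        simpa [observeBid, RealRAM.Code.setNat_nat] using
          (FirstPriceAuction.play_nat A T i' t).1)
  choose steps hsteps hlow hupp using hruns
  refine ⟨fun t => FirstPriceAuction.play A T i' t, fun t => steps t, ⟨fun _ => hsteps 0,
    fun t ht => ?_⟩, fun t => ⟨?_, ?_⟩, fun t c => FirstPriceAuction.outputProb_mem (hplay t).1 c,
    fun β hβ => ?_⟩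
  · rw [← hii]
    exact hsteps (t + 1)
  · rw [one_mul, Real.rpow_natCast]
    have h1 : (2 : ℝ) ^ N ≤ 4 ^ N := by gcongr; norm_num
    exact h1.trans (by exact_mod_cast hlow t)
  · exact le_trans (by exact_mod_cast hupp t) (hb N hN)
  -- The stationary distributions serve as decomposition: `output` gives equivalence with `β`, and
  -- `invariant` expresses the same marginals through the learners.
  · refine A.game.polytopeSwapRegret_le i β _ (fun t c j => ?_)
      (FirstPriceAuction.swapGain_mixture_le A i' i hii β
        (fun t => (FirstPriceAuction.play A T i' t).real 4) (FirstPriceAuction.weights A T i')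
        (fun t => (hplay t).1.nonneg) (fun t => (hplay t).1.sum_eq_one) (fun t c j => ?_)
        ((hplay 0).2.2.2.1 rfl) (fun t => (hplay (t + 1)).2.2.2.2 t rfl) fun t => (hplay t).2.1)
    · rw [hβ, FirstPriceAuction.marginal_mixture]
      exact (hplay t).1.output c c.2 j j.2
    · rw [hβ]
      exact ((hplay t).1.output c c.2 j j.2).trans ((hplay t).1.invariant c c.2 j j.2)
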